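/- Let $V,U_1,U_2$ be finite dimensional complex vector spaces of dimensions $n,m_1,m_2$ with $n<m_1+m_2$, and let $0\le p\le m_1$, $0\le q\le m_2$ with $p+q=n$. Put $W=\mathrm{Hom}(V,U_1)\times\mathrm{Hom}(U_2,V)$, let $\mathfrak N(W)=\{(f_1,f_2)\in W\mid f_1\circ f_2=0\}$ be the null cone of the contraction map $(f_1,f_2)\mapsto f_1\circ f_2$, and let $\mathfrak N_{p,q}$ be the Zariski closure in $W$ of $\{(f_1,f_2)\in\mathfrak N(W)\mid \operatorname{rank}f_1=p,\ \operatorname{rank}f_2=q\}$. Write $\mathrm{Grass}_d(E)$ for the Grassmann variety of $d$-dimensional subspaces of $E$, and let $$\widetilde{\mathfrak N}_{p,q}=\{(V_0;f_1,f_2)\mid V_0\in\mathrm{Grass}_q(V),\ f_1\in\mathrm{Hom}(V/V_0,U_1),\ f_2\in\mathrm{Hom}(U_2,V_0)\},$$ $$\widehat{\mathfrak N}_{p,q}=\{(V_0,V_1,V_2;F_1,F_2)\mid F_1\in\mathrm{Hom}(V/V_0,V_1),\ F_2\in\mathrm{Hom}(U_2/V_2,V_0)\},$$ where $(V_0,V_1,V_2)$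 runs over $G=\mathrm{Grass}_q(V)\times\mathrm{Grass}_p(U_1)\times\mathrm{Grass}_{m_2-q}(U_2)$. Both have the structure of subbundles of the trivial bundle with fibre $W$ over $\mathrm{Grass}_q(V)$, respectively $G$. Let $\zeta:\widetilde{\mathfrak N}_{p,q}\to\mathrm{Grass}_q(V)$ and $\tilde\zeta:\widehat{\mathfrak N}_{p,q}\to G$ be the projections, let $\nu:\widetilde{\mathfrak N}_{p,q}\to W$ send $(V_0;f_1,f_2)$ to the pair of composites $V\to V/V_0\to U_1$, $U_2\to V_0\to V$, let $\hat\nu:\widehat{\mathfrak N}_{p,q}\to W$ send $(V_0,V_1,V_2;F_1,F_2)$ to the pair of composites $V\to V/V_0\to V_1\to U_1$, $U_2\to U_2/V_2\to V_0\to V$, and let $f_{p,q}:\widehat{\mathfrak N}_{p,q}\to\widetilde{\mathfrak N}_{p,q}$ send $(V_0,V_1,V_2;F_1,F_2)$ to $V_0$ together with the composites $V/V_0\to V_1\to U_1$, $U_2\to U_2/V_2\to V_0$. Then: (0) $G$, $\widehat{\mathfrak N}_{p,q}$ and $\widetilde{\mathfrak N}_{p,q}$ are algebraic varieties, and $\tilde\zeta$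 makes $\widehat{\mathfrak N}_{p,q}$ an algebraic vector bundle over $G$. (1) $f_{p,q}$ is a surjective birational morphism. The images of $\nu$ and $\hat\nu$ lie in $\mathfrak N_{p,q}$, and $\nu:\widetilde{\mathfrak N}_{p,q}\to\mathfrak N_{p,q}$, $\hat\nu:\widehat{\mathfrak N}_{p,q}\to\mathfrak N_{p,q}$, $\zeta$, $\tilde\zeta$ and the first projection $\mathrm{pr}:G\to\mathrm{Grass}_q(V)$ are morphisms with $\hat\nu=\nu\circ f_{p,q}$ and $\zeta\circ f_{p,q}=\mathrm{pr}\circ\tilde\zeta$. (2) Let $x=(X_1,X_2)\in\mathrm{Grass}_p(U_1)\times\mathrm{Grass}_{m_2-q}(U_2)$, and regard $W^{p,q}=\mathrm{Hom}(V,X_1)\times\mathrm{Hom}(U_2/X_2,V)$ as a subspace of $W$. Then $\dim X_1+\dim U_2/X_2\le n$ (stable range), and $$\mathfrak N_{p,q}\cap W^{p,q}=\{(f_1,f_2)\in\mathfrak N(W)\mid \operatorname{Im}f_1\subset X_1,\ X_2\subset\operatorname{Ker}f_2\}.$$ The embedding $W^{p,q}\to W$ induces an isomorphism of varieties from the null cone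 of the contraction map $W^{p,q}\to\mathrm{Hom}(U_2/X_2,X_1)$ onto $\mathfrak N_{p,q}\cap W^{p,q}$. The map $\hat\nu$ restricts to a resolution of singularities $\tilde\zeta^{-1}(\mathrm{Grass}_q(V)\times\{x\})\to\mathfrak N_{p,q}\cap W^{p,q}$, that is, the source is a smooth variety, the map is proper and birational, and the smooth points of the target are precisely the points with exactly one preimage. Finally, $f_{p,q}$ restricted to $\tilde\zeta^{-1}(\mathrm{Grass}_q(V)\times\{x\})$ is an isomorphism onto a closed subvariety of $\widetilde{\mathfrak N}_{p,q}$. -/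

import Mathlib

open Filter Topology

universe u v w

/-! ### Spaces with functions, morphisms, and algebraic varieties over `ℂ` -/

/-- A space with functions over `ℂ` on the set `X`: a topology together with a sheaf of
`ℂ`-algebras of complex valued functions, in which a section that does not vanish at a point is
invertible near that point.  The sheaf is recorded by the predicate `RegAt f x`, "the germ of `f`
at `x` is the germ of a section"; the sections over an open set `U` are the functions that are
regular at every point of `U`. -/
structure AlgStr (X : Type u) where
  top : TopologicalSpace X
  RegAt : (X → ℂ) → X → Prop
  regAt_congr : ∀ {f g : X → ℂ} {x : X}, f =ᶠ[@nhds X top x] g → RegAt f x → RegAt g x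
  regAt_eventually : ∀ {f : X → ℂ} {x : X}, RegAt f x → ∀ᶠ y in @nhds X top x, RegAt f y
  regAt_const : ∀ (c : ℂ) (x : X), RegAt (fun _ => c) x
  regAt_add : ∀ {f g : X → ℂ} {x : X}, RegAt f x → RegAt g x → RegAt (f + g) x
  regAt_mul : ∀ {f g : X → ℂ} {x : X}, RegAt f x → RegAt g x → RegAt (f * g) x
  eventually_ne : ∀ {f : X → ℂ} {x : X}, RegAt f x → f x ≠ 0 → ∀ᶠ y in @nhds X top x, f y ≠ 0
  regAt_inv : ∀ {f : X → ℂ} {x : X}, RegAt f x → f x ≠ 0 → RegAt f⁻¹ x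

namespace AlgStr

variable {X : Type u} {Y : Type v} {Z : Type w}

/-- Open subsets. -/
def IsOpen (A : AlgStr X) (U : Set X) : Prop := A.top.IsOpen U

/-- Closed subsets. -/
def IsClosed (A : AlgStr X) (S : Set X) : Prop := A.IsOpen Sᶜ

/-- Closure of a subset. -/
def closure (A : AlgStr X) (S : Set X) : Set X := @_root_.closure X A.top S

/-- Dense subsets. -/
def IsDense (A : AlgStr X) (S : Set X) : Prop := @Dense X A.top S

/-- `f` is a regular function on `U`. -/
def RegOn (A : AlgStr X) (f : X → ℂ) (U : Set X) : Prop := ∀ x ∈ U, A.RegAt f x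

/-- The space with functions generated by a directed family of patches `S i` with algebras of
functions `R i`: the sets `{x ∈ S i | h x ≠ 0}`, `h ∈ R i`, form a subbasis of the topology, and
the regular functions are those that are locally of the form `g / h` with `g, h ∈ R i`. -/
def ofPatches {ι : Type w} (S : ι → Set X) (R : ι → Subalgebra ℂ (X → ℂ))
    (cover : ∀ x, ∃ i, x ∈ S i)
    (directed : ∀ i j, ∃ k, S i ∩ S j ⊆ S k ∧ R i ≤ R k ∧ R j ≤ R k) : AlgStr X :=
  let T : TopologicalSpace X :=
    TopologicalSpace.generateFrom {B | ∃ i, ∃ h ∈ R i, B = {x | x ∈ S i ∧ h x ≠ 0}}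
  have nhd : ∀ {i h x}, h ∈ R i → x ∈ S i → h x ≠ 0 →
      ∀ᶠ y in @nhds X T x, y ∈ S i ∧ h y ≠ 0 := fun {i h x} hh hx hx0 =>
    (TopologicalSpace.isOpen_generateFrom_of_mem ⟨i, h, hh, rfl⟩ :
      _root_.IsOpen {x | x ∈ S i ∧ h x ≠ 0}).mem_nhds ⟨hx, hx0⟩
  { top := T
    RegAt := fun f x => ∃ i, x ∈ S i ∧ ∃ g ∈ R i, ∃ h ∈ R i, h x ≠ 0 ∧
      f =ᶠ[@nhds X T x] fun y => g y / h y
    regAt_congr := by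
      rintro f f' x hff ⟨i, hx, g, hg, h, hh, hx0, hf⟩
      exact ⟨i, hx, g, hg, h, hh, hx0, hff.symm.trans hf⟩
    regAt_eventually := by
      rintro f x ⟨i, hx, g, hg, h, hh, hx0, hf⟩
      filter_upwards [eventually_eventually_nhds.2 hf, nhd hh hx hx0] with y hy hy'
      exact ⟨i, hy'.1, g, hg, h, hh, hy'.2, hy⟩
    regAt_const := by
      intro c x
      obtain ⟨i, hi⟩ := cover x
      refine ⟨i, hi, algebraMap ℂ _ c, (R i).algebraMap_mem c, 1, (R i).one_mem, by simp, ?_⟩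
      exact Eventually.of_forall fun y => by simp
    regAt_add := by
      rintro f f' x ⟨i, hx, g, hg, h, hh, hx0, hf⟩ ⟨j, hx', g', hg', h', hh', hx0', hf'⟩
      obtain ⟨k, hS, hi, hj⟩ := directed i j
      refine ⟨k, hS ⟨hx, hx'⟩, g * h' + h * g',
        (R k).add_mem ((R k).mul_mem (hi hg) (hj hh')) ((R k).mul_mem (hi hh) (hj hg')),
        h * h', (R k).mul_mem (hi hh) (hj hh'), mul_ne_zero hx0 hx0', ?_⟩
      filter_upwards [hf, hf', nhd hh hx hx0, nhd hh' hx' hx0'] with y h1 h2 h3 h4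
      simp only [Pi.add_apply, Pi.mul_apply, h1, h2]
      exact div_add_div _ _ h3.2 h4.2
    regAt_mul := by
      rintro f f' x ⟨i, hx, g, hg, h, hh, hx0, hf⟩ ⟨j, hx', g', hg', h', hh', hx0', hf'⟩
      obtain ⟨k, hS, hi, hj⟩ := directed i j
      refine ⟨k, hS ⟨hx, hx'⟩, g * g', (R k).mul_mem (hi hg) (hj hg'),
        h * h', (R k).mul_mem (hi hh) (hj hh'), mul_ne_zero hx0 hx0', ?_⟩
      filter_upwards [hf, hf'] with y h1 h2
      simp only [Pi.mul_apply, h1, h2]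
      exact div_mul_div_comm _ _ _ _
    eventually_ne := by
      rintro f x ⟨i, hx, g, hg, h, hh, hx0, hf⟩ hfx
      have hgx : g x ≠ 0 := by
        rintro h0
        exact hfx (hf.self_of_nhds.trans (by simp [h0]))
      filter_upwards [hf, nhd hh hx hx0, nhd hg hx hgx] with y h1 h2 h3
      rw [h1]
      exact div_ne_zero h3.2 h2.2
    regAt_inv := by
      rintro f x ⟨i, hx, g, hg, h, hh, hx0, hf⟩ hfx
      have hgx : g x ≠ 0 := by
        rintro h0
        exact hfx (hf.self_of_nhds.trans (by simp [h0]))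
      refine ⟨i, hx, h, hh, g, hg, hgx, ?_⟩
      filter_upwards [hf] with y h1
      rw [Pi.inv_apply, h1, inv_div] }

/-- The algebra of polynomial functions on a vector space. -/
def polyFun (E : Type u) [AddCommGroup E] [Module ℂ E] : Subalgebra ℂ (E → ℂ) :=
  Algebra.adjoin ℂ {f | ∃ φ : Module.Dual ℂ E, f = fun x => φ x}

/-- A finite dimensional vector space as an affine space, with its Zariski topology and its
regular functions (locally quotients of polynomial functions). -/
def aff (E : Type u) [AddCommGroup E] [Module ℂ E] : AlgStr E :=
  ofPatches (ι := Unit) (fun _ => Set.univ) (fun _ => polyFun E) (fun _ => ⟨(), trivial⟩)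
    (fun _ _ => ⟨(), fun _ _ => trivial, le_rfl, le_rfl⟩)

/-- The algebra of functions on `X × Y` generated by the functions regular on `U ⊆ X` and those
regular on `V ⊆ Y`. -/
def prodFun (A : AlgStr X) (B : AlgStr Y) (U : Set X) (V : Set Y) : Subalgebra ℂ (X × Y → ℂ) :=
  Algebra.adjoin ℂ ({F | ∃ f, A.RegOn f U ∧ F = fun z => f z.1} ∪
    {F | ∃ g, B.RegOn g V ∧ F = fun z => g z.2})

theorem prodFun_mono (A : AlgStr X) (B : AlgStr Y) {U U' : Set X} {V V' : Set Y}
    (hU : U' ⊆ U) (hV : V' ⊆ V) : prodFun A B U V ≤ prodFun A B U' V' := by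
  refine Algebra.adjoin_mono (Set.union_subset_union ?_ ?_)
  · rintro F ⟨f, hf, rfl⟩
    exact ⟨f, fun x hx => hf x (hU hx), rfl⟩
  · rintro F ⟨f, hf, rfl⟩
    exact ⟨f, fun x hx => hf x (hV hx), rfl⟩

/-- The product of two spaces with functions (the product in the category of varieties): locally,
regular functions are quotients of polynomials in the regular functions of the two factors. -/
def prod (A : AlgStr X) (B : AlgStr Y) : AlgStr (X × Y) :=
  ofPatches (ι := {U : Set X // A.IsOpen U} × {V : Set Y // B.IsOpen V})
    (fun i => i.1.1 ×ˢ i.2.1) (fun i => prodFun A B i.1.1 i.2.1)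
    (fun _ => ⟨(⟨Set.univ, A.top.isOpen_univ⟩, ⟨Set.univ, B.top.isOpen_univ⟩),
      trivial, trivial⟩)
    (fun i j => ⟨(⟨i.1.1 ∩ j.1.1, A.top.isOpen_inter _ _ i.1.2 j.1.2⟩,
        ⟨i.2.1 ∩ j.2.1, B.top.isOpen_inter _ _ i.2.2 j.2.2⟩),
      fun _ hz => ⟨⟨hz.1.1, hz.2.1⟩, ⟨hz.1.2, hz.2.2⟩⟩,
      prodFun_mono A B Set.inter_subset_left Set.inter_subset_left,
      prodFun_mono A B Set.inter_subset_right Set.inter_subset_right⟩)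

/-- The structure induced on `X` by a map `φ : X → Y`: the induced topology, and as regular
functions those that are locally restrictions of regular functions of `Y`. -/
def induced (φ : X → Y) (B : AlgStr Y) : AlgStr X :=
  let T : TopologicalSpace X := TopologicalSpace.induced φ B.top
  have tend : ∀ x, Tendsto φ (@nhds X T x) (@nhds Y B.top (φ x)) := fun x => by
    let := B.top
    exact (continuous_induced_dom (f := φ)).tendsto x
  { top := T
    RegAt := fun f x => ∃ F : Y → ℂ, B.RegAt F (φ x) ∧ f =ᶠ[@nhds X T x] F ∘ φ
    regAt_congr := fun hff ⟨F, hF, h⟩ => ⟨F, hF, hff.symm.trans h⟩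
    regAt_eventually := by
      rintro f x ⟨F, hF, h⟩
      filter_upwards [eventually_eventually_nhds.2 h, (tend x).eventually (B.regAt_eventually hF)]
        with y h1 h2
      exact ⟨F, h2, h1⟩
    regAt_const := fun c x => ⟨fun _ => c, B.regAt_const c _, Eventually.of_forall fun _ => rfl⟩
    regAt_add := by
      rintro f g x ⟨F, hF, h⟩ ⟨G, hG, h'⟩
      exact ⟨F + G, B.regAt_add hF hG, h.add h'⟩
    regAt_mul := by
      rintro f g x ⟨F, hF, h⟩ ⟨G, hG, h'⟩
      exact ⟨F * G, B.regAt_mul hF hG, h.mul h'⟩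
    eventually_ne := by
      rintro f x ⟨F, hF, h⟩ hx
      have hFx : F (φ x) ≠ 0 := by
        have := h.self_of_nhds
        rwa [this] at hx
      filter_upwards [h, (tend x).eventually (B.eventually_ne hF hFx)] with y h1 h2
      rw [h1]
      exact h2
    regAt_inv := by
      rintro f x ⟨F, hF, h⟩ hx
      have hFx : F (φ x) ≠ 0 := by
        have := h.self_of_nhds
        rwa [this] at hx
      exact ⟨F⁻¹, B.regAt_inv hF hFx, h.inv⟩ }

/-- The structure on a (locally closed) subset. -/
def sub (A : AlgStr X) (S : Set X) : AlgStr S := induced Subtype.val A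

/-- The quotient structure along a map `π : X → Y`: a set is open if its preimage is open, and a
function on an open set is regular if its pull-back is regular. -/
def coinduced (π : X → Y) (A : AlgStr X) : AlgStr Y :=
  let T : TopologicalSpace Y := TopologicalSpace.coinduced π A.top
  have cont : ∀ x, Tendsto π (@nhds X A.top x) (@nhds Y T (π x)) := fun x => by
    let := A.top
    exact (continuous_coinduced_rng (f := π)).tendsto x
  { top := T
    RegAt := fun f y => ∃ U : Set Y, T.IsOpen U ∧ y ∈ U ∧ ∀ x, π x ∈ U → A.RegAt (f ∘ π) x
    regAt_congr := by
      rintro f g y hfg ⟨U, hU, hy, h⟩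
      obtain ⟨U', hs, hU', hy'⟩ := mem_nhds_iff.1 hfg
      refine ⟨U ∩ U', T.isOpen_inter _ _ hU hU', ⟨hy, hy'⟩, fun x hx => ?_⟩
      refine A.regAt_congr ?_ (h x hx.1)
      have : ∀ᶠ z in @nhds X A.top x, π z ∈ U' := (cont x).eventually (hU'.mem_nhds hx.2)
      filter_upwards [this] with z hz
      exact hs hz
    regAt_eventually := by
      rintro f y ⟨U, hU, hy, h⟩
      filter_upwards [(show _root_.IsOpen U from hU).mem_nhds hy] with z hz
      exact ⟨U, hU, hz, h⟩
    regAt_const := fun c y => ⟨Set.univ, T.isOpen_univ, trivial, fun x _ => A.regAt_const c x⟩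
    regAt_add := by
      rintro f g y ⟨U, hU, hy, h⟩ ⟨U', hU', hy', h'⟩
      exact ⟨U ∩ U', T.isOpen_inter _ _ hU hU', ⟨hy, hy'⟩,
        fun x hx => A.regAt_add (h x hx.1) (h' x hx.2)⟩
    regAt_mul := by
      rintro f g y ⟨U, hU, hy, h⟩ ⟨U', hU', hy', h'⟩
      exact ⟨U ∩ U', T.isOpen_inter _ _ hU hU', ⟨hy, hy'⟩,
        fun x hx => A.regAt_mul (h x hx.1) (h' x hx.2)⟩
    eventually_ne := by
      rintro f y ⟨U, hU, hy, h⟩ hf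
      have hO : T.IsOpen (U ∩ {z | f z ≠ 0}) := by
        let := A.top
        change _root_.IsOpen (π ⁻¹' (U ∩ {z | f z ≠ 0}))
        rw [isOpen_iff_eventually]
        rintro x ⟨hx, hx'⟩
        have h1 : ∀ᶠ z in 𝓝 x, π z ∈ U :=
          (cont x).eventually ((show _root_.IsOpen U from hU).mem_nhds hx)
        filter_upwards [h1, A.eventually_ne (h x hx) hx'] with z hz hz'
        exact ⟨hz, hz'⟩
      have hO' : ∀ᶠ z in 𝓝 y, z ∈ U ∩ {z | f z ≠ 0} :=
        (show _root_.IsOpen (U ∩ {z | f z ≠ 0}) from hO).mem_nhds ⟨hy, hf⟩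
      exact hO'.mono fun z hz => hz.2
    regAt_inv := by
      rintro f y ⟨U, hU, hy, h⟩ hf
      have hO : T.IsOpen (U ∩ {z | f z ≠ 0}) := by
        let := A.top
        change _root_.IsOpen (π ⁻¹' (U ∩ {z | f z ≠ 0}))
        rw [isOpen_iff_eventually]
        rintro x ⟨hx, hx'⟩
        have h1 : ∀ᶠ z in 𝓝 x, π z ∈ U :=
          (cont x).eventually ((show _root_.IsOpen U from hU).mem_nhds hx)
        filter_upwards [h1, A.eventually_ne (h x hx) hx'] with z hz hz'
        exact ⟨hz, hz'⟩
      exact ⟨_, hO, ⟨hy, hf⟩, fun x hx => A.regAt_inv (h x hx.1) hx.2⟩ }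

/-- Morphisms: continuous maps that pull back regular functions to regular functions. -/
def IsMorphism (A : AlgStr X) (B : AlgStr Y) (φ : X → Y) : Prop :=
  (∀ U, B.IsOpen U → A.IsOpen (φ ⁻¹' U)) ∧
    ∀ (f : Y → ℂ) (x : X), B.RegAt f (φ x) → A.RegAt (f ∘ φ) x

/-- Isomorphisms: morphisms with an inverse morphism. -/
def IsIso (A : AlgStr X) (B : AlgStr Y) (φ : X → Y) : Prop :=
  IsMorphism A B φ ∧ ∃ ψ : Y → X, IsMorphism B A ψ ∧ Function.LeftInverse ψ φ ∧
    Function.RightInverse ψ φ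

/-- Affine varieties: spaces isomorphic to a Zariski closed subset of some `ℂⁿ`. -/
def IsAffineVariety (A : AlgStr X) : Prop :=
  ∃ (n : ℕ) (S : Set (Fin n → ℂ)), (aff (Fin n → ℂ)).IsClosed S ∧
    ∃ φ : X → S, IsIso A ((aff (Fin n → ℂ)).sub S) φ

/-- (Not necessarily irreducible) algebraic varieties: spaces with functions that have a finite
open covering by affine varieties and are separated. -/
def IsVariety (A : AlgStr X) : Prop :=
  (∃ 𝒰 : Set (Set X), 𝒰.Finite ∧ ⋃₀ 𝒰 = Set.univ ∧
    ∀ U ∈ 𝒰, A.IsOpen U ∧ IsAffineVariety (A.sub U)) ∧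
  (A.prod A).IsClosed {z | z.1 = z.2}

/-- The local ring at a point: the ring of germs of regular functions. -/
def localRing (A : AlgStr X) (x : X) : Subring (Filter.Germ (@nhds X A.top x) ℂ) where
  carrier := {s | ∃ f : X → ℂ, A.RegAt f x ∧ s = (f : Filter.Germ (@nhds X A.top x) ℂ)}
  mul_mem' := by
    rintro _ _ ⟨f, hf, rfl⟩ ⟨g, hg, rfl⟩
    exact ⟨f * g, A.regAt_mul hf hg, rfl⟩
  one_mem' := ⟨fun _ => 1, A.regAt_const 1 x, rfl⟩
  add_mem' := by
    rintro _ _ ⟨f, hf, rfl⟩ ⟨g, hg, rfl⟩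
    exact ⟨f + g, A.regAt_add hf hg, rfl⟩
  zero_mem' := ⟨fun _ => 0, A.regAt_const 0 x, rfl⟩
  neg_mem' := by
    rintro _ ⟨f, hf, rfl⟩
    refine ⟨(fun _ => -1) * f, A.regAt_mul (A.regAt_const (-1) x) hf, ?_⟩
    rw [← Filter.Germ.coe_neg]
    congr 1
    funext y
    simp

/-- Smooth (nonsingular) points: the local ring is regular. -/
def SmoothAt (A : AlgStr X) (x : X) : Prop := IsRegularLocalRing (A.localRing x)

/-- Proper morphisms of varieties, i.e. universally closed ones (morphisms of varieties are
automatically separated and of finite type). -/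
def IsProperMorphism {X Y : Type u} (A : AlgStr X) (B : AlgStr Y) (φ : X → Y) : Prop :=
  IsMorphism A B φ ∧ ∀ (Z : Type u) (C : AlgStr Z), IsVariety C → ∀ S : Set (X × Z),
    (A.prod C).IsClosed S → (B.prod C).IsClosed (Prod.map φ id '' S)

/-- Birational morphisms: they induce an isomorphism between dense open subsets. -/
def IsBirational (A : AlgStr X) (B : AlgStr Y) (φ : X → Y) : Prop :=
  IsMorphism A B φ ∧ ∃ (U : Set X) (U' : Set Y), A.IsOpen U ∧ A.IsDense U ∧ B.IsOpen U' ∧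
    B.IsDense U' ∧ ∃ h : Set.MapsTo φ U U', IsIso (A.sub U) (B.sub U') (h.restrict φ U U')

/-- Closed immersions: isomorphisms onto a closed subset of the target. -/
def IsClosedImmersion (A : AlgStr X) (B : AlgStr Y) (φ : X → Y) : Prop :=
  B.IsClosed (Set.range φ) ∧ IsIso A (B.sub (Set.range φ)) (Set.rangeFactorization φ)

/-- Resolutions of singularities: `X` is a smooth variety, the map is proper and birational, and
it is one to one precisely over the smooth points of `Y`. -/
structure IsResolution {X Y : Type u} (A : AlgStr X) (B : AlgStr Y) (φ : X → Y) : Prop where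
  isVariety : IsVariety A
  smooth : ∀ x, A.SmoothAt x
  proper : IsProperMorphism A B φ
  birational : IsBirational A B φ
  one_to_one_iff : ∀ y, B.SmoothAt y ↔ ∃! x, φ x = y

/-- `E`, a structure on the total space of a family of vector spaces over the base `B`, is an
algebraic vector bundle: the projection is a morphism, and locally on the base `E` is isomorphic
to a product with some `ℂʳ`, compatibly with the projections and linearly on the fibres. -/
def IsVectorBundle {B : Type u} {F : B → Type v} [∀ b, AddCommGroup (F b)] [∀ b, Module ℂ (F b)]
    (E : AlgStr (Σ b, F b)) (A : AlgStr B) : Prop :=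
  IsMorphism E A Sigma.fst ∧ ∀ b, ∃ U : Set B, A.IsOpen U ∧ b ∈ U ∧
    ∃ (r : ℕ) (e : (Sigma.fst ⁻¹' U : Set (Σ b, F b)) → U × (Fin r → ℂ)),
      IsIso (E.sub (Sigma.fst ⁻¹' U)) ((A.sub U).prod (aff (Fin r → ℂ))) e ∧
      (∀ z, (e z).1.1 = z.1.1) ∧
      ∀ (c : B) (hc : c ∈ U), IsLinearMap ℂ fun v : F c => (e ⟨⟨c, v⟩, hc⟩).2

end AlgStr

/-! ### Null cones and Grassmannians -/

section Objects

open AlgStr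

variable (V U₁ U₂ : Type u) [AddCommGroup V] [AddCommGroup U₁] [AddCommGroup U₂]
  [Module ℂ V] [Module ℂ U₁] [Module ℂ U₂]

/-- The representation space `W = Hom(V, U₁) × Hom(U₂, V)`. -/
abbrev RepW : Type u := (V →ₗ[ℂ] U₁) × (U₂ →ₗ[ℂ] V)

/-- The null cone: the fibre over `0` of the contraction map `(f₁, f₂) ↦ f₁ ∘ f₂`. -/
def nullCone : Set (RepW V U₁ U₂) := {f | f.1 ∘ₗ f.2 = 0}

/-- The locus in the null cone where `rank f₁ = s` and `rank f₂ = t`. -/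
def nullConeOrbit (s t : ℕ) : Set (RepW V U₁ U₂) :=
  {f | f ∈ nullCone V U₁ U₂ ∧ Module.finrank ℂ (LinearMap.range f.1) = s ∧
    Module.finrank ℂ (LinearMap.range f.2) = t}

/-- The Zariski closure of the rank `(s, t)` locus in the null cone. -/
def nullComponent (s t : ℕ) : Set (RepW V U₁ U₂) :=
  (aff (RepW V U₁ U₂)).closure (nullConeOrbit V U₁ U₂ s t)

/-- The set of `d`-dimensional subspaces of `E`. -/
abbrev Gr (d : ℕ) (E : Type u) [AddCommGroup E] [Module ℂ E] : Type u :=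
  {S : Submodule ℂ E // Module.finrank ℂ S = d}

/-- The span of a linearly independent `d`-tuple. -/
def frameSpan (d : ℕ) (E : Type u) [AddCommGroup E] [Module ℂ E]
    (v : {v : Fin d → E | LinearIndependent ℂ v}) : Gr d E :=
  ⟨Submodule.span ℂ (Set.range v.1), by
    have h := finrank_span_eq_card (R := ℂ) (b := v.1) v.2
    rwa [Fintype.card_fin] at h⟩

/-- The Grassmann variety, as the quotient of the variety of `d`-frames in `E` by `GL_d`. -/
def grass (d : ℕ) (E : Type u) [AddCommGroup E] [Module ℂ E] : AlgStr (Gr d E) :=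
  coinduced (frameSpan d E) ((aff (Fin d → E)).sub {v | LinearIndependent ℂ v})

variable (p q : ℕ)

/-- The fibre over `V₀` of the vector bundle `Hom(𝒬, 𝒰₁) × Hom(𝒰₂, 𝒯)` on `Grass_q(V)`. -/
abbrev TildeFibre (V₀ : Gr q V) : Type u :=
  ((V ⧸ V₀.1) →ₗ[ℂ] U₁) × (U₂ →ₗ[ℂ] V₀.1)

/-- The total space of the vector bundle `Hom(𝒬, 𝒰₁) × Hom(𝒰₂, 𝒯)` on `Grass_q(V)`. -/
abbrev TildeN : Type u := Σ V₀ : Gr q V, TildeFibre V U₁ U₂ q V₀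

variable {V U₁ U₂ q} in
/-- The map `ν : (V₀; f₁, f₂) ↦ (f₁, f₂)`. -/
def nuTilde (z : TildeN V U₁ U₂ q) : RepW V U₁ U₂ :=
  (z.2.1 ∘ₗ z.1.1.mkQ, z.1.1.subtype ∘ₗ z.2.2)

/-- The variety structure on `TildeN`, as a subbundle of the trivial bundle with fibre `W`. -/
def tildeN : AlgStr (TildeN V U₁ U₂ q) :=
  induced (fun z => (z.1, nuTilde z)) ((grass q V).prod (aff (RepW V U₁ U₂)))

/-- The base `Grass_q(V) × Grass_p(U₁) × Grass_{m₂ - q}(U₂)`, `m₂ = dim U₂`. -/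
abbrev HatBase : Type u := Gr q V × Gr p U₁ × Gr (Module.finrank ℂ U₂ - q) U₂

/-- The variety structure on the base. -/
noncomputable def hatBase : AlgStr (HatBase V U₁ U₂ p q) :=
  (grass q V).prod ((grass p U₁).prod (grass (Module.finrank ℂ U₂ - q) U₂))

/-- The fibre `Hom(V/V₀, V₁) × Hom(U₂/V₂, V₀)` over `(V₀, V₁, V₂)`. -/
abbrev HatFibre (x : HatBase V U₁ U₂ p q) : Type u :=
  ((V ⧸ x.1.1) →ₗ[ℂ] x.2.1.1) × ((U₂ ⧸ x.2.2.1) →ₗ[ℂ] x.1.1)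

/-- The total space of `Hom(𝒬(V), 𝒯(U₁)) × Hom(𝒬(U₂), 𝒯(V))`. -/
abbrev HatN : Type u := Σ x : HatBase V U₁ U₂ p q, HatFibre V U₁ U₂ p q x

variable {V U₁ U₂ p q}

/-- The map `ν̂`, sending `(V₀, V₁, V₂; F₁, F₂)` to the pair of composites
`V → V/V₀ → V₁ → U₁` and `U₂ → U₂/V₂ → V₀ → V`. -/
def nuHat (z : HatN V U₁ U₂ p q) : RepW V U₁ U₂ :=
  (z.1.2.1.1.subtype ∘ₗ z.2.1 ∘ₗ z.1.1.1.mkQ, z.1.1.1.subtype ∘ₗ z.2.2 ∘ₗ z.1.2.2.1.mkQ)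

/-- The map `f_{p,q}`, sending `(V₀, V₁, V₂; F₁, F₂)` to `V₀` with the pair of composites
`V/V₀ → V₁ → U₁` and `U₂ → U₂/V₂ → V₀`. -/
def hatToTilde (z : HatN V U₁ U₂ p q) : TildeN V U₁ U₂ q :=
  ⟨z.1.1, z.1.2.1.1.subtype ∘ₗ z.2.1, z.2.2 ∘ₗ z.1.2.2.1.mkQ⟩

/-- The bundle projection of `HatN`. -/
def zetaHat (z : HatN V U₁ U₂ p q) : HatBase V U₁ U₂ p q := z.1

/-- The bundle projection of `TildeN`. -/
def zetaTilde (z : TildeN V U₁ U₂ q) : Gr q V := z.1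

variable (V U₁ U₂ p q) in
/-- The variety structure on `HatN`, as a subbundle of the trivial bundle with fibre `W`. -/
noncomputable def hatN : AlgStr (HatN V U₁ U₂ p q) :=
  induced (fun z => (z.1, nuHat z)) ((hatBase V U₁ U₂ p q).prod (aff (RepW V U₁ U₂)))

variable (V) in
/-- The natural embedding `Hom(V, X₁) × Hom(U₂/X₂, V) → W`. -/
def reducedIncl (X₁ : Submodule ℂ U₁) (X₂ : Submodule ℂ U₂) (g : RepW V X₁ (U₂ ⧸ X₂)) :
    RepW V U₁ U₂ :=
  (X₁.subtype ∘ₗ g.1, g.2 ∘ₗ X₂.mkQ)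

variable (V p q) in
/-- The intersection of the closure of the rank `(p, q)` locus with the subspace
`Hom(V, X₁) × Hom(U₂/X₂, V)` of `W`. -/
def nullSlice (X₁ : Submodule ℂ U₁) (X₂ : Submodule ℂ U₂) : Set (RepW V U₁ U₂) :=
  nullComponent V U₁ U₂ p q ∩ Set.range (reducedIncl V X₁ X₂)

/-- The part of `HatN` lying over `Grass_q(V) × {x}`. -/
def hatSlice (x : Gr p U₁ × Gr (Module.finrank ℂ U₂ - q) U₂) : Set (HatN V U₁ U₂ p q) :=
  zetaHat ⁻¹' (Set.univ ×ˢ {x})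

end Objects

/-!
# Resolutions of the components of the null cone of a contraction map

The proof works throughout with maps that are morphisms at a point (`AlgStr.MorAt`): the products,
subspaces and quotients of `AlgStr` have their usual universal properties in this pointwise form,
and a map into a finite dimensional vector space is a morphism at `x` as soon as its coordinates
are regular at `x`. Inverses of regular families of linear maps are regular
(`AlgStr.MorAt.exists_inverse`), which makes rank conditions open and makes images, kernels and
projections along a fixed complement depend regularly on parameters.

*Varieties and bundles.* The complements of a fixed subspace `C` form an open chart of the
Grassmannian isomorphic to an affine space. Over such charts the fibres of `TildeN` and `HatN` are
identified with a fixed space of linear maps, so both are covered by finitely many affine spaces;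
they are separated because they inject into a product of a separated base with `W`.

*The map `f_{p,q}`.* Every point of `TildeN` lies on a line in its fibre whose general point has
`f₁` injective and `f₂` surjective, hence these generic points are dense. Over them `V₁` is the
image of `f₁` and `V₂` the kernel of `f₂`, which inverts `f_{p,q}`. By the same density `ν` takes
values in the closure of the rank `(p, q)` locus.

*The slices.* Over `(X₁, X₂)` the bundle `HatN` is `TildeN` for the spaces `V`, `X₁`, `U₂ / X₂`,
and the slice of the null cone is the null cone for these spaces. Thus everything is reduced to
the map `ν` from `TildeN` to the null cone when `dim U₁ = p` and `dim U₂ = q`, that is, to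
`isResolution_nuNull`.

*Properness* (`isProperMorphism_nuTilde`). A closed subset of `TildeN × Z` becomes a closed
condition on frames of `V₀` together with points of the null cone and of `Z`. That the projection
along the Grassmannian is closed is proved by eliminating the vectors of the frame one after
another (`AlgStr.eventually_frame_notMem`). Each step is the fundamental theorem of elimination
theory (`AlgStr.eventually_cone_trivial`): by the Nullstellensatz all monomials of a large degree
are combinations of the given homogeneous equations at one parameter value, and this persists
nearby.

*Smooth points.* If `f₁` is surjective or `f₂` is injective, then `V₀` must be `ker f₁` or
`range f₂`; so `ν` is an isomorphism over this open set, and the null cone is smooth there because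
affine spaces are. Otherwise there are several choices of `V₀` between `range f₂` and `ker f₁`,
and the point is singular (`not_smoothAt_nullCone`): the lines through `f` in the null cone
span the kernel of the differential of `(f₁, f₂) ↦ f₁ ∘ f₂`, whose dimension exceeds
`p² + p q + q²` since this differential is not surjective, and derivations along curves bound the
number of generators of the maximal ideal from below (`AlgStr.finrank_span_velocities_le`). The
Krull dimension, on the other hand, is at most `p² + p q + q²`, because the null cone is
dominated by a vector space of that dimension (`ringKrullDim_localRing_nullCone_le`).
-/

/-! ### Pointwise morphisms of spaces with functions -/

namespace AlgStr

variable {X : Type u} {Y : Type v} {Z : Type w}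

/-- The filter of neighbourhoods of a point. -/
def nhd (A : AlgStr X) (x : X) : Filter X := @nhds X A.top x

/-- `φ` is a morphism at the point `x`: it is continuous at `x` and pulls back functions regular
at `φ x` to functions regular at `x`. -/
def MorAt (A : AlgStr X) (B : AlgStr Y) (φ : X → Y) (x : X) : Prop :=
  Tendsto φ (A.nhd x) (B.nhd (φ x)) ∧ ∀ f : Y → ℂ, B.RegAt f (φ x) → A.RegAt (f ∘ φ) x

theorem mem_of_mem_nhd {A : AlgStr X} {x : X} {s : Set X} (h : s ∈ A.nhd x) : x ∈ s := by
  let := A.top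
  exact mem_of_mem_nhds (h : s ∈ 𝓝 x)

theorem self_of_nhd {A : AlgStr X} {x : X} {p : X → Prop} (h : ∀ᶠ y in A.nhd x, p y) : p x :=
  mem_of_mem_nhd h

theorem isOpen_iff {A : AlgStr X} {U : Set X} : A.IsOpen U ↔ ∀ x ∈ U, U ∈ A.nhd x := by
  let := A.top
  exact isOpen_iff_mem_nhds

theorem mem_nhd_iff {A : AlgStr X} {x : X} {s : Set X} :
    s ∈ A.nhd x ↔ ∃ U, U ⊆ s ∧ A.IsOpen U ∧ x ∈ U := by
  let := A.top
  exact mem_nhds_iff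

theorem isClosed_iff {A : AlgStr X} {S : Set X} : A.IsClosed S ↔ ∀ x, x ∉ S → Sᶜ ∈ A.nhd x :=
  isOpen_iff

theorem isOpen_univ (A : AlgStr X) : A.IsOpen Set.univ := A.top.isOpen_univ

theorem isOpen_inter {A : AlgStr X} {U V : Set X} (hU : A.IsOpen U) (hV : A.IsOpen V) :
    A.IsOpen (U ∩ V) := A.top.isOpen_inter _ _ hU hV

theorem mem_closure_iff {A : AlgStr X} {S : Set X} {x : X} :
    x ∈ A.closure S ↔ ∀ U ∈ A.nhd x, (U ∩ S).Nonempty := by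
  let := A.top
  exact mem_closure_iff_nhds

theorem closure_minimal {A : AlgStr X} {S T : Set X} (h : S ⊆ T) (hT : A.IsClosed T) :
    A.closure S ⊆ T := by
  let := A.top
  exact _root_.closure_minimal h ⟨hT⟩

theorem isDense_iff {A : AlgStr X} {S : Set X} :
    A.IsDense S ↔ ∀ x, ∀ U ∈ A.nhd x, (U ∩ S).Nonempty :=
  forall_congr' fun _ => mem_closure_iff

theorem RegAt.congr {A : AlgStr X} {f g : X → ℂ} {x : X} (hf : A.RegAt f x)
    (h : ∀ᶠ y in A.nhd x, f y = g y) : A.RegAt g x := A.regAt_congr h hf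

theorem RegAt.eventually {A : AlgStr X} {f : X → ℂ} {x : X} (hf : A.RegAt f x) :
    ∀ᶠ y in A.nhd x, A.RegAt f y := A.regAt_eventually hf

theorem RegAt.add {A : AlgStr X} {f g : X → ℂ} {x : X} (hf : A.RegAt f x) (hg : A.RegAt g x) :
    A.RegAt (fun y => f y + g y) x := A.regAt_add hf hg

theorem RegAt.mul {A : AlgStr X} {f g : X → ℂ} {x : X} (hf : A.RegAt f x) (hg : A.RegAt g x) :
    A.RegAt (fun y => f y * g y) x := A.regAt_mul hf hg

theorem RegAt.inv {A : AlgStr X} {f : X → ℂ} {x : X} (hf : A.RegAt f x) (h : f x ≠ 0) :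
    A.RegAt (fun y => (f y)⁻¹) x := A.regAt_inv hf h

theorem RegAt.div {A : AlgStr X} {f g : X → ℂ} {x : X} (hf : A.RegAt f x) (hg : A.RegAt g x)
    (h : g x ≠ 0) : A.RegAt (fun y => f y / g y) x := by
  simpa only [div_eq_mul_inv] using hf.mul (hg.inv h)

theorem RegAt.neg {A : AlgStr X} {f : X → ℂ} {x : X} (hf : A.RegAt f x) :
    A.RegAt (fun y => -f y) x := by
  simpa using (A.regAt_const (-1) x).mul hf

theorem RegAt.sub {A : AlgStr X} {f g : X → ℂ} {x : X} (hf : A.RegAt f x) (hg : A.RegAt g x) :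
    A.RegAt (fun y => f y - g y) x := by
  simpa only [sub_eq_add_neg] using hf.add hg.neg

theorem RegAt.sum {A : AlgStr X} {ι : Type*} (s : Finset ι) {f : ι → X → ℂ} {x : X}
    (hf : ∀ i ∈ s, A.RegAt (f i) x) : A.RegAt (fun y => ∑ i ∈ s, f i y) x := by
  classical
  induction s using Finset.induction_on with
  | empty => simpa using A.regAt_const 0 x
  | insert i s hi ih =>
    simp only [Finset.sum_insert hi]
    exact (hf i (Finset.mem_insert_self i s)).add
      (ih fun j hj => hf j (Finset.mem_insert_of_mem hj))

theorem RegAt.prod {A : AlgStr X} {ι : Type*} (s : Finset ι) {f : ι → X → ℂ} {x : X}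
    (hf : ∀ i ∈ s, A.RegAt (f i) x) : A.RegAt (fun y => ∏ i ∈ s, f i y) x := by
  classical
  induction s using Finset.induction_on with
  | empty => simpa using A.regAt_const 1 x
  | insert i s hi ih =>
    simp only [Finset.prod_insert hi]
    exact (hf i (Finset.mem_insert_self i s)).mul
      (ih fun j hj => hf j (Finset.mem_insert_of_mem hj))

theorem RegAt.ne {A : AlgStr X} {f : X → ℂ} {x : X} (hf : A.RegAt f x) (h : f x ≠ 0) :
    ∀ᶠ y in A.nhd x, f y ≠ 0 := A.eventually_ne hf h

theorem isMorphism_iff {A : AlgStr X} {B : AlgStr Y} {φ : X → Y} :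
    IsMorphism A B φ ↔ ∀ x, MorAt A B φ x := by
  let := A.top
  let := B.top
  have : (∀ U, B.IsOpen U → A.IsOpen (φ ⁻¹' U)) ↔ ∀ x, Tendsto φ (A.nhd x) (B.nhd (φ x)) :=
    continuous_def.symm.trans continuous_iff_continuousAt
  rw [IsMorphism, this]
  exact ⟨fun h x => ⟨h.1 x, fun f => h.2 f x⟩, fun h => ⟨fun x => (h x).1, fun f x => (h x).2 f⟩⟩

theorem IsMorphism.morAt {A : AlgStr X} {B : AlgStr Y} {φ : X → Y} (h : IsMorphism A B φ) (x : X) :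
    MorAt A B φ x := isMorphism_iff.1 h x

theorem morAt_id (A : AlgStr X) (x : X) : MorAt A A (fun y => y) x := ⟨tendsto_id, fun _ h => h⟩

theorem MorAt.comp {A : AlgStr X} {B : AlgStr Y} {C : AlgStr Z} {φ : X → Y} {ψ : Y → Z} {x : X}
    (hψ : MorAt B C ψ (φ x)) (hφ : MorAt A B φ x) : MorAt A C (fun y => ψ (φ y)) x :=
  ⟨hψ.1.comp hφ.1, fun f hf => hφ.2 _ (hψ.2 f hf)⟩

theorem MorAt.congr {A : AlgStr X} {B : AlgStr Y} {φ ψ : X → Y} {x : X} (hφ : MorAt A B φ x)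
    (h : ∀ᶠ y in A.nhd x, φ y = ψ y) : MorAt A B ψ x := by
  have hx : φ x = ψ x := self_of_nhd (p := fun y => φ y = ψ y) h
  refine ⟨hx ▸ hφ.1.congr' h, fun f hf => RegAt.congr (hφ.2 f (hx ▸ hf)) ?_⟩
  exact h.mono fun y hy => congrArg f hy

theorem MorAt.regAt {A : AlgStr X} {B : AlgStr Y} {φ : X → Y} {x : X} (h : MorAt A B φ x)
    {f : Y → ℂ} (hf : B.RegAt f (φ x)) : A.RegAt (fun y => f (φ y)) x := h.2 f hf

theorem MorAt.mem {A : AlgStr X} {B : AlgStr Y} {φ : X → Y} {x : X} (h : MorAt A B φ x)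
    {s : Set Y} (hs : s ∈ B.nhd (φ x)) : ∀ᶠ y in A.nhd x, φ y ∈ s := h.1 hs

theorem morAt_const {A : AlgStr X} {B : AlgStr Y} (b : Y) (x : X) : MorAt A B (fun _ => b) x := by
  let := B.top
  exact ⟨tendsto_const_nhds (x := b), fun f _ => A.regAt_const (f b) x⟩

theorem isMorphism_comp {A : AlgStr X} {B : AlgStr Y} {C : AlgStr Z} {φ : X → Y} {ψ : Y → Z}
    (hψ : IsMorphism B C ψ) (hφ : IsMorphism A B φ) : IsMorphism A C (fun x => ψ (φ x)) :=
  isMorphism_iff.2 fun x => (hψ.morAt _).comp (hφ.morAt x)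

theorem IsMorphism.isOpen_preimage {A : AlgStr X} {B : AlgStr Y} {φ : X → Y}
    (h : IsMorphism A B φ) {U : Set Y} (hU : B.IsOpen U) : A.IsOpen (φ ⁻¹' U) := h.1 U hU

theorem IsMorphism.isClosed_preimage {A : AlgStr X} {B : AlgStr Y} {φ : X → Y}
    (h : IsMorphism A B φ) {S : Set Y} (hS : B.IsClosed S) : A.IsClosed (φ ⁻¹' S) := h.1 _ hS

/-! ### Induced structures, subspaces and quotients -/

theorem nhd_induced (φ : X → Y) (B : AlgStr Y) (x : X) :
    (induced φ B).nhd x = comap φ (B.nhd (φ x)) := by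
  let := B.top
  exact nhds_induced φ x

theorem morAt_induced (φ : X → Y) (B : AlgStr Y) (x : X) : MorAt (induced φ B) B φ x := by
  refine ⟨?_, fun f hf => ⟨f, hf, EventuallyEq.rfl⟩⟩
  rw [nhd_induced]
  exact tendsto_comap

theorem morAt_induced_iff {φ : X → Y} {B : AlgStr Y} {C : AlgStr Z} {ψ : Z → X} {z : Z} :
    MorAt C (induced φ B) ψ z ↔ MorAt C B (fun w => φ (ψ w)) z := by
  refine ⟨fun h => (morAt_induced φ B _).comp h, fun h => ⟨?_, ?_⟩⟩
  · rw [nhd_induced, tendsto_comap_iff]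
    exact h.1
  · rintro f ⟨F, hF, hf⟩
    refine RegAt.congr (h.2 F hF) ?_
    have hf' : ∀ᶠ x in (induced φ B).nhd (ψ z), f x = F (φ x) := hf
    rw [nhd_induced, eventually_comap] at hf'
    exact (h.1.eventually hf').mono fun w hw => (hw _ rfl).symm

theorem nhd_sub (A : AlgStr X) (S : Set X) (x : S) :
    (A.sub S).nhd x = comap Subtype.val (A.nhd x.1) := nhd_induced _ _ _

theorem morAt_val (A : AlgStr X) (S : Set X) (x : S) : MorAt (A.sub S) A Subtype.val x :=
  morAt_induced _ _ _

theorem morAt_sub_iff {A : AlgStr X} {S : Set X} {C : AlgStr Z} {ψ : Z → S} {z : Z} :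
    MorAt C (A.sub S) ψ z ↔ MorAt C A (fun w => (ψ w).1) z := morAt_induced_iff

theorem MorAt.restrict {A : AlgStr X} {B : AlgStr Y} {φ : X → Y} {S : Set X} {x : S}
    (h : MorAt A B φ x) : MorAt (A.sub S) B (fun y : S => φ y) x :=
  h.comp (morAt_val A S x)

/-- Being a morphism at a point is local: it may be checked on a neighbourhood. -/
theorem MorAt.of_restrict {A : AlgStr X} {B : AlgStr Y} {φ : X → Y} {S : Set X} {x : S}
    (hS : S ∈ A.nhd x.1) (h : MorAt (A.sub S) B (fun y : S => φ y) x) : MorAt A B φ x := by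
  have key : ∀ p : X → Prop, (∀ᶠ y in (A.sub S).nhd x, p y.1) → ∀ᶠ y in A.nhd x.1, p y := by
    intro p hp
    rw [nhd_sub, eventually_comap] at hp
    filter_upwards [hp, hS] with y hy hyS
    exact hy ⟨y, hyS⟩ rfl
  refine ⟨fun s hs => key _ (h.1 hs), fun f hf => ?_⟩
  obtain ⟨F, hF, hFf⟩ := h.2 f hf
  exact RegAt.congr hF ((key (fun y => f (φ y) = F y) hFf).mono fun y hy => hy.symm)

theorem morAt_coinduced (π : X → Y) (A : AlgStr X) (x : X) : MorAt A (coinduced π A) π x := by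
  let := A.top
  let := (coinduced π A).top
  refine ⟨(continuous_coinduced_rng (f := π)).tendsto x, ?_⟩
  rintro f ⟨U, hU, hx, h⟩
  exact h x hx

theorem isOpen_coinduced {π : X → Y} {A : AlgStr X} {U : Set Y} :
    (coinduced π A).IsOpen U ↔ A.IsOpen (π ⁻¹' U) := Iff.rfl

/-- A map out of a quotient is a morphism near `y` if its composite with the projection is. -/
theorem morAt_of_coinduced {π : X → Y} {A : AlgStr X} {C : AlgStr Z} {ψ : Y → Z} {y : Y}
    {U : Set Y} (hU : (coinduced π A).IsOpen U) (hy : y ∈ U)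
    (h : ∀ x, π x ∈ U → MorAt A C (fun x => ψ (π x)) x) : MorAt (coinduced π A) C ψ y := by
  have hopen : ∀ W, C.IsOpen W → (coinduced π A).IsOpen (U ∩ ψ ⁻¹' W) := by
    intro W hW
    rw [isOpen_coinduced, isOpen_iff]
    rintro x ⟨hx, hx'⟩
    filter_upwards [isOpen_iff.1 (isOpen_coinduced.1 hU) x hx,
      (h x hx).mem (isOpen_iff.1 hW _ hx')] with z hz hz'
    exact ⟨hz, hz'⟩
  refine ⟨fun s hs => ?_, fun f hf => ?_⟩
  · obtain ⟨W, hWs, hW, hyW⟩ := mem_nhd_iff.1 hs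
    exact mem_nhd_iff.2 ⟨_, fun z hz => hWs hz.2, hopen W hW, hy, hyW⟩
  · obtain ⟨W, hWs, hW, hyW⟩ := mem_nhd_iff.1 hf.eventually
    exact ⟨_, hopen W hW, ⟨hy, hyW⟩, fun x hx => (h x hx.1).regAt (hWs hx.2)⟩

/-! ### Products and affine spaces -/

section Patches

variable {ι : Type w} {S : ι → Set X} {R : ι → Subalgebra ℂ (X → ℂ)}
  {cover : ∀ x, ∃ i, x ∈ S i} {directed : ∀ i j, ∃ k, S i ∩ S j ⊆ S k ∧ R i ≤ R k ∧ R j ≤ R k}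

theorem patch_mem_nhd {i : ι} {h : X → ℂ} {x : X} (hh : h ∈ R i) (hx : x ∈ S i) (hx0 : h x ≠ 0) :
    {y | y ∈ S i ∧ h y ≠ 0} ∈ (ofPatches S R cover directed).nhd x := by
  let T : TopologicalSpace X :=
    TopologicalSpace.generateFrom {B | ∃ i, ∃ h ∈ R i, B = {x | x ∈ S i ∧ h x ≠ 0}}
  exact (TopologicalSpace.isOpen_generateFrom_of_mem ⟨i, h, hh, rfl⟩ :
      _root_.IsOpen {x | x ∈ S i ∧ h x ≠ 0}).mem_nhds ⟨hx, hx0⟩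

theorem mem_nhd_ofPatches (hS : ∀ i j, ∃ k, S k = S i ∩ S j ∧ R i ≤ R k ∧ R j ≤ R k)
    {s : Set X} {x : X} :
    s ∈ (ofPatches S R cover directed).nhd x ↔
      ∃ i, x ∈ S i ∧ ∃ h ∈ R i, h x ≠ 0 ∧ {y | y ∈ S i ∧ h y ≠ 0} ⊆ s := by
  constructor
  · intro hs
    change s ∈ @nhds X (TopologicalSpace.generateFrom _) x at hs
    rw [TopologicalSpace.nhds_generateFrom, mem_biInf_of_directed] at hs
    · obtain ⟨B, ⟨hxB, i, h, hh, rfl⟩, hB⟩ := hs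
      exact ⟨i, hxB.1, h, hh, hxB.2, by simpa using hB⟩
    · rintro _ ⟨hx, i, h, hh, rfl⟩ _ ⟨hx', j, h', hh', rfl⟩
      obtain ⟨k, hk, hi, hj⟩ := hS i j
      have hxk : x ∈ S k := hk ▸ ⟨hx.1, hx'.1⟩
      refine ⟨{y | y ∈ S k ∧ (h * h') y ≠ 0}, ⟨⟨hxk, mul_ne_zero hx.2 hx'.2⟩, k, h * h',
        (R k).mul_mem (hi hh) (hj hh'), rfl⟩, ?_, ?_⟩
      · refine principal_mono.2 fun y hy => ?_
        rw [hk] at hy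
        exact ⟨hy.1.1, left_ne_zero_of_mul hy.2⟩
      · refine principal_mono.2 fun y hy => ?_
        rw [hk] at hy
        exact ⟨hy.1.2, right_ne_zero_of_mul hy.2⟩
    · obtain ⟨i, hi⟩ := cover x
      exact ⟨{y | y ∈ S i ∧ (1 : X → ℂ) y ≠ 0}, ⟨hi, one_ne_zero⟩, i, 1, (R i).one_mem, rfl⟩
  · rintro ⟨i, hx, h, hh, hx0, hs⟩
    exact mem_of_superset (patch_mem_nhd hh hx hx0) hs

theorem morAt_ofPatches {Z : Type*} {C : AlgStr Z} {φ : Z → X} {z : Z}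
    (h : ∀ i, φ z ∈ S i → (∀ᶠ w in C.nhd z, φ w ∈ S i) ∧
      ∀ g ∈ R i, C.RegAt (fun w => g (φ w)) z) :
    MorAt C (ofPatches S R cover directed) φ z := by
  have tend : Tendsto φ (C.nhd z) ((ofPatches S R cover directed).nhd (φ z)) := by
    refine TopologicalSpace.tendsto_nhds_generateFrom_iff.2 ?_
    rintro _ ⟨i, g, hg, rfl⟩ hx
    change ∀ᶠ w in C.nhd z, φ w ∈ S i ∧ g (φ w) ≠ 0
    exact (h i hx.1).1.and (((h i hx.1).2 g hg).ne hx.2)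
  refine ⟨tend, ?_⟩
  rintro f ⟨i, hx, g, hg, k, hk, hk0, hf⟩
  refine RegAt.congr (((h i hx).2 g hg).div ((h i hx).2 k hk) hk0) ?_
  exact (tend.eventually hf).mono fun w hw => hw.symm

end Patches

variable {A : AlgStr X} {B : AlgStr Y} {C : AlgStr Z}

theorem mem_nhd_prod {s : Set (X × Y)} {x : X} {y : Y} :
    s ∈ (A.prod B).nhd (x, y) ↔ ∃ U V, A.IsOpen U ∧ B.IsOpen V ∧ x ∈ U ∧ y ∈ V ∧
      ∃ h ∈ prodFun A B U V, h (x, y) ≠ 0 ∧ ∀ z, z.1 ∈ U → z.2 ∈ V → h z ≠ 0 → z ∈ s := by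
  rw [prod, mem_nhd_ofPatches fun i j => ⟨(⟨i.1.1 ∩ j.1.1, isOpen_inter i.1.2 j.1.2⟩,
    ⟨i.2.1 ∩ j.2.1, isOpen_inter i.2.2 j.2.2⟩), Set.prod_inter_prod.symm,
      prodFun_mono A B Set.inter_subset_left Set.inter_subset_left,
      prodFun_mono A B Set.inter_subset_right Set.inter_subset_right⟩]
  constructor
  · rintro ⟨⟨U, V⟩, hx, h, hh, h0, hs⟩
    exact ⟨U.1, V.1, U.2, V.2, hx.1, hx.2, h, hh, h0, fun z h1 h2 h3 => hs ⟨⟨h1, h2⟩, h3⟩⟩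
  · rintro ⟨U, V, hU, hV, hx, hy, h, hh, h0, hs⟩
    exact ⟨(⟨U, hU⟩, ⟨V, hV⟩), ⟨hx, hy⟩, h, hh, h0, fun z hz => hs z hz.1.1 hz.1.2 hz.2⟩

theorem morAt_fst (z : X × Y) : MorAt (A.prod B) A Prod.fst z := by
  refine ⟨fun s hs => ?_, fun f hf => ?_⟩
  · obtain ⟨U, hUs, hU, hx⟩ := mem_nhd_iff.1 hs
    exact mem_nhd_prod.2 ⟨U, Set.univ, hU, B.isOpen_univ, hx, trivial, 1, one_mem _, one_ne_zero,
      fun z hz _ _ => hUs hz⟩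
  · obtain ⟨U, hUs, hU, hx⟩ := mem_nhd_iff.1 hf.eventually
    refine ⟨(⟨U, hU⟩, ⟨Set.univ, B.isOpen_univ⟩), ⟨hx, trivial⟩, fun z => f z.1,
      Algebra.subset_adjoin (Or.inl ⟨f, fun x hx => hUs hx, rfl⟩), 1, one_mem _, one_ne_zero, ?_⟩
    exact Eventually.of_forall fun z => by simp

theorem morAt_snd (z : X × Y) : MorAt (A.prod B) B Prod.snd z := by
  refine ⟨fun s hs => ?_, fun f hf => ?_⟩
  · obtain ⟨U, hUs, hU, hx⟩ := mem_nhd_iff.1 hs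
    exact mem_nhd_prod.2 ⟨Set.univ, U, A.isOpen_univ, hU, trivial, hx, 1, one_mem _, one_ne_zero,
      fun z _ hz _ => hUs hz⟩
  · obtain ⟨U, hUs, hU, hx⟩ := mem_nhd_iff.1 hf.eventually
    refine ⟨(⟨Set.univ, A.isOpen_univ⟩, ⟨U, hU⟩), ⟨trivial, hx⟩, fun z => f z.2,
      Algebra.subset_adjoin (Or.inr ⟨f, fun x hx => hUs hx, rfl⟩), 1, one_mem _, one_ne_zero, ?_⟩
    exact Eventually.of_forall fun z => by simp

theorem MorAt.prodMk {φ : Z → X} {ψ : Z → Y} {z : Z} (hφ : MorAt C A φ z) (hψ : MorAt C B ψ z) :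
    MorAt C (A.prod B) (fun w => (φ w, ψ w)) z := by
  rw [prod]
  refine morAt_ofPatches ?_
  rintro ⟨⟨U, hU⟩, ⟨V, hV⟩⟩ hz
  refine ⟨?_, fun g hg => ?_⟩
  · filter_upwards [hφ.mem (isOpen_iff.1 hU _ hz.1), hψ.mem (isOpen_iff.1 hV _ hz.2)] with w h1 h2
    exact ⟨h1, h2⟩
  · induction hg using Algebra.adjoin_induction with
    | mem g hg =>
      rcases hg with ⟨f, hf, rfl⟩ | ⟨f, hf, rfl⟩
      · exact hφ.regAt (hf _ hz.1)
      · exact hψ.regAt (hf _ hz.2)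
    | algebraMap r => exact C.regAt_const r z
    | add f g _ _ hf hg => exact hf.add hg
    | mul f g _ _ hf hg => exact hf.mul hg

theorem MorAt.fst {φ : Z → X × Y} {z : Z} (h : MorAt C (A.prod B) φ z) :
    MorAt C A (fun w => (φ w).1) z := (morAt_fst _).comp h

theorem MorAt.snd {φ : Z → X × Y} {z : Z} (h : MorAt C (A.prod B) φ z) :
    MorAt C B (fun w => (φ w).2) z := (morAt_snd _).comp h

theorem isMorphism_fst : IsMorphism (A.prod B) A Prod.fst := isMorphism_iff.2 morAt_fst

theorem isMorphism_snd : IsMorphism (A.prod B) B Prod.snd := isMorphism_iff.2 morAt_snd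

end AlgStr

/-! ### Regular maps to finite dimensional vector spaces -/

namespace AlgStr

section Affine

variable {X : Type*} {A : AlgStr X} {x : X}
variable {E F G : Type*} [AddCommGroup E] [Module ℂ E] [AddCommGroup F] [Module ℂ F]
  [AddCommGroup G] [Module ℂ G]

theorem regAt_polyFun {f : E → ℂ} (hf : f ∈ polyFun E) (x : E) : (aff E).RegAt f x :=
  ⟨(), trivial, f, hf, 1, one_mem _, one_ne_zero, Eventually.of_forall fun y => by simp⟩

theorem dual_mem_polyFun (φ : Module.Dual ℂ E) : (fun x => φ x) ∈ polyFun E :=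
  Algebra.subset_adjoin ⟨φ, rfl⟩

theorem mem_nhd_aff {s : Set E} {x : E} :
    s ∈ (aff E).nhd x ↔ ∃ h ∈ polyFun E, h x ≠ 0 ∧ {y | h y ≠ 0} ⊆ s := by
  rw [aff, mem_nhd_ofPatches fun _ _ => ⟨(), by simp, le_rfl, le_rfl⟩]
  simp

theorem regAt_aff_iff {f : E → ℂ} {x : E} :
    (aff E).RegAt f x ↔ ∃ g ∈ polyFun E, ∃ h ∈ polyFun E, h x ≠ 0 ∧
      ∀ᶠ y in (aff E).nhd x, f y = g y / h y := by
  constructor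
  · rintro ⟨_, _, g, hg, h, hh, h0, hf⟩
    exact ⟨g, hg, h, hh, h0, hf⟩
  · rintro ⟨g, hg, h, hh, h0, hf⟩
    exact ⟨(), trivial, g, hg, h, hh, h0, hf⟩

theorem regAt_comp_polyFun {f : X → E} (hf : ∀ φ : Module.Dual ℂ E, A.RegAt (fun y => φ (f y)) x)
    {g : E → ℂ} (hg : g ∈ polyFun E) : A.RegAt (fun y => g (f y)) x := by
  induction hg using Algebra.adjoin_induction with
  | mem g hg =>
    obtain ⟨φ, rfl⟩ := hg
    exact hf φ
  | algebraMap r => exact A.regAt_const r x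
  | add f g _ _ hf hg => exact hf.add hg
  | mul f g _ _ hf hg => exact hf.mul hg

theorem morAt_aff_iff {f : X → E} :
    MorAt A (aff E) f x ↔ ∀ φ : Module.Dual ℂ E, A.RegAt (fun y => φ (f y)) x := by
  refine ⟨fun h φ => h.regAt (regAt_polyFun (dual_mem_polyFun φ) _), fun h => ?_⟩
  rw [aff]
  exact morAt_ofPatches fun i _ => ⟨by simp, fun g hg => regAt_comp_polyFun h hg⟩

theorem regAt_iff_morAt {f : X → ℂ} : A.RegAt f x ↔ MorAt A (aff ℂ) f x := by
  rw [morAt_aff_iff]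
  refine ⟨fun h φ => ?_, fun h => h LinearMap.id⟩
  have : ∀ z, φ z = z * φ 1 := fun z => by simpa using φ.map_smul z 1
  exact (h.mul (A.regAt_const (φ 1) x)).congr (Eventually.of_forall fun y => (this _).symm)

theorem morAt_linear (L : E →ₗ[ℂ] F) (x : E) : MorAt (aff E) (aff F) (fun y => L y) x :=
  morAt_aff_iff.2 fun φ => regAt_polyFun (dual_mem_polyFun (φ ∘ₗ L)) x

theorem MorAt.linear {f : X → E} (hf : MorAt A (aff E) f x) (L : E →ₗ[ℂ] F) :
    MorAt A (aff F) (fun y => L (f y)) x := (morAt_linear L _).comp hf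

theorem MorAt.add {f g : X → E} (hf : MorAt A (aff E) f x) (hg : MorAt A (aff E) g x) :
    MorAt A (aff E) (fun y => f y + g y) x := by
  rw [morAt_aff_iff] at *
  exact fun φ => by simpa using (hf φ).add (hg φ)

theorem MorAt.sub {f g : X → E} (hf : MorAt A (aff E) f x) (hg : MorAt A (aff E) g x) :
    MorAt A (aff E) (fun y => f y - g y) x := by
  rw [morAt_aff_iff] at *
  exact fun φ => by simpa using (hf φ).sub (hg φ)

theorem MorAt.smul {c : X → ℂ} {g : X → E} (hc : A.RegAt c x) (hg : MorAt A (aff E) g x) :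
    MorAt A (aff E) (fun y => c y • g y) x := by
  rw [morAt_aff_iff] at *
  exact fun φ => by simpa using hc.mul (hg φ)

theorem MorAt.sum {ι : Type*} (s : Finset ι) {f : ι → X → E}
    (hf : ∀ i ∈ s, MorAt A (aff E) (f i) x) : MorAt A (aff E) (fun y => ∑ i ∈ s, f i y) x := by
  simp only [morAt_aff_iff] at *
  exact fun φ => by simpa using RegAt.sum s fun i hi => hf i hi φ

theorem MorAt.bilin [FiniteDimensional ℂ E] (β : E →ₗ[ℂ] F →ₗ[ℂ] G) {f : X → E} {g : X → F}
    (hf : MorAt A (aff E) f x) (hg : MorAt A (aff F) g x) :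
    MorAt A (aff G) (fun y => β (f y) (g y)) x := by
  let b := Module.finBasis ℂ E
  have : ∀ y, β (f y) (g y) = ∑ i, b.coord i (f y) • β (b i) (g y) := by
    intro y
    conv_lhs => rw [← b.sum_repr (f y)]
    simp [-Module.Basis.sum_repr]
  simp only [this]
  exact MorAt.sum _ fun i _ => MorAt.smul (morAt_aff_iff.1 hf _) (hg.linear _)

theorem MorAt.compL [FiniteDimensional ℂ F] [FiniteDimensional ℂ G] {f : X → F →ₗ[ℂ] G}
    {g : X → E →ₗ[ℂ] F} (hf : MorAt A (aff _) f x) (hg : MorAt A (aff _) g x) :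
    MorAt A (aff (E →ₗ[ℂ] G)) (fun y => f y ∘ₗ g y) x :=
  MorAt.bilin (LinearMap.llcomp ℂ E F G) hf hg

theorem MorAt.applyL [FiniteDimensional ℂ E] [FiniteDimensional ℂ F] {f : X → E →ₗ[ℂ] F}
    {g : X → E} (hf : MorAt A (aff _) f x) (hg : MorAt A (aff _) g x) :
    MorAt A (aff F) (fun y => f y (g y)) x :=
  MorAt.bilin LinearMap.id hf hg

theorem morAt_aff_prod {f : X → E × F} (h1 : MorAt A (aff E) (fun y => (f y).1) x)
    (h2 : MorAt A (aff F) (fun y => (f y).2) x) : MorAt A (aff (E × F)) f x := by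
  have := (h1.linear (LinearMap.inl ℂ E F)).add (h2.linear (LinearMap.inr ℂ E F))
  simpa using this

theorem morAt_aff_pi {ι : Type*} [Fintype ι] {f : X → ι → E}
    (h : ∀ i, MorAt A (aff E) (fun y => f y i) x) : MorAt A (aff (ι → E)) f x := by
  classical
  have := MorAt.sum Finset.univ fun i _ => (h i).linear (LinearMap.single ℂ (fun _ => E) i)
  convert this using 2 with y
  ext j
  simp [Finset.sum_apply, Pi.single_apply]

theorem MorAt.eventually_ne [FiniteDimensional ℂ E] {f : X → E} (hf : MorAt A (aff E) f x)
    (h : f x ≠ 0) : ∀ᶠ y in A.nhd x, f y ≠ 0 := by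
  obtain ⟨φ, hφ⟩ : ∃ φ : Module.Dual ℂ E, φ (f x) ≠ 0 := by
    by_contra! hc
    exact h ((Module.forall_dual_apply_eq_zero_iff ℂ _).1 hc)
  filter_upwards [(morAt_aff_iff.1 hf φ).ne hφ] with y hy h0
  simp [h0] at hy

theorem isClosed_setOf_eq [FiniteDimensional ℂ E] {f g : X → E} (hf : IsMorphism A (aff E) f)
    (hg : IsMorphism A (aff E) g) : A.IsClosed {y | f y = g y} := by
  rw [isClosed_iff]
  intro x hx
  filter_upwards [((hf.morAt x).sub (hg.morAt x)).eventually_ne (sub_ne_zero.2 hx)] with y hy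
  exact sub_ne_zero.1 hy

/-! ### Determinants, inverses, and the openness of rank conditions -/

theorem regAt_det {n : Type*} [Fintype n] [DecidableEq n] {M : X → Matrix n n ℂ}
    (h : ∀ i j, A.RegAt (fun y => M y i j) x) : A.RegAt (fun y => (M y).det) x := by
  simp only [Matrix.det_apply']
  exact RegAt.sum _ fun σ _ => (A.regAt_const _ x).mul (RegAt.prod _ fun i _ => h _ _)

variable [FiniteDimensional ℂ E] [FiniteDimensional ℂ F]

/-- A regular family of linear maps that is invertible at a point has a regular inverse near that
point. -/
theorem MorAt.exists_inverse {M : X → E →ₗ[ℂ] F} (hM : MorAt A (aff _) M x)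
    (hx : Function.Bijective (M x)) : ∃ N : X → F →ₗ[ℂ] E, MorAt A (aff _) N x ∧
      ∀ᶠ y in A.nhd x, N y ∘ₗ M y = LinearMap.id ∧ M y ∘ₗ N y = LinearMap.id := by
  classical
  let e := LinearEquiv.ofBijective (M x) hx
  let b := Module.finBasis ℂ E
  let T : X → Matrix _ _ ℂ := fun y => LinearMap.toMatrix b b (e.symm.toLinearMap ∘ₗ M y)
  have hT : ∀ i j, A.RegAt (fun y => T y i j) x := fun i j => by
    have h1 : MorAt A (aff E) (fun y => e.symm (M y (b j))) x :=
      (hM.applyL (morAt_const (b j) x)).linear e.symm.toLinearMap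
    simpa [T, LinearMap.toMatrix_apply] using morAt_aff_iff.1 h1 (b.coord i)
  have hTx : (T x).det ≠ 0 := by
    have : e.symm.toLinearMap ∘ₗ M x = LinearMap.id :=
      LinearMap.ext fun v => e.symm_apply_apply v
    simp [T, this]
  have hinv : ∀ i j, A.RegAt (fun y => (T y)⁻¹ i j) x := fun i j => by
    simp only [Matrix.inv_def, Matrix.smul_apply, Ring.inverse_eq_inv', smul_eq_mul]
    refine (RegAt.inv (regAt_det hT) hTx).mul ?_
    simp only [Matrix.adjugate_apply]
    refine regAt_det fun k l => ?_
    by_cases hk : k = j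
    · subst hk
      simpa using A.regAt_const _ x
    · simpa [Matrix.updateRow_apply, hk] using hT k l
  refine ⟨fun y => Matrix.toLin b b (T y)⁻¹ ∘ₗ e.symm.toLinearMap, ?_, ?_⟩
  · refine MorAt.compL ?_ (morAt_const _ x)
    have : ∀ y, Matrix.toLin b b (T y)⁻¹ =
        ∑ i, ∑ j, (T y)⁻¹ i j • Matrix.toLin b b (Matrix.single i j 1) := by
      intro y
      conv_lhs => rw [Matrix.matrix_eq_sum_single (T y)⁻¹]
      simp only [map_sum]
      refine Finset.sum_congr rfl fun i _ => Finset.sum_congr rfl fun j _ => ?_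
      rw [← map_smul, Matrix.smul_single, smul_eq_mul, mul_one]
    simp only [this]
    exact MorAt.sum _ fun i _ => MorAt.sum _ fun j _ => MorAt.smul (hinv i j) (morAt_const _ x)
  · filter_upwards [(regAt_det hT).ne hTx] with y hy
    have hu : IsUnit (T y).det := isUnit_iff_ne_zero.2 hy
    have h1 : Matrix.toLin b b (T y)⁻¹ ∘ₗ (e.symm.toLinearMap ∘ₗ M y) = LinearMap.id := by
      rw [← Matrix.toLin_toMatrix b b (e.symm.toLinearMap ∘ₗ M y), ← Matrix.toLin_mul b b b,
        Matrix.nonsing_inv_mul _ hu, Matrix.toLin_one]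
    have h2 : (e.symm.toLinearMap ∘ₗ M y) ∘ₗ Matrix.toLin b b (T y)⁻¹ = LinearMap.id := by
      rw [← Matrix.toLin_toMatrix b b (e.symm.toLinearMap ∘ₗ M y), ← Matrix.toLin_mul b b b,
        Matrix.mul_nonsing_inv _ hu, Matrix.toLin_one]
    refine ⟨h1, ?_⟩
    ext v
    have := congrArg e (LinearMap.congr_fun h2 (e.symm v))
    simpa using this

theorem MorAt.eventually_bijective {M : X → E →ₗ[ℂ] F} (hM : MorAt A (aff _) M x)
    (hx : Function.Bijective (M x)) : ∀ᶠ y in A.nhd x, Function.Bijective (M y) := by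
  obtain ⟨N, -, hN⟩ := hM.exists_inverse hx
  filter_upwards [hN] with y hy
  exact Function.bijective_iff_has_inverse.2
    ⟨N y, fun v => LinearMap.congr_fun hy.1 v, fun v => LinearMap.congr_fun hy.2 v⟩

theorem MorAt.eventually_injective {M : X → E →ₗ[ℂ] F} (hM : MorAt A (aff _) M x)
    (hx : Function.Injective (M x)) : ∀ᶠ y in A.nhd x, Function.Injective (M y) := by
  obtain ⟨L, hL⟩ := (M x).exists_leftInverse_of_injective (LinearMap.ker_eq_bot.2 hx)
  have h : MorAt A (aff (E →ₗ[ℂ] E)) (fun y => L ∘ₗ M y) x := MorAt.compL (morAt_const _ x) hM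
  filter_upwards [h.eventually_bijective (by rw [hL]; exact Function.bijective_id)] with y hy
  exact Function.Injective.of_comp (f := L) (by simpa using hy.1)

theorem MorAt.eventually_surjective {M : X → E →ₗ[ℂ] F} (hM : MorAt A (aff _) M x)
    (hx : Function.Surjective (M x)) : ∀ᶠ y in A.nhd x, Function.Surjective (M y) := by
  obtain ⟨L, hL⟩ := (M x).exists_rightInverse_of_surjective (LinearMap.range_eq_top.2 hx)
  have h : MorAt A (aff (F →ₗ[ℂ] F)) (fun y => M y ∘ₗ L) x := MorAt.compL hM (morAt_const _ x)
  filter_upwards [h.eventually_bijective (by rw [hL]; exact Function.bijective_id)] with y hy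
  exact Function.Surjective.of_comp (g := L) (by simpa using hy.2)

omit [FiniteDimensional ℂ E] in
theorem MorAt.linearCombination {d : ℕ} {v : X → Fin d → E} (hv : MorAt A (aff (Fin d → E)) v x) :
    MorAt A (aff ((Fin d → ℂ) →ₗ[ℂ] E)) (fun y => Fintype.linearCombination ℂ (v y)) x :=
  hv.linear (Fintype.bilinearCombination ℂ ℂ)

theorem MorAt.eventually_linearIndependent {d : ℕ} {v : X → Fin d → E}
    (hv : MorAt A (aff (Fin d → E)) v x) (hx : LinearIndependent ℂ (v x)) :
    ∀ᶠ y in A.nhd x, LinearIndependent ℂ (v y) := by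
  simp only [linearIndependent_iff_injective_fintypeLinearCombination] at *
  exact hv.linearCombination.eventually_injective hx

end Affine

/-! ### Isomorphisms -/

section Iso

variable {X : Type u} {Y : Type v} {Z : Type w} {A : AlgStr X} {B : AlgStr Y} {C : AlgStr Z}

theorem IsIso.mk {φ : X → Y} {ψ : Y → X} (hφ : ∀ x, MorAt A B φ x) (hψ : ∀ y, MorAt B A ψ y)
    (h1 : ∀ x, ψ (φ x) = x) (h2 : ∀ y, φ (ψ y) = y) : IsIso A B φ :=
  ⟨isMorphism_iff.2 hφ, ψ, isMorphism_iff.2 hψ, h1, h2⟩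

theorem IsIso.exists_symm {φ : X → Y} (h : IsIso A B φ) : ∃ ψ, IsIso B A ψ ∧
    (∀ x, ψ (φ x) = x) ∧ ∀ y, φ (ψ y) = y := by
  obtain ⟨hφ, ψ, hψ, h1, h2⟩ := h
  exact ⟨ψ, ⟨hψ, φ, hφ, h2, h1⟩, h1, h2⟩

theorem IsIso.comp {φ : X → Y} {ψ : Y → Z} (hψ : IsIso B C ψ) (hφ : IsIso A B φ) :
    IsIso A C (fun x => ψ (φ x)) := by
  obtain ⟨φ', hφ', h1, h2⟩ := hφ.exists_symm
  obtain ⟨ψ', hψ', h3, h4⟩ := hψ.exists_symm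
  refine ⟨isMorphism_comp hψ.1 hφ.1, fun z => φ' (ψ' z), isMorphism_comp hφ'.1 hψ'.1, ?_, ?_⟩
  · intro x
    simp [h3, h1]
  · intro z
    simp [h4, h2]

theorem IsIso.bijective {φ : X → Y} (h : IsIso A B φ) : Function.Bijective φ := by
  obtain ⟨ψ, -, h1, h2⟩ := h.exists_symm
  exact Function.bijective_iff_has_inverse.2 ⟨ψ, h1, h2⟩

end Iso

end AlgStr

/-! ### Projections along a complement -/

section Projections

variable {E T : Type*} [AddCommGroup E] [Module ℂ E] [AddCommGroup T] [Module ℂ T]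

open Classical in
/-- The endomorphism of `E` projecting onto `S` along `C`; it is `0` if `S` and `C` are not
complementary. -/
noncomputable def projAlong (C S : Submodule ℂ E) : E →ₗ[ℂ] E :=
  if h : IsCompl S C then S.projection C h else 0

variable {C S : Submodule ℂ E}

theorem projAlong_eq (h : IsCompl S C) : projAlong C S = S.projection C h := dif_pos h

theorem projAlong_mem (C S : Submodule ℂ E) (x : E) : projAlong C S x ∈ S := by
  by_cases h : IsCompl S C
  · rw [projAlong_eq h]
    exact Submodule.projection_apply_mem h x
  · simp [projAlong, h]

theorem projAlong_of_mem (h : IsCompl S C) {x : E} (hx : x ∈ S) : projAlong C S x = x := by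
  rw [projAlong_eq h]
  exact Submodule.projection_apply_of_mem_left h hx

theorem projAlong_of_mem_right (h : IsCompl S C) {x : E} (hx : x ∈ C) : projAlong C S x = 0 := by
  rw [projAlong_eq h]
  exact (Submodule.projection_apply_eq_zero_iff h).2 hx

theorem sub_projAlong_mem (h : IsCompl S C) (x : E) : x - projAlong C S x ∈ C := by
  rw [← Submodule.projection_apply_eq_zero_iff h, ← projAlong_eq h, map_sub,
    projAlong_of_mem h (projAlong_mem C S x), sub_self]

theorem projAlong_unique (h : IsCompl S C) {x s : E} (hs : s ∈ S) (hx : x - s ∈ C) :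
    projAlong C S x = s := by
  have := projAlong_of_mem_right h hx
  rwa [map_sub, projAlong_of_mem h hs, sub_eq_zero] at this

theorem isCompl_range_iff {L : T →ₗ[ℂ] E} (hL : Function.Injective L) :
    IsCompl (LinearMap.range L) C ↔ Function.Bijective (C.mkQ ∘ₗ L) := by
  constructor
  · intro h
    constructor
    · rw [injective_iff_map_eq_zero]
      intro t ht
      have h1 : L t ∈ C := by simpa using ht
      have h2 := (Submodule.disjoint_def.1 h.disjoint) (L t) ⟨t, rfl⟩ h1
      exact hL (by rw [h2, map_zero])
    · intro y
      obtain ⟨e, rfl⟩ := C.mkQ_surjective y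
      obtain ⟨_, ⟨t, rfl⟩, c, hc, rfl⟩ := Submodule.mem_sup.1
        (h.sup_eq_top ▸ Submodule.mem_top : e ∈ LinearMap.range L ⊔ C)
      exact ⟨t, by simpa using hc⟩
  · intro h
    constructor
    · rw [Submodule.disjoint_def]
      rintro _ ⟨t, rfl⟩ ht
      have : t = 0 := h.1 (by simpa using ht)
      rw [this, map_zero]
    · rw [codisjoint_iff, eq_top_iff]
      intro e _
      obtain ⟨t, ht⟩ := h.2 (C.mkQ e)
      refine Submodule.mem_sup.2 ⟨L t, ⟨t, rfl⟩, e - L t, ?_, by abel⟩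
      rw [← Submodule.ker_mkQ C, LinearMap.mem_ker, map_sub, ← ht]
      simp

theorem range_fintypeLinearCombination {d : ℕ} (v : Fin d → E) :
    LinearMap.range (Fintype.linearCombination ℂ v) = Submodule.span ℂ (Set.range v) :=
  Fintype.range_linearCombination ℂ v

/-- Any subspace has a complement spanned by members of a given basis. -/
theorem exists_isCompl_span_basis {ι : Type*} (b : Module.Basis ι ℂ E) (S : Submodule ℂ E) :
    ∃ I : Set ι, IsCompl S (Submodule.span ℂ (b '' I)) := by
  obtain ⟨κ, a, ha, hspan, hli⟩ := exists_linearIndependent' ℂ (fun i => S.mkQ (b i))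
  refine ⟨Set.range a, ?_⟩
  have hrange : b '' Set.range a = Set.range (b ∘ a) := (Set.range_comp b a).symm
  rw [hrange, ← Finsupp.range_linearCombination]
  have hinj : Function.Injective (Finsupp.linearCombination ℂ (b ∘ a)) :=
    linearIndependent_iff_injective_finsuppLinearCombination.1 (b.linearIndependent.comp a ha)
  have hcomp : S.mkQ ∘ₗ Finsupp.linearCombination ℂ (b ∘ a) =
      Finsupp.linearCombination ℂ ((fun i => S.mkQ (b i)) ∘ a) := by
    ext; simp
  refine ((isCompl_range_iff hinj).2 ?_).symm
  rw [hcomp]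
  refine ⟨linearIndependent_iff_injective_finsuppLinearCombination.1 hli, ?_⟩
  rw [← LinearMap.range_eq_top, Finsupp.range_linearCombination, hspan, Set.range_comp' S.mkQ b,
    Submodule.span_image, b.span_eq, Submodule.map_top, LinearMap.range_eq_top]
  exact S.mkQ_surjective

end Projections

/-! ### The Grassmann variety -/

section Grassmannian

open AlgStr

variable {X : Type*} {A : AlgStr X} {x : X} {d : ℕ}
variable {E : Type u} [AddCommGroup E] [Module ℂ E] [FiniteDimensional ℂ E]
variable {T F : Type*} [AddCommGroup T] [Module ℂ T] [FiniteDimensional ℂ T]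
  [AddCommGroup F] [Module ℂ F] [FiniteDimensional ℂ F]

theorem finrank_isCompl {S C S' : Submodule ℂ E} (h : IsCompl S C) (h' : IsCompl S' C) :
    Module.finrank ℂ S = Module.finrank ℂ S' := by
  have h1 := Submodule.finrank_add_eq_of_isCompl h
  have h2 := Submodule.finrank_add_eq_of_isCompl h'
  omega

omit [FiniteDimensional ℂ E] in
theorem linearIndependent_of_span_eq {v : Fin d → E} {S : Gr d E}
    (h : Submodule.span ℂ (Set.range v) = S.1) : LinearIndependent ℂ v := by
  rw [linearIndependent_iff_card_eq_finrank_span, Set.finrank, h, S.2, Fintype.card_fin]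

omit [FiniteDimensional ℂ E] in
/-- A family of subspaces is regular at `x` if it is spanned by a regular frame near `x`. -/
theorem morAt_grass_of_frame {S : X → Gr d E} {v : X → Fin d → E}
    (hv : MorAt A (aff (Fin d → E)) v x)
    (h : ∀ᶠ y in A.nhd x, Submodule.span ℂ (Set.range (v y)) = (S y).1) :
    MorAt A (grass d E) S x := by
  classical
  have hx : LinearIndependent ℂ (v x) := by
    have := self_of_nhd h
    exact linearIndependent_of_span_eq this
  let w : X → {v : Fin d → E | LinearIndependent ℂ v} := fun y =>
    if hy : LinearIndependent ℂ (v y) then ⟨v y, hy⟩ else ⟨v x, hx⟩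
  have hw : MorAt A ((aff (Fin d → E)).sub {v | LinearIndependent ℂ v}) w x := by
    rw [morAt_sub_iff]
    refine hv.congr ?_
    filter_upwards [h] with y hy
    have := linearIndependent_of_span_eq hy
    simp [w, this]
  refine ((morAt_coinduced (frameSpan d E) _ (w x)).comp hw).congr ?_
  filter_upwards [h] with y hy
  have := linearIndependent_of_span_eq hy
  apply Subtype.ext
  simp [w, this, frameSpan, hy]

/-- A family of subspaces is regular at `x` if near `x` it consists of the images of a regular
family of linear maps. -/
theorem morAt_grass_of_range {S : X → Gr d E} {M : X → T →ₗ[ℂ] E} (hT : Module.finrank ℂ T = d)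
    (hM : MorAt A (aff (T →ₗ[ℂ] E)) M x) (h : ∀ᶠ y in A.nhd x, LinearMap.range (M y) = (S y).1) :
    MorAt A (grass d E) S x := by
  let b := Module.finBasisOfFinrankEq ℂ T hT
  refine morAt_grass_of_frame (v := fun y i => M y (b i))
    (morAt_aff_pi fun i => hM.applyL (morAt_const (b i) x)) ?_
  filter_upwards [h] with y hy
  rw [Set.range_comp' (M y) b, Submodule.span_image, b.span_eq, Submodule.map_top, hy]

/-- A family of subspaces is regular at `x` if near `x` it consists of the kernels of a regular
family of surjective linear maps. -/
theorem morAt_grass_of_ker {S : X → Gr d E} {M : X → E →ₗ[ℂ] F}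
    (hM : MorAt A (aff (E →ₗ[ℂ] F)) M x) (hx : Function.Surjective (M x))
    (h : ∀ᶠ y in A.nhd x, LinearMap.ker (M y) = (S y).1) : MorAt A (grass d E) S x := by
  obtain ⟨R, hR⟩ := Submodule.exists_isCompl (LinearMap.ker (M x))
  have hbij : Function.Bijective (M x ∘ₗ R.subtype) := by
    constructor
    · rw [injective_iff_map_eq_zero]
      intro r hr
      exact Subtype.ext (Submodule.disjoint_def.1 hR.disjoint r.1 hr r.2)
    · intro f
      obtain ⟨e, rfl⟩ := hx f
      obtain ⟨k, hk, r, hr, rfl⟩ := Submodule.mem_sup.1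
        (hR.sup_eq_top ▸ Submodule.mem_top : e ∈ LinearMap.ker (M x) ⊔ R)
      refine ⟨⟨r, hr⟩, ?_⟩
      have : M x k = 0 := hk
      simp [this]
  have hMR : MorAt A (aff (R →ₗ[ℂ] F)) (fun y => M y ∘ₗ R.subtype) x :=
    hM.compL (morAt_const _ x)
  obtain ⟨N, hN, hNM⟩ := hMR.exists_inverse hbij
  let K := LinearMap.ker (M x)
  have hK : Module.finrank ℂ K = d := by
    have := self_of_nhd h
    exact (congrArg (fun S : Submodule ℂ E => Module.finrank ℂ S) this).trans (S x).2
  have hL : MorAt A (aff (K →ₗ[ℂ] E))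
      (fun y => K.subtype - R.subtype ∘ₗ N y ∘ₗ M y ∘ₗ K.subtype) x :=
    (morAt_const _ x).sub ((morAt_const R.subtype x).compL
      (hN.compL (hM.compL (morAt_const K.subtype x))))
  refine morAt_grass_of_range hK hL ?_
  filter_upwards [h, hNM] with y hy hyN
  rw [← hy]
  apply le_antisymm
  · rintro _ ⟨k, rfl⟩
    have := LinearMap.congr_fun hyN.2 (M y k)
    simp only [LinearMap.comp_apply, Submodule.subtype_apply, LinearMap.id_apply] at this
    simp [this]
  · intro e he
    obtain ⟨k, hk, r, hr, rfl⟩ := Submodule.mem_sup.1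
      (hR.sup_eq_top ▸ Submodule.mem_top : e ∈ LinearMap.ker (M x) ⊔ R)
    refine ⟨⟨k, hk⟩, ?_⟩
    have h1 : M y k = -M y r := by
      rw [LinearMap.mem_ker, map_add] at he
      exact eq_neg_of_add_eq_zero_left he
    have h2 : N y (M y r) = ⟨r, hr⟩ := LinearMap.congr_fun hyN.1 ⟨r, hr⟩
    simp [h1, h2]

/-- The chart of the Grassmannian formed by the complements of `C`. -/
def grChart (d : ℕ) (C : Submodule ℂ E) : Set (Gr d E) := {S | IsCompl S.1 C}

omit [FiniteDimensional ℂ E] in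
theorem isCompl_span_iff {C : Submodule ℂ E} {v : Fin d → E} (hv : LinearIndependent ℂ v) :
    IsCompl (Submodule.span ℂ (Set.range v)) C ↔
      Function.Bijective (C.mkQ ∘ₗ Fintype.linearCombination ℂ v) := by
  rw [← range_fintypeLinearCombination]
  exact isCompl_range_iff (linearIndependent_iff_injective_fintypeLinearCombination.1 hv)

theorem isOpen_grChart (C : Submodule ℂ E) : (grass d E).IsOpen (grChart d C) := by
  rw [grass, AlgStr.isOpen_coinduced, AlgStr.isOpen_iff]
  intro v hv
  have hM : MorAt ((aff (Fin d → E)).sub {v | LinearIndependent ℂ v})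
      (aff ((Fin d → ℂ) →ₗ[ℂ] E ⧸ C))
      (fun v => C.mkQ ∘ₗ Fintype.linearCombination ℂ v.1) v :=
    (morAt_const C.mkQ v).compL (morAt_val _ _ v).linearCombination
  filter_upwards [hM.eventually_bijective ((isCompl_span_iff v.2).1 hv)] with w hw
  exact (isCompl_span_iff w.2).2 hw

/-- If `S` has a regular frame `v` near `x`, the projection onto `S` along a complement is
regular. -/
theorem morAt_projAlong_span {C : Submodule ℂ E} {v : X → Fin d → E}
    (hv : MorAt A (aff (Fin d → E)) v x) (hli : LinearIndependent ℂ (v x))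
    (hC : IsCompl (Submodule.span ℂ (Set.range (v x))) C) :
    MorAt A (aff (E →ₗ[ℂ] E)) (fun y => projAlong C (Submodule.span ℂ (Set.range (v y)))) x := by
  have hM : MorAt A (aff ((Fin d → ℂ) →ₗ[ℂ] E ⧸ C))
      (fun y => C.mkQ ∘ₗ Fintype.linearCombination ℂ (v y)) x :=
    (morAt_const C.mkQ x).compL hv.linearCombination
  have hbij := (isCompl_span_iff hli).1 hC
  obtain ⟨N, hN, hNM⟩ := hM.exists_inverse hbij
  refine (hv.linearCombination.compL (hN.compL (morAt_const C.mkQ x))).congr ?_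
  filter_upwards [hNM, hv.eventually_linearIndependent hli, hM.eventually_bijective hbij] with
    y hy hyv hyb
  refine (LinearMap.ext fun e => projAlong_unique ((isCompl_span_iff hyv).2 hyb) ?_ ?_).symm
  · rw [← range_fintypeLinearCombination]
    exact ⟨_, rfl⟩
  · rw [← Submodule.Quotient.mk_eq_zero, Submodule.Quotient.mk_sub, sub_eq_zero]
    exact (LinearMap.congr_fun hy.2 (C.mkQ e)).symm

theorem morAt_projAlong {C : Submodule ℂ E} {S : Gr d E} (h : IsCompl S.1 C) :
    MorAt (grass d E) (aff (E →ₗ[ℂ] E)) (fun S => projAlong C S.1) S := by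
  refine morAt_of_coinduced (isOpen_grChart C) h fun v hv => ?_
  exact morAt_projAlong_span (morAt_val _ _ v) v.2 hv

theorem eventually_isCompl {C : Submodule ℂ E} {S : Gr d E} (h : IsCompl S.1 C) :
    ∀ᶠ S in (grass d E).nhd S, IsCompl S.1 C := AlgStr.isOpen_iff.1 (isOpen_grChart C) S h

theorem eq_of_le_of_gr {S T : Gr d E} (h : S.1 ≤ T.1) : S = T :=
  Subtype.ext (Submodule.eq_of_le_of_finrank_eq h (S.2.trans T.2.symm))

/-- The diagonal is closed. -/
def AlgStr.IsSeparated {X : Type*} (A : AlgStr X) : Prop :=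
  (A.prod A).IsClosed {z | z.1 = z.2}

theorem isSeparated_grass (d : ℕ) (E : Type u) [AddCommGroup E] [Module ℂ E]
    [FiniteDimensional ℂ E] : (grass d E).IsSeparated := by
  refine isClosed_iff.2 ?_
  rintro ⟨S, T⟩ hne
  obtain ⟨C, hC⟩ := Submodule.exists_isCompl S.1
  obtain ⟨C', hC'⟩ := Submodule.exists_isCompl T.1
  -- on the product of the two charts, `S ≤ T` is expressed by the vanishing of this regular map
  have hM : MorAt ((grass d E).prod (grass d E)) (aff (E →ₗ[ℂ] E))
      (fun z => projAlong C z.1.1 - projAlong C' z.2.1 ∘ₗ projAlong C z.1.1) (S, T) := by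
    have h1 : MorAt ((grass d E).prod (grass d E)) (aff (E →ₗ[ℂ] E))
        (fun z => projAlong C z.1.1) (S, T) :=
      MorAt.comp (ψ := fun S : Gr d E => projAlong C S.1) (morAt_projAlong hC) (morAt_fst _)
    have h2 : MorAt ((grass d E).prod (grass d E)) (aff (E →ₗ[ℂ] E))
        (fun z => projAlong C' z.2.1) (S, T) :=
      MorAt.comp (ψ := fun S : Gr d E => projAlong C' S.1) (morAt_projAlong hC') (morAt_snd _)
    exact h1.sub (h2.compL h1)
  have hne' : projAlong C S.1 - projAlong C' T.1 ∘ₗ projAlong C S.1 ≠ 0 := by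
    intro h0
    refine hne (eq_of_le_of_gr fun s hs => ?_)
    have := LinearMap.congr_fun (sub_eq_zero.1 h0) s
    rw [LinearMap.comp_apply, projAlong_of_mem hC hs] at this
    rw [this]
    exact projAlong_mem _ _ _
  filter_upwards [hM.eventually_ne hne', (morAt_fst _).mem (eventually_isCompl hC),
    (morAt_snd _).mem (eventually_isCompl hC')] with z hz h1 h2
  rintro (h : z.1 = z.2)
  refine hz (sub_eq_zero.2 (LinearMap.ext fun e => ?_))
  rw [LinearMap.comp_apply, projAlong_of_mem h2 (h ▸ projAlong_mem _ _ _)]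

/-- The chart of complements of `C` is isomorphic to the vector space of linear maps from one
complement of `C` to `C`: a complement is the graph of such a map. -/
theorem exists_isIso_grChart {C : Submodule ℂ E} (S₀ : Gr d E) (h₀ : IsCompl S₀.1 C) :
    ∃ φ, IsIso ((grass d E).sub (grChart d C)) (aff (S₀.1 →ₗ[ℂ] C)) φ := by
  let P : E →ₗ[ℂ] C := C.projectionOnto S₀.1 h₀.symm
  have hP : ∀ c : C, P c = c := fun c => Submodule.projectionOnto_apply_left _ c
  have hP0 : ∀ s : S₀.1, P s = 0 := fun s => Submodule.projectionOnto_apply_right _ s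
  let L : (S₀.1 →ₗ[ℂ] C) → S₀.1 →ₗ[ℂ] E := fun h => S₀.1.subtype + C.subtype ∘ₗ h
  have hLinj : ∀ h, Function.Injective (L h) := by
    intro h
    rw [injective_iff_map_eq_zero]
    intro s hs
    have h1 : P (L h s) = h s := by simp [L, hP, hP0]
    rw [hs, map_zero] at h1
    simpa [L, ← h1] using hs
  have hLC : ∀ h, IsCompl (LinearMap.range (L h)) C := by
    intro h
    rw [isCompl_range_iff (hLinj h)]
    have : C.mkQ ∘ₗ L h = C.mkQ ∘ₗ S₀.1.subtype := by
      ext s; simp [L]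
    rw [this, ← isCompl_range_iff S₀.1.injective_subtype, Submodule.range_subtype]
    exact h₀
  let ψ : (S₀.1 →ₗ[ℂ] C) → grChart d C := fun h =>
    ⟨⟨LinearMap.range (L h), (finrank_isCompl (hLC h) h₀).trans S₀.2⟩, hLC h⟩
  have hproj : ∀ (S : grChart d C) (s : S₀.1),
      projAlong C S.1.1 s = s + (P (projAlong C S.1.1 s) : E) := by
    intro S s
    have h1 := sub_projAlong_mem S.2 (s : E)
    have h2 : ((P (s - projAlong C S.1.1 s) : C) : E) = s - projAlong C S.1.1 s := by
      simpa using congrArg Subtype.val (hP ⟨_, h1⟩)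
    rw [map_sub, hP0, zero_sub, Submodule.coe_neg] at h2
    rw [neg_eq_iff_eq_neg] at h2
    rw [h2]
    abel
  refine ⟨fun S => P ∘ₗ projAlong C S.1.1 ∘ₗ S₀.1.subtype, IsIso.mk (ψ := ψ) ?_ ?_ ?_ ?_⟩
  · intro S
    have h1 : MorAt ((grass d E).sub (grChart d C)) (aff (E →ₗ[ℂ] E))
        (fun S => projAlong C S.1.1) S :=
      MorAt.restrict (φ := fun S : Gr d E => projAlong C S.1) (morAt_projAlong S.2)
    exact (morAt_const P S).compL (h1.compL (morAt_const S₀.1.subtype S))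
  · intro h
    rw [morAt_sub_iff]
    refine morAt_grass_of_range (T := S₀.1) (M := L) S₀.2 ?_ (Eventually.of_forall fun h => rfl)
    exact (morAt_const _ h).add ((morAt_const C.subtype h).compL (morAt_id _ h))
  · intro S
    refine Subtype.ext (eq_of_le_of_gr ?_)
    rintro _ ⟨s, rfl⟩
    have : L (P ∘ₗ projAlong C S.1.1 ∘ₗ S₀.1.subtype) s = projAlong C S.1.1 s := (hproj S s).symm
    rw [this]
    exact projAlong_mem _ _ _
  · intro h
    refine LinearMap.ext fun s => ?_
    have : projAlong C (LinearMap.range (L h)) s = L h s :=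
      projAlong_unique (hLC h) ⟨s, rfl⟩ (by simp [L])
    simp [ψ, this, L, hP, hP0]

end Grassmannian

/-! ### Atlases by affine spaces -/

namespace AlgStr

section Atlas

variable {X : Type u} {Y : Type v} {Z : Type w} {A : AlgStr X} {B : AlgStr Y} {C : AlgStr Z}

theorem isIso_linearEquiv {E F : Type*} [AddCommGroup E] [Module ℂ E] [AddCommGroup F]
    [Module ℂ F] (e : E ≃ₗ[ℂ] F) : IsIso (aff E) (aff F) e :=
  IsIso.mk (ψ := e.symm) (fun x => morAt_linear e.toLinearMap x)
    (fun y => morAt_linear e.symm.toLinearMap y) e.symm_apply_apply e.apply_symm_apply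

theorem isIso_aff_prod (E F : Type*) [AddCommGroup E] [Module ℂ E] [AddCommGroup F]
    [Module ℂ F] : IsIso ((aff E).prod (aff F)) (aff (E × F)) (fun z => z) :=
  IsIso.mk (ψ := fun z => z) (fun z => morAt_aff_prod (morAt_fst z) (morAt_snd z))
    (fun z => (morAt_linear (LinearMap.fst ℂ E F) z).prodMk (morAt_linear (LinearMap.snd ℂ E F) z))
    (fun _ => rfl) fun _ => rfl

theorem IsIso.prodMap {X' Y' : Type*} {A' : AlgStr X'} {B' : AlgStr Y'} {φ : X → X'} {ψ : Y → Y'}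
    (hφ : IsIso A A' φ) (hψ : IsIso B B' ψ) :
    IsIso (A.prod B) (A'.prod B') (fun z => (φ z.1, ψ z.2)) := by
  obtain ⟨φ', hφ', h1, h2⟩ := hφ.exists_symm
  obtain ⟨ψ', hψ', h3, h4⟩ := hψ.exists_symm
  exact IsIso.mk (ψ := fun z => (φ' z.1, ψ' z.2))
    (fun z => ((hφ.1.morAt _).comp (morAt_fst z)).prodMk ((hψ.1.morAt _).comp (morAt_snd z)))
    (fun z => ((hφ'.1.morAt _).comp (morAt_fst z)).prodMk ((hψ'.1.morAt _).comp (morAt_snd z)))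
    (fun z => by simp [h1, h3]) (fun z => by simp [h2, h4])

theorem isIso_sub_prod (U : Set X) (V : Set Y) :
    IsIso ((A.prod B).sub (U ×ˢ V)) ((A.sub U).prod (B.sub V))
      (fun z => (⟨z.1.1, z.2.1⟩, ⟨z.1.2, z.2.2⟩)) := by
  refine IsIso.mk (ψ := fun z => ⟨(z.1.1, z.2.1), z.1.2, z.2.2⟩) (fun z => ?_) (fun z => ?_)
    (fun _ => rfl) fun _ => rfl
  · refine MorAt.prodMk (morAt_sub_iff.2 ?_) (morAt_sub_iff.2 ?_)
    · exact (morAt_val _ _ z).fst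
    · exact (morAt_val _ _ z).snd
  · refine morAt_sub_iff.2 (MorAt.prodMk ?_ ?_)
    · exact (morAt_val A U z.1).comp (morAt_fst z)
    · exact (morAt_val B V z.2).comp (morAt_snd z)

theorem isOpen_prod {U : Set X} {V : Set Y} (hU : A.IsOpen U) (hV : B.IsOpen V) :
    (A.prod B).IsOpen (U ×ˢ V) := by
  rw [Set.prod_eq]
  exact isOpen_inter (isMorphism_fst.isOpen_preimage hU) (isMorphism_snd.isOpen_preimage hV)

/-- `A` has a finite open covering by copies of `ℂⁿ` that all satisfy `P`. -/
def HasAtlas (A : AlgStr X) (n : ℕ) (P : Set X → Prop) : Prop :=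
  ∃ 𝒰 : Set (Set X), 𝒰.Finite ∧ ⋃₀ 𝒰 = Set.univ ∧ ∀ U ∈ 𝒰, A.IsOpen U ∧
    (∃ φ, IsIso (A.sub U) (aff (Fin n → ℂ)) φ) ∧ P U

theorem HasAtlas.prod {n m : ℕ} {P : Set X → Prop} {Q : Set Y → Prop} (hA : HasAtlas A n P)
    (hB : HasAtlas B m Q) :
    HasAtlas (A.prod B) (n + m) (fun W => ∃ U V, P U ∧ Q V ∧ W = U ×ˢ V) := by
  obtain ⟨𝒰, hfin, hcov, h⟩ := hA
  obtain ⟨𝒱, hfin', hcov', h'⟩ := hB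
  refine ⟨Set.image2 (fun U V => U ×ˢ V) 𝒰 𝒱, hfin.image2 _ hfin', ?_, ?_⟩
  · rw [Set.eq_univ_iff_forall] at *
    rintro ⟨x, y⟩
    obtain ⟨U, hU, hx⟩ := hcov x
    obtain ⟨V, hV, hy⟩ := hcov' y
    exact ⟨_, ⟨U, hU, V, hV, rfl⟩, hx, hy⟩
  · rintro _ ⟨U, hU, V, hV, rfl⟩
    obtain ⟨hUo, ⟨φ, hφ⟩, hP⟩ := h U hU
    obtain ⟨hVo, ⟨ψ, hψ⟩, hQ⟩ := h' V hV
    refine ⟨isOpen_prod hUo hVo, ?_, U, V, hP, hQ, rfl⟩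
    have e : ((Fin n → ℂ) × (Fin m → ℂ)) ≃ₗ[ℂ] (Fin (n + m) → ℂ) :=
      LinearEquiv.ofFinrankEq _ _ (by simp)
    exact ⟨_, (isIso_linearEquiv e).comp ((isIso_aff_prod _ _).comp
      ((hφ.prodMap hψ).comp (isIso_sub_prod U V)))⟩

theorem HasAtlas.mono {n : ℕ} {P Q : Set X → Prop} (hA : HasAtlas A n P) (h : ∀ U, P U → Q U) :
    HasAtlas A n Q := by
  obtain ⟨𝒰, hfin, hcov, h'⟩ := hA
  exact ⟨𝒰, hfin, hcov, fun U hU => ⟨(h' U hU).1, (h' U hU).2.1, h U (h' U hU).2.2⟩⟩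

theorem isAffineVariety_of_isIso {n : ℕ} {φ : X → Fin n → ℂ} (h : IsIso A (aff (Fin n → ℂ)) φ) :
    IsAffineVariety A := by
  refine ⟨n, Set.univ, ?_, fun x => ⟨φ x, trivial⟩, ?_⟩
  · exact isClosed_iff.2 fun x hx => (hx trivial).elim
  · obtain ⟨ψ, hψ, h1, h2⟩ := h.exists_symm
    exact IsIso.mk (ψ := fun y => ψ y.1) (fun x => morAt_sub_iff.2 (h.1.morAt x))
      (fun y => (hψ.1.morAt _).comp (morAt_val _ _ y)) h1 (fun y => Subtype.ext (h2 y.1))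

theorem HasAtlas.isVariety {n : ℕ} {P : Set X → Prop} (hA : HasAtlas A n P)
    (hsep : A.IsSeparated) : IsVariety A := by
  obtain ⟨𝒰, hfin, hcov, h⟩ := hA
  refine ⟨⟨𝒰, hfin, hcov, fun U hU => ⟨(h U hU).1, ?_⟩⟩, hsep⟩
  obtain ⟨φ, hφ⟩ := (h U hU).2.1
  exact isAffineVariety_of_isIso hφ

theorem IsSeparated.of_injective {φ : X → Y} (hB : B.IsSeparated) (hφ : IsMorphism A B φ)
    (hinj : Function.Injective φ) : A.IsSeparated := by
  have h : IsMorphism (A.prod A) (B.prod B) (fun z => (φ z.1, φ z.2)) :=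
    isMorphism_iff.2 fun z => ((hφ.morAt _).comp (morAt_fst z)).prodMk
      ((hφ.morAt _).comp (morAt_snd z))
  have heq : {z : X × X | z.1 = z.2} = (fun z => (φ z.1, φ z.2)) ⁻¹' {z | z.1 = z.2} :=
    Set.ext fun z => hinj.eq_iff.symm
  rw [IsSeparated, heq]
  exact h.isClosed_preimage hB

theorem IsSeparated.prod (hA : A.IsSeparated) (hB : B.IsSeparated) : (A.prod B).IsSeparated := by
  have h1 : IsMorphism ((A.prod B).prod (A.prod B)) (A.prod A) (fun z => (z.1.1, z.2.1)) :=
    isMorphism_iff.2 fun z => (morAt_fst z).fst.prodMk (morAt_snd z).fst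
  have h2 : IsMorphism ((A.prod B).prod (A.prod B)) (B.prod B) (fun z => (z.1.2, z.2.2)) :=
    isMorphism_iff.2 fun z => (morAt_fst z).snd.prodMk (morAt_snd z).snd
  refine isClosed_iff.2 fun z hz => ?_
  by_cases hz1 : z.1.1 = z.2.1
  · have hz2 : z.1.2 ≠ z.2.2 := fun h => hz (Prod.ext hz1 h)
    filter_upwards [isClosed_iff.1 (h2.isClosed_preimage hB) z hz2] with w hw h
    exact hw (congrArg Prod.snd h)
  · filter_upwards [isClosed_iff.1 (h1.isClosed_preimage hA) z hz1] with w hw h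
    exact hw (congrArg Prod.fst h)

theorem isSeparated_aff (E : Type*) [AddCommGroup E] [Module ℂ E] [FiniteDimensional ℂ E] :
    (aff E).IsSeparated := isClosed_setOf_eq isMorphism_fst isMorphism_snd

end Atlas

/-! ### Families of vector spaces embedded in a trivial bundle -/

section Bundle

variable {B : Type u} {F : B → Type v} [∀ b, AddCommGroup (F b)] [∀ b, Module ℂ (F b)]
  {A : AlgStr B}

/-- The family of vector spaces `F`, with the structure `E` on its total space, is a trivial vector
bundle of rank `r` over `U`. -/
def IsTrivialOver (E : AlgStr (Σ b, F b)) (A : AlgStr B) (r : ℕ) (U : Set B) : Prop :=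
  ∃ e : (Sigma.fst ⁻¹' U : Set (Σ b, F b)) → U × (Fin r → ℂ),
    IsIso (E.sub (Sigma.fst ⁻¹' U)) ((A.sub U).prod (aff (Fin r → ℂ))) e ∧
    (∀ z, (e z).1.1 = z.1.1) ∧
    ∀ (c : B) (hc : c ∈ U), IsLinearMap ℂ fun v : F c => (e ⟨⟨c, v⟩, hc⟩).2

theorem HasAtlas.isVectorBundle {E : AlgStr (Σ b, F b)} {n r : ℕ}
    (hE : IsMorphism E A Sigma.fst) (h : HasAtlas A n (IsTrivialOver E A r)) :
    IsVectorBundle E A := by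
  refine ⟨hE, fun b => ?_⟩
  obtain ⟨𝒰, -, hcov, h⟩ := h
  obtain ⟨U, hU, hb⟩ := Set.eq_univ_iff_forall.1 hcov b
  obtain ⟨e, he⟩ := (h U hU).2.2
  exact ⟨U, (h U hU).1, hb, r, e, he⟩

theorem HasAtlas.total {E : AlgStr (Σ b, F b)} {n r : ℕ}
    (hE : IsMorphism E A Sigma.fst) (h : HasAtlas A n (IsTrivialOver E A r)) :
    HasAtlas E (n + r) (fun _ => True) := by
  obtain ⟨𝒰, hfin, hcov, h⟩ := h
  refine ⟨(fun U => Sigma.fst ⁻¹' U) '' 𝒰, hfin.image _, ?_, ?_⟩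
  · rw [Set.eq_univ_iff_forall] at *
    intro z
    obtain ⟨U, hU, hz⟩ := hcov z.1
    exact ⟨_, ⟨U, hU, rfl⟩, hz⟩
  · rintro _ ⟨U, hU, rfl⟩
    obtain ⟨hUo, ⟨φ, hφ⟩, e, he, -⟩ := h U hU
    refine ⟨hE.isOpen_preimage hUo, ?_, trivial⟩
    have e' : ((Fin n → ℂ) × (Fin r → ℂ)) ≃ₗ[ℂ] (Fin (n + r) → ℂ) :=
      LinearEquiv.ofFinrankEq _ _ (by simp)
    exact ⟨_, (isIso_linearEquiv e').comp ((isIso_aff_prod _ _).comp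
      ((hφ.prodMap (isIso_linearEquiv (LinearEquiv.refl ℂ _))).comp he))⟩

/-- A family of subspaces `ι b (F b)` of `W` is a trivial bundle over `U` as soon as there are
fibrewise isomorphisms `θ b` with a fixed space `M` such that `θ` is induced by a linear map
`L` on `W`, and the inverses of the `θ b` form a regular map to `W`. -/
theorem isTrivialOver_of_embedding {W M : Type*} [AddCommGroup W] [Module ℂ W] [AddCommGroup M]
    [Module ℂ M] [FiniteDimensional ℂ M] {r : ℕ} (hr : Module.finrank ℂ M = r)
    (ι : (Σ b, F b) → W) {U : Set B}
    (θ : ∀ b ∈ U, F b ≃ₗ[ℂ] M) (L : W →ₗ[ℂ] M) (hL : ∀ b hb v, L (ι ⟨b, v⟩) = θ b hb v)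
    (R : B → M → W) (hRθ : ∀ b hb m, R b m = ι ⟨b, (θ b hb).symm m⟩)
    (hR : ∀ b ∈ U, ∀ m, MorAt (A.prod (aff M)) (aff W) (fun z => R z.1 z.2) (b, m)) :
    IsTrivialOver (induced (fun z => (z.1, ι z)) (A.prod (aff W))) A r U := by
  have e : M ≃ₗ[ℂ] (Fin r → ℂ) := LinearEquiv.ofFinrankEq _ _ (by simp [hr])
  refine ⟨fun z => (⟨z.1.1, z.2⟩, e (θ z.1.1 z.2 z.1.2)), ?_, fun _ => rfl, ?_⟩
  · refine IsIso.mk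
      (ψ := fun y => ⟨⟨y.1.1, (θ y.1.1 y.1.2).symm (e.symm y.2)⟩, y.1.2⟩) ?_ ?_ ?_ ?_
    · intro z
      have h : MorAt ((induced (fun z => (z.1, ι z)) (A.prod (aff W))).sub (Sigma.fst ⁻¹' U))
          (A.prod (aff W)) (fun z => (z.1.1, ι z.1)) z :=
        (morAt_induced _ _ _).comp (morAt_val _ _ z)
      refine MorAt.prodMk (morAt_sub_iff.2 h.fst) ?_
      have h2 := (h.snd.linear L).linear e.toLinearMap
      refine h2.congr (Eventually.of_forall fun z => ?_)
      exact congrArg e (hL z.1.1 z.2 z.1.2)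
    · intro y
      rw [morAt_sub_iff, morAt_induced_iff]
      have h1 : MorAt ((A.sub U).prod (aff (Fin r → ℂ))) A (fun y => y.1.1) y :=
        (morAt_val _ _ _).comp (morAt_fst y)
      refine h1.prodMk ?_
      have h2 : MorAt ((A.sub U).prod (aff (Fin r → ℂ))) (aff M) (fun y => e.symm y.2) y :=
        (morAt_snd y).linear e.symm.toLinearMap
      refine (MorAt.comp (φ := fun y => (y.1.1, e.symm y.2)) (ψ := fun z : B × M => R z.1 z.2)
        (hR y.1.1 y.1.2 _) (h1.prodMk h2)).congr (Eventually.of_forall fun y => ?_)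
      exact hRθ _ _ _
    · rintro ⟨⟨b, v⟩, hb⟩
      simp
    · rintro ⟨⟨b, hb⟩, m⟩
      simp
  · intro c hc
    exact ((θ c hc).trans e).toLinearMap.isLinear

end Bundle

end AlgStr

section Charts

open AlgStr

variable (E : Type u) [AddCommGroup E] [Module ℂ E] [FiniteDimensional ℂ E]

/-- The Grassmannian is covered by finitely many charts isomorphic to an affine space. -/
theorem hasAtlas_grass (d : ℕ) : HasAtlas (grass d E) (d * (Module.finrank ℂ E - d))
    (fun U => ∃ C, U = grChart d C ∧ U.Nonempty) := by
  let b := Module.finBasis ℂ E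
  refine ⟨(fun I => grChart d (Submodule.span ℂ (b '' I))) ''
    {I | (grChart d (Submodule.span ℂ (b '' I))).Nonempty}, Set.Finite.image _ (Set.toFinite _),
    ?_, ?_⟩
  · rw [Set.eq_univ_iff_forall]
    intro S
    obtain ⟨I, hI⟩ := exists_isCompl_span_basis b S.1
    exact ⟨_, ⟨I, ⟨S, hI⟩, rfl⟩, hI⟩
  · rintro _ ⟨I, hI, rfl⟩
    refine ⟨isOpen_grChart _, ?_, _, rfl, hI⟩
    obtain ⟨S, hS⟩ := hI
    obtain ⟨φ, hφ⟩ := exists_isIso_grChart S hS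
    have hdim : Module.finrank ℂ (S.1 →ₗ[ℂ] Submodule.span ℂ (b '' I)) =
        d * (Module.finrank ℂ E - d) := by
      have h1 := Submodule.finrank_add_eq_of_isCompl hS
      have h2 := S.2
      rw [Module.finrank_linearMap, S.2]
      congr 1
      omega
    have e : (S.1 →ₗ[ℂ] Submodule.span ℂ (b '' I)) ≃ₗ[ℂ]
        (Fin (d * (Module.finrank ℂ E - d)) → ℂ) :=
      LinearEquiv.ofFinrankEq _ _ (by rw [hdim]; simp)
    exact ⟨_, (isIso_linearEquiv e).comp hφ⟩

end Charts

/-! ### The bundles `HatN` and `TildeN` -/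

section Bundles

open AlgStr

section Pieces

variable {X : Type*} {A : AlgStr X} {x : X} {d : ℕ}
variable {E : Type u} [AddCommGroup E] [Module ℂ E] [FiniteDimensional ℂ E]
variable {T : Type*} [AddCommGroup T] [Module ℂ T] [FiniteDimensional ℂ T]

omit [FiniteDimensional ℂ E] [FiniteDimensional ℂ T] in
theorem comp_quotientEquivOfIsCompl {C S : Submodule ℂ E} (h : IsCompl S C) {P : E →ₗ[ℂ] C}
    (hP : P ∘ₗ C.subtype = LinearMap.id) (a : C →ₗ[ℂ] T) :
    (a ∘ₗ (S.quotientEquivOfIsCompl C h).toLinearMap) ∘ₗ S.mkQ =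
      a ∘ₗ P ∘ₗ (LinearMap.id - projAlong C S) := by
  refine LinearMap.ext fun e => ?_
  have h1 : (S.quotientEquivOfIsCompl C h) (S.mkQ e) = ⟨e - projAlong C S e,
      sub_projAlong_mem h e⟩ := by
    have : S.mkQ e = S.mkQ (e - projAlong C S e) := by
      rw [map_sub, Submodule.mkQ_apply S (projAlong C S e),
        (Submodule.Quotient.mk_eq_zero S).2 (projAlong_mem C S e), sub_zero]
    rw [this]
    exact Submodule.quotientEquivOfIsCompl_apply_mk_right h ⟨_, sub_projAlong_mem h e⟩
  have h2 : P (e - projAlong C S e) = ⟨e - projAlong C S e, sub_projAlong_mem h e⟩ :=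
    LinearMap.congr_fun hP ⟨e - projAlong C S e, sub_projAlong_mem h e⟩
  exact congrArg a (h1.trans h2.symm)

omit [FiniteDimensional ℂ E] [FiniteDimensional ℂ T] in
theorem subtype_comp_quotientEquivOfIsCompl {C S : Submodule ℂ E} (h : IsCompl S C)
    {s : E ⧸ C →ₗ[ℂ] E} (hs : C.mkQ ∘ₗ s = LinearMap.id) (a : T →ₗ[ℂ] E ⧸ C) :
    S.subtype ∘ₗ (C.quotientEquivOfIsCompl S h.symm).toLinearMap ∘ₗ a =
      projAlong C S ∘ₗ s ∘ₗ a := by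
  refine LinearMap.ext fun t => ?_
  have h1 : a t = C.mkQ (s (a t)) := (LinearMap.congr_fun hs (a t)).symm
  have h2 : ∀ e, ((C.quotientEquivOfIsCompl S h.symm (C.mkQ e) : S) : E) = projAlong C S e := by
    intro e
    rw [projAlong_eq h]
    rfl
  have h3 := h2 (s (a t))
  rw [← h1] at h3
  exact h3

theorem exists_mkQ_section (C : Submodule ℂ E) : ∃ s : E ⧸ C →ₗ[ℂ] E, C.mkQ ∘ₗ s = LinearMap.id :=
  C.mkQ.exists_rightInverse_of_surjective (LinearMap.range_eq_top.2 C.mkQ_surjective)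

omit [FiniteDimensional ℂ E] in
theorem exists_subtype_retraction (C : Submodule ℂ E) :
    ∃ P : E →ₗ[ℂ] C, P ∘ₗ C.subtype = LinearMap.id :=
  C.subtype.exists_leftInverse_of_injective C.ker_subtype

theorem MorAt.projAlong {S : X → Gr d E} {C : Submodule ℂ E} (hS : MorAt A (grass d E) S x)
    (hC : IsCompl (S x).1 C) : MorAt A (aff (E →ₗ[ℂ] E)) (fun y => projAlong C (S y).1) x :=
  MorAt.comp (ψ := fun S : Gr d E => _root_.projAlong C S.1) (morAt_projAlong hC) hS

theorem finrank_eq_of_mem_grChart {C : Submodule ℂ E} (h : (grChart d C).Nonempty) :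
    Module.finrank ℂ C = Module.finrank ℂ E - d ∧ Module.finrank ℂ (E ⧸ C) = d := by
  obtain ⟨S, hS⟩ := h
  have h1 := Submodule.finrank_add_eq_of_isCompl hS
  have h2 := S.2
  have h3 := C.finrank_quotient_add_finrank
  omega

end Pieces

variable (V U₁ U₂ : Type u) [AddCommGroup V] [AddCommGroup U₁] [AddCommGroup U₂]
  [Module ℂ V] [Module ℂ U₁] [Module ℂ U₂]
  [FiniteDimensional ℂ V] [FiniteDimensional ℂ U₁] [FiniteDimensional ℂ U₂] (p q : ℕ)

omit [FiniteDimensional ℂ V] [FiniteDimensional ℂ U₁] [FiniteDimensional ℂ U₂] in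
theorem isMorphism_zetaHat :
    IsMorphism (hatN V U₁ U₂ p q) (hatBase V U₁ U₂ p q) Sigma.fst :=
  isMorphism_iff.2 fun z => (morAt_induced _ _ z).fst

omit [FiniteDimensional ℂ V] [FiniteDimensional ℂ U₁] [FiniteDimensional ℂ U₂] in
theorem isMorphism_zetaTilde : IsMorphism (tildeN V U₁ U₂ q) (grass q V) Sigma.fst :=
  isMorphism_iff.2 fun z => (morAt_induced _ _ z).fst

theorem hasAtlas_grass_tildeN :
    HasAtlas (grass q V) (q * (Module.finrank ℂ V - q)) (IsTrivialOver (tildeN V U₁ U₂ q)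
      (grass q V)
      ((Module.finrank ℂ V - q) * Module.finrank ℂ U₁ + Module.finrank ℂ U₂ * q)) := by
  refine (hasAtlas_grass V q).mono ?_
  rintro _ ⟨C, rfl, hC⟩
  obtain ⟨hd1, hd2⟩ := finrank_eq_of_mem_grChart hC
  obtain ⟨s, hs⟩ := exists_mkQ_section C
  obtain ⟨P, hP⟩ := exists_subtype_retraction C
  refine isTrivialOver_of_embedding (M := (C →ₗ[ℂ] U₁) × (U₂ →ₗ[ℂ] V ⧸ C))
    (by simp [Module.finrank_linearMap, hd1, hd2]) nuTilde
    (fun S hS => LinearEquiv.prodCongr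
      ((S.1.quotientEquivOfIsCompl C hS).arrowCongr (LinearEquiv.refl ℂ U₁))
      ((LinearEquiv.refl ℂ U₂).arrowCongr (C.quotientEquivOfIsCompl S.1 (IsCompl.symm hS)).symm))
    (LinearMap.prodMap (LinearMap.lcomp ℂ U₁ C.subtype) (LinearMap.llcomp ℂ U₂ V (V ⧸ C) C.mkQ))
    ?_
    (fun S m => (m.1 ∘ₗ P ∘ₗ (LinearMap.id - projAlong C S.1), projAlong C S.1 ∘ₗ s ∘ₗ m.2))
    ?_ ?_
  · intro S hS v
    rfl
  · rintro S hS ⟨a, c⟩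
    refine Prod.ext ?_ ?_
    · exact (comp_quotientEquivOfIsCompl hS hP a).symm
    · exact (subtype_comp_quotientEquivOfIsCompl hS hs c).symm
  · intro S hS m
    have hz : MorAt ((grass q V).prod (aff ((C →ₗ[ℂ] U₁) × (U₂ →ₗ[ℂ] V ⧸ C)))) (grass q V)
      (fun z => z.1) (S, m) := morAt_fst _
    have hm := morAt_snd (A := grass q V) (B := aff ((C →ₗ[ℂ] U₁) × (U₂ →ₗ[ℂ] V ⧸ C))) (S, m)
    have hπ := MorAt.projAlong hz hS
    refine morAt_aff_prod ?_ ?_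
    · exact (hm.linear (LinearMap.fst ℂ _ _)).compL
        ((morAt_const P _).compL ((morAt_const _ _).sub hπ))
    · exact hπ.compL ((morAt_const s _).compL (hm.linear (LinearMap.snd ℂ _ _)))

/-- The dimension of the base of `HatN`. -/
noncomputable def hatBaseDim : ℕ :=
  q * (Module.finrank ℂ V - q) + (p * (Module.finrank ℂ U₁ - p) +
    (Module.finrank ℂ U₂ - q) * (Module.finrank ℂ U₂ - (Module.finrank ℂ U₂ - q)))

theorem hasAtlas_hatBase :
    HasAtlas (hatBase V U₁ U₂ p q) (hatBaseDim V U₁ U₂ p q) (IsTrivialOver (hatN V U₁ U₂ p q)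
      (hatBase V U₁ U₂ p q) ((Module.finrank ℂ V - q) * p +
        (Module.finrank ℂ U₂ - (Module.finrank ℂ U₂ - q)) * q)) := by
  refine ((hasAtlas_grass V q).prod ((hasAtlas_grass U₁ p).prod (hasAtlas_grass U₂ _))).mono ?_
  rintro _ ⟨_, _, ⟨C₀, rfl, hC₀⟩, ⟨_, _, ⟨C₁, rfl, hC₁⟩, ⟨C₂, rfl, hC₂⟩, rfl⟩, rfl⟩
  obtain ⟨hd1, hd2⟩ := finrank_eq_of_mem_grChart hC₀
  obtain ⟨-, hd3⟩ := finrank_eq_of_mem_grChart hC₁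
  obtain ⟨hd4, -⟩ := finrank_eq_of_mem_grChart hC₂
  obtain ⟨s₀, hs₀⟩ := exists_mkQ_section C₀
  obtain ⟨P₀, hP₀⟩ := exists_subtype_retraction C₀
  obtain ⟨s₁, hs₁⟩ := exists_mkQ_section C₁
  obtain ⟨P₂, hP₂⟩ := exists_subtype_retraction C₂
  let M := (C₀ →ₗ[ℂ] U₁ ⧸ C₁) × (C₂ →ₗ[ℂ] V ⧸ C₀)
  refine isTrivialOver_of_embedding (M := M)
    (by simp [M, Module.finrank_linearMap, hd1, hd2, hd3, hd4]) nuHat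
    (fun S hS => LinearEquiv.prodCongr
      ((S.1.1.quotientEquivOfIsCompl C₀ hS.1).arrowCongr
        (C₁.quotientEquivOfIsCompl S.2.1.1 (IsCompl.symm hS.2.1)).symm)
      ((S.2.2.1.quotientEquivOfIsCompl C₂ hS.2.2).arrowCongr
        (C₀.quotientEquivOfIsCompl S.1.1 (IsCompl.symm hS.1)).symm))
    (LinearMap.prodMap (LinearMap.lcomp ℂ _ C₀.subtype ∘ₗ LinearMap.llcomp ℂ V U₁ _ C₁.mkQ)
      (LinearMap.lcomp ℂ _ C₂.subtype ∘ₗ LinearMap.llcomp ℂ U₂ V _ C₀.mkQ)) ?_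
    (fun S m => (projAlong C₁ S.2.1.1 ∘ₗ s₁ ∘ₗ m.1 ∘ₗ P₀ ∘ₗ (LinearMap.id - projAlong C₀ S.1.1),
      projAlong C₀ S.1.1 ∘ₗ s₀ ∘ₗ m.2 ∘ₗ P₂ ∘ₗ (LinearMap.id - projAlong C₂ S.2.2.1)))
    ?_ ?_
  · intro S hS v
    rfl
  · rintro S hS ⟨a, c⟩
    refine Prod.ext ?_ ?_
    · change _ = S.2.1.1.subtype ∘ₗ (((C₁.quotientEquivOfIsCompl S.2.1.1
        (IsCompl.symm hS.2.1)).toLinearMap ∘ₗ a) ∘ₗ (S.1.1.quotientEquivOfIsCompl C₀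
          hS.1).toLinearMap) ∘ₗ S.1.1.mkQ
      rw [comp_quotientEquivOfIsCompl hS.1 hP₀, LinearMap.comp_assoc,
        subtype_comp_quotientEquivOfIsCompl hS.2.1 hs₁]
    · change _ = S.1.1.subtype ∘ₗ (((C₀.quotientEquivOfIsCompl S.1.1
        (IsCompl.symm hS.1)).toLinearMap ∘ₗ c) ∘ₗ (S.2.2.1.quotientEquivOfIsCompl C₂
          hS.2.2).toLinearMap) ∘ₗ S.2.2.1.mkQ
      rw [comp_quotientEquivOfIsCompl hS.2.2 hP₂, LinearMap.comp_assoc,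
        subtype_comp_quotientEquivOfIsCompl hS.1 hs₀]
  · intro S hS m
    have hz : MorAt ((hatBase V U₁ U₂ p q).prod (aff M)) (hatBase V U₁ U₂ p q)
      (fun z => z.1) (S, m) := morAt_fst _
    have hm := morAt_snd (A := hatBase V U₁ U₂ p q) (B := aff M) (S, m)
    have hπ₀ := MorAt.projAlong hz.fst hS.1
    have hπ₁ := MorAt.projAlong hz.snd.fst hS.2.1
    have hπ₂ := MorAt.projAlong hz.snd.snd hS.2.2
    refine morAt_aff_prod ?_ ?_
    · exact hπ₁.compL ((morAt_const s₁ _).compL ((hm.linear (LinearMap.fst ℂ _ _)).compL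
        ((morAt_const P₀ _).compL ((morAt_const _ _).sub hπ₀))))
    · exact hπ₀.compL ((morAt_const s₀ _).compL ((hm.linear (LinearMap.snd ℂ _ _)).compL
        ((morAt_const P₂ _).compL ((morAt_const _ _).sub hπ₂))))

theorem isSeparated_hatBase : (hatBase V U₁ U₂ p q).IsSeparated :=
  (isSeparated_grass q V).prod ((isSeparated_grass p U₁).prod (isSeparated_grass _ U₂))

variable {V U₁ U₂ q} in
omit [FiniteDimensional ℂ V] [FiniteDimensional ℂ U₁] [FiniteDimensional ℂ U₂] in
theorem tildeN_ext {z w : TildeN V U₁ U₂ q} (h1 : z.1 = w.1) (h2 : nuTilde z = nuTilde w) :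
    z = w := by
  obtain ⟨S, f⟩ := z
  obtain ⟨T, g⟩ := w
  obtain rfl : S = T := h1
  congr 1
  refine Prod.ext ?_ ?_
  · exact (LinearMap.cancel_right S.1.mkQ_surjective).1 (congrArg Prod.fst h2)
  · exact (LinearMap.cancel_left S.1.injective_subtype).1 (congrArg Prod.snd h2)

variable {V U₁ U₂ p q} in
omit [FiniteDimensional ℂ V] [FiniteDimensional ℂ U₁] [FiniteDimensional ℂ U₂] in
theorem hatN_ext {z w : HatN V U₁ U₂ p q} (h1 : z.1 = w.1) (h2 : nuHat z = nuHat w) :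
    z = w := by
  obtain ⟨S, f⟩ := z
  obtain ⟨T, g⟩ := w
  obtain rfl : S = T := h1
  congr 1
  refine Prod.ext ?_ ?_
  · exact (LinearMap.cancel_right S.1.1.mkQ_surjective).1
      ((LinearMap.cancel_left S.2.1.1.injective_subtype).1 (congrArg Prod.fst h2))
  · exact (LinearMap.cancel_right S.2.2.1.mkQ_surjective).1
      ((LinearMap.cancel_left S.1.1.injective_subtype).1 (congrArg Prod.snd h2))

theorem isSeparated_tildeN : (tildeN V U₁ U₂ q).IsSeparated :=
  ((isSeparated_grass q V).prod (isSeparated_aff _)).of_injective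
    (isMorphism_iff.2 fun z => morAt_induced _ _ z)
    fun _ _ h => tildeN_ext (congrArg Prod.fst h) (congrArg Prod.snd h)

theorem isSeparated_hatN : (hatN V U₁ U₂ p q).IsSeparated :=
  ((isSeparated_hatBase V U₁ U₂ p q).prod (isSeparated_aff _)).of_injective
    (isMorphism_iff.2 fun z => morAt_induced _ _ z)
    fun _ _ h => hatN_ext (congrArg Prod.fst h) (congrArg Prod.snd h)

theorem hasAtlas_tildeN : HasAtlas (tildeN V U₁ U₂ q) (q * (Module.finrank ℂ V - q) +
    ((Module.finrank ℂ V - q) * Module.finrank ℂ U₁ + Module.finrank ℂ U₂ * q))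
    (fun _ => True) :=
  (hasAtlas_grass_tildeN V U₁ U₂ q).total (isMorphism_zetaTilde V U₁ U₂ q)

end Bundles

/-! ### Elimination theory -/

namespace AlgStr

section Elimination

open MvPolynomial

theorem exists_mvPolynomial_of_mem_polyFun {n : ℕ} {g : (Fin n → ℂ) → ℂ}
    (hg : g ∈ polyFun (Fin n → ℂ)) : ∃ P : MvPolynomial (Fin n) ℂ, ∀ x, g x = eval x P := by
  induction hg using Algebra.adjoin_induction with
  | mem g hg =>
    obtain ⟨φ, rfl⟩ := hg
    refine ⟨∑ i, C (φ (Pi.single i 1)) * X i, fun x => ?_⟩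
    conv_lhs => rw [pi_eq_sum_univ' x]
    simp only [map_sum, map_smul, smul_eq_mul, eval_mul, eval_C, eval_X]
    exact Finset.sum_congr rfl fun i _ => mul_comm _ _
  | algebraMap r => exact ⟨C r, fun x => by simp⟩
  | add f g _ _ hf hg =>
    obtain ⟨P, hP⟩ := hf
    obtain ⟨Q, hQ⟩ := hg
    exact ⟨P + Q, fun x => by simp [hP, hQ]⟩
  | mul f g _ _ hf hg =>
    obtain ⟨P, hP⟩ := hf
    obtain ⟨Q, hQ⟩ := hg
    exact ⟨P * Q, fun x => by simp [hP, hQ]⟩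

theorem eval_homogeneousComponent {n : ℕ} (P : MvPolynomial (Fin n) ℂ) (x : Fin n → ℂ) (d : ℕ) :
    eval x (homogeneousComponent d P) =
      ∑ α ∈ P.support with α.degree = d, coeff α P * ∏ i, x i ^ α i := by
  rw [homogeneousComponent_apply, map_sum]
  refine Finset.sum_congr rfl fun α _ => ?_
  rw [eval_monomial, Finsupp.prod_fintype _ _ (by simp)]

/-- A polynomial vanishing on a punctured line through the origin has homogeneous components
vanishing on that line. -/
theorem eval_homogeneousComponent_eq_zero {n : ℕ} {P : MvPolynomial (Fin n) ℂ} {x : Fin n → ℂ}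
    (h : ∀ t : ℂ, t ≠ 0 → eval (t • x) P = 0) (d : ℕ) :
    eval x (homogeneousComponent d P) = 0 := by
  let Q : Polynomial ℂ := ∑ d ∈ Finset.range (P.totalDegree + 1),
    Polynomial.monomial d (eval x (homogeneousComponent d P))
  have hQ : ∀ t, Q.eval t = eval (t • x) P := by
    intro t
    conv_rhs => rw [← sum_homogeneousComponent P]
    simp only [Q, Polynomial.eval_finsetSum, Polynomial.eval_monomial, map_sum]
    refine Finset.sum_congr rfl fun d _ => ?_
    rw [eval_homogeneousComponent, eval_homogeneousComponent, Finset.sum_mul]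
    refine Finset.sum_congr rfl fun α hα => ?_
    have hα : ∑ i, α i = d := by
      rw [← Finsupp.degree_eq_sum]
      exact (Finset.mem_filter.1 hα).2
    simp only [Pi.smul_apply, smul_eq_mul, mul_pow, Finset.prod_mul_distrib,
      Finset.prod_pow_eq_pow_sum, hα]
    ring
  have hQ0 : Q = 0 := by
    refine Polynomial.eq_zero_of_infinite_isRoot Q (Set.Infinite.mono (s := {0}ᶜ) ?_ ?_)
    · intro t ht
      exact (hQ t).trans (h t ht)
    · exact (Set.finite_singleton (0 : ℂ)).infinite_compl
  by_cases hd : d < P.totalDegree + 1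
  · have := congrArg (fun Q => Polynomial.coeff Q d) hQ0
    simpa [Q, Polynomial.finsetSum_coeff, Polynomial.coeff_monomial, Finset.sum_ite_eq', hd]
      using this
  · rw [homogeneousComponent_eq_zero _ _ (by omega), map_zero]

variable {Y : Type*} {B : AlgStr Y} {y₀ : Y} {n : ℕ}

/-- The family of polynomials `H` has coefficients that are regular at `y`. -/
def RegCoeff (B : AlgStr Y) (y : Y) (H : Y → MvPolynomial (Fin n) ℂ) : Prop :=
  ∀ α, B.RegAt (fun y => coeff α (H y)) y

theorem RegCoeff.const (P : MvPolynomial (Fin n) ℂ) : RegCoeff B y₀ fun _ => P :=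
  fun _ => B.regAt_const _ _

theorem RegCoeff.add {H K : Y → MvPolynomial (Fin n) ℂ} (hH : RegCoeff B y₀ H)
    (hK : RegCoeff B y₀ K) : RegCoeff B y₀ fun y => H y + K y := fun α => by
  simpa using (hH α).add (hK α)

theorem RegCoeff.mul {H K : Y → MvPolynomial (Fin n) ℂ} (hH : RegCoeff B y₀ H)
    (hK : RegCoeff B y₀ K) : RegCoeff B y₀ fun y => H y * K y := fun α => by
  classical
  simp only [coeff_mul]
  exact RegAt.sum _ fun i _ => (hH _).mul (hK _)

/-- Up to a polynomial denominator, functions in `prodFun` are polynomials in the first variable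
with regular coefficients in the second one. -/
theorem exists_regCoeff_of_mem_prodFun {U : Set (Fin n → ℂ)} {V : Set Y} {x₀ : Fin n → ℂ}
    (hx : x₀ ∈ U) (hy : y₀ ∈ V) {h : (Fin n → ℂ) × Y → ℂ}
    (hh : h ∈ prodFun (aff (Fin n → ℂ)) B U V) :
    ∃ (q : MvPolynomial (Fin n) ℂ) (H : Y → MvPolynomial (Fin n) ℂ), eval x₀ q ≠ 0 ∧
      RegCoeff B y₀ H ∧ ∀ᶠ x in (aff (Fin n → ℂ)).nhd x₀, ∀ y,
        eval x q * h (x, y) = eval x (H y) := by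
  induction hh using Algebra.adjoin_induction with
  | mem g hg =>
    rcases hg with ⟨f, hf, rfl⟩ | ⟨f, hf, rfl⟩
    · obtain ⟨g, hg, k, hk, hk0, hf⟩ := regAt_aff_iff.1 (hf x₀ hx)
      obtain ⟨G, hG⟩ := exists_mvPolynomial_of_mem_polyFun hg
      obtain ⟨K, hK⟩ := exists_mvPolynomial_of_mem_polyFun hk
      refine ⟨K, fun _ => G, hK x₀ ▸ hk0, RegCoeff.const G, ?_⟩
      filter_upwards [hf, (regAt_polyFun hk x₀).ne hk0] with x hx hx0 y
      rw [hx, ← hK, ← hG, mul_div_cancel₀ _ hx0]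
    · refine ⟨1, fun y => C (f y), by simp, fun α => ?_, Eventually.of_forall fun x y => by simp⟩
      classical
      simp only [coeff_C]
      by_cases hα : 0 = α
      · simpa [hα] using hf y₀ hy
      · simpa [hα] using B.regAt_const 0 y₀
  | algebraMap r =>
    exact ⟨1, fun _ => C r, by simp, RegCoeff.const _, Eventually.of_forall fun x y => by simp⟩
  | add f g _ _ hf hg =>
    obtain ⟨q, H, hq, hH, hf⟩ := hf
    obtain ⟨q', H', hq', hH', hg⟩ := hg
    refine ⟨q * q', fun y => q' * H y + q * H' y, by simp [hq, hq'],
      ((RegCoeff.const q').mul hH).add ((RegCoeff.const q).mul hH'), ?_⟩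
    filter_upwards [hf, hg] with x h1 h2 y
    simp only [Pi.add_apply, map_add, map_mul, ← h1, ← h2]
    ring
  | mul f g _ _ hf hg =>
    obtain ⟨q, H, hq, hH, hf⟩ := hf
    obtain ⟨q', H', hq', hH', hg⟩ := hg
    refine ⟨q * q', fun y => H y * H' y, by simp [hq, hq'], hH.mul hH', ?_⟩
    filter_upwards [hf, hg] with x h1 h2 y
    simp only [Pi.mul_apply, map_mul, ← h1, ← h2]
    ring

theorem exists_regCoeff_of_mem_nhd {s : Set ((Fin n → ℂ) × Y)} {x₀ : Fin n → ℂ}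
    (hs : s ∈ ((aff (Fin n → ℂ)).prod B).nhd (x₀, y₀)) :
    ∃ H : Y → MvPolynomial (Fin n) ℂ, RegCoeff B y₀ H ∧ eval x₀ (H y₀) ≠ 0 ∧
      ∀ᶠ y in B.nhd y₀, ∀ x, eval x (H y) ≠ 0 → (x, y) ∈ s := by
  obtain ⟨U, V, hU, hV, hx, hy, h, hh, h0, hs⟩ := mem_nhd_prod.1 hs
  obtain ⟨q, H, hq, hH, hev⟩ := exists_regCoeff_of_mem_prodFun hx hy hh
  obtain ⟨r, hr, hr0, hrs⟩ := mem_nhd_aff.1 (inter_mem hev (isOpen_iff.1 hU _ hx))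
  obtain ⟨R, hR⟩ := exists_mvPolynomial_of_mem_polyFun hr
  refine ⟨fun y => R * H y, (RegCoeff.const R).mul hH, ?_, ?_⟩
  · rw [map_mul, ← hR, ← (hrs hr0).1 y₀]
    exact mul_ne_zero hr0 (mul_ne_zero hq h0)
  · filter_upwards [isOpen_iff.1 hV _ hy] with y hyV x hx
    rw [map_mul, ← hR] at hx
    have hx' := hrs (left_ne_zero_of_mul hx)
    have := right_ne_zero_of_mul hx
    rw [← hx'.1 y] at this
    exact hs _ hx'.2 hyV (right_ne_zero_of_mul this)

/-- The polynomials that extend to a family of polynomials over a neighbourhood of `y₀`, with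
coefficients regular at `y₀`, that vanishes on the fibres of the family of sets `S`. -/
def extIdeal (B : AlgStr Y) (y₀ : Y) (S : Set ((Fin n → ℂ) × Y)) :
    Ideal (MvPolynomial (Fin n) ℂ) where
  carrier := {P | ∃ H : Y → MvPolynomial (Fin n) ℂ, RegCoeff B y₀ H ∧ H y₀ = P ∧
    ∀ᶠ y in B.nhd y₀, ∀ x, x ≠ 0 → (x, y) ∈ S → eval x (H y) = 0}
  zero_mem' := ⟨fun _ => 0, RegCoeff.const 0, rfl, Eventually.of_forall fun y x _ _ => by simp⟩
  add_mem' := by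
    rintro _ _ ⟨H, hH, rfl, h⟩ ⟨K, hK, rfl, k⟩
    refine ⟨fun y => H y + K y, hH.add hK, rfl, ?_⟩
    filter_upwards [h, k] with y h k x hx hxy
    rw [map_add, h x hx hxy, k x hx hxy, add_zero]
  smul_mem' := by
    rintro P _ ⟨H, hH, rfl, h⟩
    refine ⟨fun y => P * H y, (RegCoeff.const P).mul hH, rfl, ?_⟩
    filter_upwards [h] with y h x hx hxy
    rw [map_mul, h x hx hxy, mul_zero]

/-- The projection along a projective space is closed, stated in a neighbourhood of `y₀`: if the
cone over `y₀` in a family of cones `S` is trivial, then so are the neighbouring cones. -/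
theorem eventually_cone_trivial {S : Set ((Fin n → ℂ) × Y)}
    (hS : ∀ x, x ≠ 0 → Sᶜ ∈ ((aff (Fin n → ℂ)).prod B).nhd (x, y₀))
    (hcone : ∀ y x (t : ℂ), t ≠ 0 → (x, y) ∈ S → (t • x, y) ∈ S) :
    ∀ᶠ y in B.nhd y₀, ∀ x, x ≠ 0 → (x, y) ∉ S := by
  classical
  let J := extIdeal B y₀ S
  let 𝔪 : Ideal (MvPolynomial (Fin n) ℂ) := Ideal.span (Set.range X)
  have h𝔪 : 𝔪 ≤ J.radical := by
    rw [← vanishingIdeal_zeroLocus_eq_radical (K := ℂ) J, Ideal.span_le]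
    rintro _ ⟨i, rfl⟩ x hx
    by_contra hne
    have hx0 : x ≠ 0 := fun h => hne (by simp [h])
    obtain ⟨H, hH, hH0, hHS⟩ := exists_regCoeff_of_mem_nhd (hS x hx0)
    refine hH0 ?_
    have : H y₀ ∈ J := ⟨H, hH, rfl, ?_⟩
    · simpa [aeval_eq_eval] using hx _ this
    · filter_upwards [hHS] with y hy z _ hz
      by_contra h
      exact hy z h hz
  obtain ⟨D, hD⟩ := Ideal.exists_pow_le_of_le_radical_of_fg h𝔪 (IsNoetherian.noetherian 𝔪)
  -- the monomials of degree `D` lie in `J`, and a determinant shows that this persists nearby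
  let s : Finset (Fin n →₀ ℕ) := Finset.finsuppAntidiag Finset.univ D
  have hmon : ∀ α : s, monomial α.1 (1 : ℂ) ∈ J := by
    intro α
    refine hD ?_
    have hα : ∑ i, α.1 i = D := (Finset.mem_finsuppAntidiag.1 α.2).1
    rw [monomial_eq, C_1, one_mul, Finsupp.prod_fintype _ _ (by simp)]
    refine (congrArg (fun D => _ ∈ 𝔪 ^ D) hα).mp ?_
    rw [← Finset.prod_pow_eq_pow_sum]
    exact Ideal.prod_mem_prod fun i _ =>
      Ideal.pow_mem_pow (Ideal.subset_span (Set.mem_range_self i)) _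
  choose H hH hH0 hHS using hmon
  let M : Y → Matrix s s ℂ := fun y => Matrix.of fun α β => coeff β.1 (H α y)
  have hM : ∀ i j, B.RegAt (fun y => M y i j) y₀ := fun i j => hH i j.1
  have hM0 : (M y₀).det ≠ 0 := by
    have : M y₀ = 1 := by
      ext α β
      simp only [M, hH0, coeff_monomial, Matrix.one_apply, Matrix.of_apply, Subtype.coe_inj]
    simp [this]
  filter_upwards [(regAt_det hM).ne hM0, eventually_all.2 hHS] with y hy hyS x hx hxy
  have hvec : (M y).mulVec (fun β : s => ∏ i, x i ^ β.1 i) = 0 := by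
    ext α
    have h1 : eval x (homogeneousComponent D (H α y)) = 0 :=
      eval_homogeneousComponent_eq_zero (fun t ht => hyS α _ (smul_ne_zero ht hx)
        (hcone y x t ht hxy)) D
    rw [eval_homogeneousComponent] at h1
    simp only [Matrix.mulVec, dotProduct, M, Matrix.of_apply, Pi.zero_apply]
    rw [Finset.sum_coe_sort s fun β => coeff β (H α y) * ∏ i, x i ^ β i, ← h1]
    refine (Finset.sum_subset (fun β hβ => ?_) fun β hβ hβ' => ?_).symm
    · refine Finset.mem_finsuppAntidiag.2 ⟨?_, Finset.subset_univ _⟩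
      rw [← Finsupp.degree_eq_sum]
      exact (Finset.mem_filter.1 hβ).2
    · have hdeg : β.degree = D := by
        rw [Finsupp.degree_eq_sum]
        exact (Finset.mem_finsuppAntidiag.1 hβ).1
      have : coeff β (H α y) = 0 := by
        by_contra hne
        exact hβ' (Finset.mem_filter.2 ⟨mem_support_iff.2 hne, hdeg⟩)
      rw [this, zero_mul]
  have hzero := Matrix.eq_zero_of_mulVec_eq_zero hy hvec
  refine hx (funext fun i => ?_)
  have hβ : Finsupp.single i D ∈ Finset.finsuppAntidiag Finset.univ D := by
    simp [Finset.mem_finsuppAntidiag, Finsupp.single_apply]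
  have := congrFun hzero ⟨_, hβ⟩
  simp only [Pi.zero_apply, Finset.prod_eq_zero_iff] at this
  obtain ⟨j, -, hj⟩ := this
  by_cases hij : i = j
  · subst hij
    simp only [Finsupp.single_eq_same] at hj
    exact eq_zero_of_pow_eq_zero hj
  · simp [hij] at hj

end Elimination

section Frames

variable {E : Type*} [AddCommGroup E] [Module ℂ E] [FiniteDimensional ℂ E]

omit [FiniteDimensional ℂ E] in
theorem linearIndependent_congr_span {d : ℕ} {v v' : Fin d → E}
    (h : Submodule.span ℂ (Set.range v) = Submodule.span ℂ (Set.range v'))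
    (hv : LinearIndependent ℂ v) : LinearIndependent ℂ v' := by
  rw [linearIndependent_iff_card_eq_finrank_span, Set.finrank] at *
  rw [← h, hv]

omit [FiniteDimensional ℂ E] in
theorem span_cons_congr {d : ℕ} {w : Fin d → E} {x x' : E} {t : ℂ} (ht : t ≠ 0)
    (h : x - t • x' ∈ Submodule.span ℂ (Set.range w)) :
    Submodule.span ℂ (Set.range (Fin.cons x w : Fin (d + 1) → E)) =
      Submodule.span ℂ (Set.range (Fin.cons x' w : Fin (d + 1) → E)) := by
  simp only [Fin.range_cons]
  apply le_antisymm <;> rw [Submodule.span_le, Set.insert_subset_iff]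
  · refine ⟨?_, fun y hy => Submodule.subset_span (Set.mem_insert_of_mem _ hy)⟩
    have := Submodule.add_mem _ (Submodule.span_mono (Set.subset_insert x' _) h)
      (Submodule.smul_mem _ t (Submodule.subset_span (Set.mem_insert x' (Set.range w))))
    simpa using this
  · refine ⟨?_, fun y hy => Submodule.subset_span (Set.mem_insert_of_mem _ hy)⟩
    have := Submodule.smul_mem _ t⁻¹ (Submodule.sub_mem _
      (Submodule.subset_span (Set.mem_insert x (Set.range w)))
      (Submodule.span_mono (Set.subset_insert x _) h))
    simpa [smul_smul, ht] using this

/-- The projection along a Grassmannian is closed, stated in a neighbourhood of `y₀` and in terms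
of frames.  The members of a frame are eliminated one at a time, each varying in a complement of
the span of the others. -/
theorem eventually_frame_notMem {Y : Type*} {B : AlgStr Y} {y₀ : Y} (d : ℕ)
    {S : Set ((Fin d → E) × Y)}
    (hS : ∀ v, LinearIndependent ℂ v → Sᶜ ∈ ((aff (Fin d → E)).prod B).nhd (v, y₀))
    (hspan : ∀ y v v', Submodule.span ℂ (Set.range v) = Submodule.span ℂ (Set.range v') →
      (v, y) ∈ S → (v', y) ∈ S) :
    ∀ᶠ y in B.nhd y₀, ∀ v, LinearIndependent ℂ v → (v, y) ∉ S := by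
  induction d with
  | zero =>
    have h := ((morAt_const (A := B) (B := aff (Fin 0 → E)) 0 y₀).prodMk (morAt_id B y₀)).mem
      (hS 0 linearIndependent_empty_type)
    filter_upwards [h] with y hy v _
    rwa [Subsingleton.elim v 0]
  | succ d ih =>
    let T : Set ((Fin d → E) × Y) :=
      {z | ∃ x, LinearIndependent ℂ (Fin.cons x z.1 : Fin (d + 1) → E) ∧
        ((Fin.cons x z.1 : Fin (d + 1) → E), z.2) ∈ S}
    have hT : ∀ w, LinearIndependent ℂ w → Tᶜ ∈ ((aff (Fin d → E)).prod B).nhd (w, y₀) := by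
      intro w₀ hw₀
      obtain ⟨C, hC⟩ := Submodule.exists_isCompl (Submodule.span ℂ (Set.range w₀))
      let e := (Module.finBasis ℂ C).equivFun.symm
      let L : (Fin (Module.finrank ℂ C) → ℂ) →ₗ[ℂ] E := C.subtype ∘ₗ e.toLinearMap
      have hL : ∀ c, L c ∈ C := fun c => (e c).2
      have hL0 : ∀ c, c ≠ 0 → L c ≠ 0 := fun c hc h => hc (by simpa [L] using h)
      let S' : Set ((Fin (Module.finrank ℂ C) → ℂ) × ((Fin d → E) × Y)) :=
        {z | ((Fin.cons (L z.1) z.2.1 : Fin (d + 1) → E), z.2.2) ∈ S}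
      have key : ∀ᶠ z in ((aff (Fin d → E)).prod B).nhd (w₀, y₀), ∀ c, c ≠ 0 → (c, z) ∉ S' := by
        refine eventually_cone_trivial (fun c hc => ?_) fun y c t ht hc => ?_
        · have h1 := morAt_fst (A := aff (Fin (Module.finrank ℂ C) → ℂ))
            (B := (aff (Fin d → E)).prod B) (c, (w₀, y₀))
          have h2 := morAt_snd (A := aff (Fin (Module.finrank ℂ C) → ℂ))
            (B := (aff (Fin d → E)).prod B) (c, (w₀, y₀))
          have h3 : MorAt ((aff (Fin (Module.finrank ℂ C) → ℂ)).prod ((aff (Fin d → E)).prod B))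
              (aff (Fin (d + 1) → E)) (fun z => (Fin.cons (L z.1) z.2.1 : Fin (d + 1) → E))
              (c, (w₀, y₀)) := by
            refine morAt_aff_pi fun i => ?_
            refine Fin.cases ?_ (fun i => ?_) i
            · exact h1.linear L
            · exact h2.fst.linear (LinearMap.proj i)
          refine (h3.prodMk h2.snd).mem (hS _ ?_)
          refine linearIndependent_finCons.2 ⟨hw₀, fun h => hL0 c hc ?_⟩
          exact Submodule.disjoint_def.1 hC.disjoint _ h (hL c)
        · refine hspan _ _ _ (span_cons_congr (t := t⁻¹) (inv_ne_zero ht) ?_) hc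
          simp [smul_smul, ht]
      have hw := (morAt_fst (A := aff (Fin d → E)) (B := B) (w₀, y₀))
      have hM : MorAt ((aff (Fin d → E)).prod B) (aff ((Fin d → ℂ) →ₗ[ℂ] E ⧸ C))
          (fun z => C.mkQ ∘ₗ Fintype.linearCombination ℂ z.1) (w₀, y₀) :=
        (morAt_const C.mkQ _).compL hw.linearCombination
      filter_upwards [key, hw.eventually_linearIndependent hw₀,
        hM.eventually_bijective ((isCompl_span_iff hw₀).1 hC)] with z hz hz1 hz2
      rintro ⟨x, hx, hxS⟩
      have hzC := (isCompl_span_iff hz1).2 hz2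
      obtain ⟨s, hs, c, hc, rfl⟩ := Submodule.mem_sup.1
        (hzC.sup_eq_top ▸ Submodule.mem_top : x ∈ Submodule.span ℂ (Set.range z.1) ⊔ C)
      have hLc : L (e.symm ⟨c, hc⟩) = c := by simp [L]
      refine hz (e.symm ⟨c, hc⟩) ?_ ?_
      · rintro h0
        rw [h0, map_zero] at hLc
        rw [← hLc, add_zero] at hx
        exact (linearIndependent_finCons.1 hx).2 hs
      · refine hspan _ _ _ (span_cons_congr (t := 1) one_ne_zero ?_) hxS
        simpa [hLc] using hs
    have := ih hT fun y w w' hww ⟨x, hx, hxS⟩ => by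
      have hcons : Submodule.span ℂ (Set.range (Fin.cons x w : Fin (d + 1) → E)) =
          Submodule.span ℂ (Set.range (Fin.cons x w' : Fin (d + 1) → E)) := by
        simp only [Fin.range_cons, Submodule.span_insert, hww]
      exact ⟨x, linearIndependent_congr_span hcons hx, hspan _ _ _ hcons hxS⟩
    filter_upwards [this] with y hy v hv hvS
    rw [← Fin.cons_self_tail v] at hv hvS
    exact hy _ (linearIndependent_finCons.1 hv).1 ⟨_, hv, hvS⟩

end Frames

end AlgStr

/-! ### Generic points on lines -/

section Lines

open AlgStr

theorem finite_compl_of_mem_nhd_aff {s : Set ℂ} {x : ℂ} (hs : s ∈ (aff ℂ).nhd x) : sᶜ.Finite := by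
  obtain ⟨h, hh, h0, hs⟩ := mem_nhd_aff.1 hs
  obtain ⟨P, hP⟩ : ∃ P : Polynomial ℂ, ∀ x, h x = P.eval x := by
    clear hs h0
    induction hh using Algebra.adjoin_induction with
    | mem g hg =>
      obtain ⟨φ, rfl⟩ := hg
      refine ⟨Polynomial.C (φ 1) * Polynomial.X, fun x => ?_⟩
      have : φ x = x * φ 1 := by simpa using φ.map_smul x 1
      change φ x = _
      rw [this, Polynomial.eval_mul, Polynomial.eval_C, Polynomial.eval_X, mul_comm]
    | algebraMap r => exact ⟨Polynomial.C r, fun x => by simp⟩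
    | add f g _ _ hf hg =>
      obtain ⟨P, hP⟩ := hf
      obtain ⟨Q, hQ⟩ := hg
      exact ⟨P + Q, fun x => by simp [hP, hQ]⟩
    | mul f g _ _ hf hg =>
      obtain ⟨P, hP⟩ := hf
      obtain ⟨Q, hQ⟩ := hg
      exact ⟨P * Q, fun x => by simp [hP, hQ]⟩
  have hP0 : P ≠ 0 := fun h => h0 (by simp [hP, h])
  refine (P.rootSet_finite ℂ).subset fun y hy => ?_
  rw [Polynomial.mem_rootSet_of_ne hP0, Polynomial.coe_aeval_eq_eval, ← hP]
  by_contra hne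
  exact hy (hs hne)

theorem exists_notMem_of_line {X : Type*} {A : AlgStr X} {γ : ℂ → X} (hγ : MorAt (aff ℂ) A γ 0)
    {U : Set X} (hU : U ∈ A.nhd (γ 0)) {F : Set ℂ} (hF : F.Finite) : ∃ t, t ∉ F ∧ γ t ∈ U := by
  have h := (hF.union (finite_compl_of_mem_nhd_aff (hγ.1 hU))).infinite_compl.nonempty
  obtain ⟨t, ht⟩ := h
  rw [Set.compl_union, compl_compl] at ht
  exact ⟨t, ht.1, ht.2⟩

variable {E F : Type*} [AddCommGroup E] [Module ℂ E] [AddCommGroup F] [Module ℂ F]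
  [FiniteDimensional ℂ E] [FiniteDimensional ℂ F]

theorem finite_not_bijective_add_smul (f : E →ₗ[ℂ] E) :
    {t : ℂ | ¬ Function.Bijective (f + t • LinearMap.id : E →ₗ[ℂ] E)}.Finite := by
  refine ((Module.End.finite_spectrum f).image fun t => -t).subset fun t ht => ⟨-t, ?_, neg_neg t⟩
  intro hu
  refine ht ?_
  rw [spectrum.mem_resolventSet_iff, ← IsUnit.neg_iff, Module.End.isUnit_iff] at hu
  convert hu using 2
  ext v
  simp [Algebra.algebraMap_eq_smul_one]

theorem exists_generic_injective (h : Module.finrank ℂ E ≤ Module.finrank ℂ F) (f : E →ₗ[ℂ] F) :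
    ∃ w : E →ₗ[ℂ] F, {t : ℂ | ¬ Function.Injective (f + t • w)}.Finite := by
  obtain ⟨w, hw⟩ := finrank_le_iff_exists_linearMap.1 h
  obtain ⟨L, hL⟩ := w.exists_leftInverse_of_injective (LinearMap.ker_eq_bot.2 hw)
  refine ⟨w, (finite_not_bijective_add_smul (L ∘ₗ f)).subset fun t ht hb => ht ?_⟩
  have : L ∘ₗ (f + t • w) = L ∘ₗ f + t • LinearMap.id := by
    rw [LinearMap.comp_add, LinearMap.comp_smul, hL]
  rw [← this] at hb
  exact Function.Injective.of_comp (f := L) (by simpa using hb.1)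

theorem exists_generic_surjective (h : Module.finrank ℂ F ≤ Module.finrank ℂ E) (f : E →ₗ[ℂ] F) :
    ∃ w : E →ₗ[ℂ] F, {t : ℂ | ¬ Function.Surjective (f + t • w)}.Finite := by
  obtain ⟨L, hL⟩ := finrank_le_iff_exists_linearMap.1 h
  obtain ⟨w, hw⟩ := L.exists_leftInverse_of_injective (LinearMap.ker_eq_bot.2 hL)
  refine ⟨w, (finite_not_bijective_add_smul (f ∘ₗ L)).subset fun t ht hb => ht ?_⟩
  have : (f + t • w) ∘ₗ L = f ∘ₗ L + t • LinearMap.id := by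
    rw [LinearMap.add_comp, LinearMap.smul_comp, hw]
  rw [← this] at hb
  exact Function.Surjective.of_comp (g := L) (by simpa using hb.2)

omit [FiniteDimensional ℂ E] in
theorem morAt_line (f w : E) (x : ℂ) : MorAt (aff ℂ) (aff E) (fun t => f + t • w) x :=
  (morAt_const f x).add (MorAt.smul (regAt_iff_morAt.2 (morAt_id _ x)) (morAt_const w x))

/-- Between two subspaces there are subspaces of all intermediate dimensions. -/
theorem exists_submodule_between {S T : Submodule ℂ E} (h : S ≤ T) {d : ℕ}
    (hS : Module.finrank ℂ S ≤ d) (hT : d ≤ Module.finrank ℂ T) :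
    ∃ R, S ≤ R ∧ R ≤ T ∧ Module.finrank ℂ R = d := by
  induction d, hS using Nat.le_induction with
  | base => exact ⟨S, le_rfl, h, rfl⟩
  | succ d _ ih =>
    obtain ⟨R, hSR, hRT, hR⟩ := ih (by omega)
    have hlt : R < T := lt_of_le_of_ne hRT fun h => by
      rw [h] at hR
      omega
    obtain ⟨v, hvT, hvR⟩ := SetLike.exists_of_lt hlt
    refine ⟨R ⊔ Submodule.span ℂ {v}, hSR.trans le_sup_left, sup_le hRT ?_, ?_⟩
    · rwa [Submodule.span_singleton_le_iff_mem]
    · rw [Submodule.finrank_sup_span_singleton hvR, hR]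

end Lines

/-! ### The maps `ν`, `ν̂` and `f_{p,q}` -/

section Maps

open AlgStr

section Fibres

variable {E F : Type*} [AddCommGroup E] [Module ℂ E] [AddCommGroup F] [Module ℂ F]
  {S C : Submodule ℂ E}

theorem bijective_mkQ_comp_subtype (h : IsCompl S C) :
    Function.Bijective (C.mkQ ∘ₗ S.subtype) := by
  rw [← isCompl_range_iff S.injective_subtype, Submodule.range_subtype]
  exact h

theorem injective_comp_mkQ_iff (h : IsCompl S C) {f : E ⧸ S →ₗ[ℂ] F} :
    Function.Injective ((f ∘ₗ S.mkQ) ∘ₗ C.subtype) ↔ Function.Injective f :=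
  Function.Injective.of_comp_iff' f (bijective_mkQ_comp_subtype h.symm)

theorem range_comp_mkQ_comp_subtype (h : IsCompl S C) (f : E ⧸ S →ₗ[ℂ] F) :
    LinearMap.range ((f ∘ₗ S.mkQ) ∘ₗ C.subtype) = LinearMap.range f := by
  rw [LinearMap.comp_assoc, LinearMap.range_comp_of_range_eq_top]
  exact LinearMap.range_eq_top.2 (bijective_mkQ_comp_subtype h.symm).2

theorem surjective_mkQ_comp_iff (h : IsCompl S C) {g : F →ₗ[ℂ] S} :
    Function.Surjective (C.mkQ ∘ₗ S.subtype ∘ₗ g) ↔ Function.Surjective g :=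
  Function.Surjective.of_comp_iff' (bijective_mkQ_comp_subtype h) g

theorem ker_mkQ_comp_subtype_comp (h : IsCompl S C) (g : F →ₗ[ℂ] S) :
    LinearMap.ker (C.mkQ ∘ₗ S.subtype ∘ₗ g) = LinearMap.ker g := by
  rw [← LinearMap.comp_assoc, LinearMap.ker_comp_of_ker_eq_bot]
  exact LinearMap.ker_eq_bot.2 (bijective_mkQ_comp_subtype h).1

end Fibres

variable {V U₁ U₂ : Type u} [AddCommGroup V] [AddCommGroup U₁] [AddCommGroup U₂]
  [Module ℂ V] [Module ℂ U₁] [Module ℂ U₂]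
  [FiniteDimensional ℂ V] [FiniteDimensional ℂ U₁] [FiniteDimensional ℂ U₂] {p q : ℕ}

omit [FiniteDimensional ℂ V] [FiniteDimensional ℂ U₁] [FiniteDimensional ℂ U₂] in
theorem isMorphism_nuTilde :
    IsMorphism (tildeN V U₁ U₂ q) (aff (RepW V U₁ U₂)) nuTilde :=
  isMorphism_iff.2 fun z => (morAt_induced _ _ z).snd

omit [FiniteDimensional ℂ V] [FiniteDimensional ℂ U₁] [FiniteDimensional ℂ U₂] in
theorem isMorphism_nuHat :
    IsMorphism (hatN V U₁ U₂ p q) (aff (RepW V U₁ U₂)) nuHat :=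
  isMorphism_iff.2 fun z => (morAt_induced _ _ z).snd

omit [FiniteDimensional ℂ V] [FiniteDimensional ℂ U₁] [FiniteDimensional ℂ U₂] in
theorem isMorphism_hatToTilde :
    IsMorphism (hatN V U₁ U₂ p q) (tildeN V U₁ U₂ q) hatToTilde :=
  isMorphism_iff.2 fun z => morAt_induced_iff.2
    (((isMorphism_zetaHat V U₁ U₂ p q).morAt z).fst.prodMk (isMorphism_nuHat.morAt z))

theorem finrank_quotient_gr {d : ℕ} {E : Type u} [AddCommGroup E] [Module ℂ E]
    [FiniteDimensional ℂ E] (S : Gr d E) :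
    Module.finrank ℂ (E ⧸ S.1) = Module.finrank ℂ E - d := by
  have h1 := S.1.finrank_quotient_add_finrank
  have h2 := S.2
  omega

theorem surjective_hatToTilde (hp : p ≤ Module.finrank ℂ U₁) (hq : q ≤ Module.finrank ℂ U₂)
    (hpq : p + q = Module.finrank ℂ V) :
    Function.Surjective (hatToTilde : HatN V U₁ U₂ p q → TildeN V U₁ U₂ q) := by
  rintro ⟨V₀, f₁, f₂⟩
  have hV := finrank_quotient_gr V₀
  have h1 := LinearMap.finrank_range_le f₁
  obtain ⟨V₁, hV₁, -, hd₁⟩ := exists_submodule_between (le_top : LinearMap.range f₁ ≤ ⊤)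
    (d := p) (by omega) (by rwa [finrank_top])
  have h2 := LinearMap.finrank_range_add_finrank_ker f₂
  have h3 := Submodule.finrank_le (LinearMap.range f₂)
  have h4 := V₀.2
  obtain ⟨V₂, -, hV₂, hd₂⟩ := exists_submodule_between (bot_le : ⊥ ≤ LinearMap.ker f₂)
    (d := Module.finrank ℂ U₂ - q) (by simp) (by omega)
  refine ⟨⟨(V₀, ⟨V₁, hd₁⟩, ⟨V₂, hd₂⟩), f₁.codRestrict V₁ fun x => hV₁ ⟨x, rfl⟩,
    V₂.liftQ f₂ hV₂⟩, tildeN_ext rfl ?_⟩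
  refine Prod.ext (LinearMap.ext fun x => rfl) (LinearMap.ext fun x => rfl)

/-- The points of `TildeN` where both maps have maximal rank. -/
def tildeGeneric (V U₁ U₂ : Type u) [AddCommGroup V] [AddCommGroup U₁] [AddCommGroup U₂]
    [Module ℂ V] [Module ℂ U₁] [Module ℂ U₂] (q : ℕ) : Set (TildeN V U₁ U₂ q) :=
  {z | Function.Injective z.2.1 ∧ Function.Surjective z.2.2}

theorem isOpen_tildeGeneric : (tildeN V U₁ U₂ q).IsOpen (tildeGeneric V U₁ U₂ q) := by
  rw [AlgStr.isOpen_iff]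
  rintro z ⟨hz1, hz2⟩
  obtain ⟨C, hC⟩ := Submodule.exists_isCompl z.1.1
  have hν := isMorphism_nuTilde.morAt z
  have hν1 := hν.linear (LinearMap.fst ℂ _ _)
  have hν2 := hν.linear (LinearMap.snd ℂ _ _)
  filter_upwards [((isMorphism_zetaTilde V U₁ U₂ q).morAt z).mem (eventually_isCompl hC),
    (hν1.compL (morAt_const C.subtype z)).eventually_injective ((injective_comp_mkQ_iff hC).2 hz1),
    ((morAt_const C.mkQ z).compL hν2).eventually_surjective ((surjective_mkQ_comp_iff hC).2 hz2)]
    with w hw h1 h2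
  exact ⟨(injective_comp_mkQ_iff hw).1 h1, (surjective_mkQ_comp_iff hw).1 h2⟩

/-- Every point of `TildeN` lies on a line in a fibre whose general point is generic. -/
theorem exists_line_tildeGeneric (hp : Module.finrank ℂ V - q ≤ Module.finrank ℂ U₁)
    (hq : q ≤ Module.finrank ℂ U₂) (z : TildeN V U₁ U₂ q) :
    ∃ w : TildeFibre V U₁ U₂ q z.1,
      {t : ℂ | (⟨z.1, z.2 + t • w⟩ : TildeN V U₁ U₂ q) ∉ tildeGeneric V U₁ U₂ q}.Finite := by
  obtain ⟨w₁, h₁⟩ := exists_generic_injective ((finrank_quotient_gr z.1).trans_le hp) z.2.1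
  obtain ⟨w₂, h₂⟩ := exists_generic_surjective (z.1.2.trans_le hq) z.2.2
  refine ⟨(w₁, w₂), (h₁.union h₂).subset fun t ht => ?_⟩
  by_contra h
  simp only [Set.mem_union, not_or, Set.mem_ofPred_eq, not_not] at h
  exact ht h

omit [FiniteDimensional ℂ V] [FiniteDimensional ℂ U₁] [FiniteDimensional ℂ U₂] in
theorem morAt_line_tildeN (z : TildeN V U₁ U₂ q) (w : TildeFibre V U₁ U₂ q z.1) (t : ℂ) :
    MorAt (aff ℂ) (tildeN V U₁ U₂ q) (fun t => ⟨z.1, z.2 + t • w⟩) t := by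
  refine morAt_induced_iff.2 ((morAt_const z.1 t).prodMk ?_)
  refine (morAt_line (nuTilde z) (nuTilde ⟨z.1, w⟩) t).congr (Eventually.of_forall fun t => ?_)
  refine Prod.ext (LinearMap.ext fun x => rfl) (LinearMap.ext fun x => rfl)

theorem isDense_tildeGeneric (hp : Module.finrank ℂ V - q ≤ Module.finrank ℂ U₁)
    (hq : q ≤ Module.finrank ℂ U₂) : (tildeN V U₁ U₂ q).IsDense (tildeGeneric V U₁ U₂ q) := by
  rw [isDense_iff]
  intro z U hU
  obtain ⟨w, hw⟩ := exists_line_tildeGeneric hp hq z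
  obtain ⟨t, ht, htU⟩ := exists_notMem_of_line (morAt_line_tildeN z w 0) (by simpa using hU) hw
  exact ⟨_, htU, by simpa using ht⟩

theorem isDense_hatGeneric (hq : q ≤ Module.finrank ℂ U₂) (hpq : p + q = Module.finrank ℂ V) :
    (hatN V U₁ U₂ p q).IsDense (hatToTilde ⁻¹' tildeGeneric V U₁ U₂ q) := by
  rw [isDense_iff]
  intro z U hU
  have h1 := finrank_quotient_gr z.1.1
  have h2 := finrank_quotient_gr z.1.2.2
  have h3 := z.1.2.1.2
  have h4 := z.1.1.2
  obtain ⟨w₁, hw₁⟩ := exists_generic_injective (by omega) z.2.1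
  obtain ⟨w₂, hw₂⟩ := exists_generic_surjective (by omega) z.2.2
  have hγ : MorAt (aff ℂ) (hatN V U₁ U₂ p q)
      (fun t => ⟨z.1, z.2 + t • (w₁, w₂)⟩) 0 := by
    refine morAt_induced_iff.2 ((morAt_const z.1 0).prodMk ?_)
    refine (morAt_line (nuHat z) (nuHat ⟨z.1, w₁, w₂⟩) 0).congr (Eventually.of_forall fun t => ?_)
    refine Prod.ext (LinearMap.ext fun x => rfl) (LinearMap.ext fun x => ?_)
    simp [nuHat]
  obtain ⟨t, ht, htU⟩ := exists_notMem_of_line hγ (by simpa using hU) (hw₁.union hw₂)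
  simp only [Set.mem_union, not_or, Set.mem_ofPred_eq, not_not] at ht
  refine ⟨_, htU, ?_, ?_⟩
  · exact z.1.2.1.1.injective_subtype.comp ht.1
  · exact ht.2.comp z.1.2.2.1.mkQ_surjective

omit [FiniteDimensional ℂ U₁] [FiniteDimensional ℂ U₂] in
theorem finrank_range_of_mem_tildeGeneric (hpq : p + q = Module.finrank ℂ V)
    {z : TildeN V U₁ U₂ q} (hz : z ∈ tildeGeneric V U₁ U₂ q) :
    Module.finrank ℂ (LinearMap.range z.2.1) = p := by
  have h := finrank_quotient_gr z.1
  rw [LinearMap.finrank_range_of_inj hz.1]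
  omega

omit [FiniteDimensional ℂ V] [FiniteDimensional ℂ U₁] in
theorem finrank_ker_of_mem_tildeGeneric {z : TildeN V U₁ U₂ q}
    (hz : z ∈ tildeGeneric V U₁ U₂ q) :
    Module.finrank ℂ (LinearMap.ker z.2.2) = Module.finrank ℂ U₂ - q := by
  have h1 := LinearMap.finrank_range_add_finrank_ker z.2.2
  rw [LinearMap.range_eq_top.2 hz.2, finrank_top] at h1
  have h2 := z.1.2
  omega

theorem isBirational_hatToTilde (hp : p ≤ Module.finrank ℂ U₁) (hq : q ≤ Module.finrank ℂ U₂)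
    (hpq : p + q = Module.finrank ℂ V) :
    IsBirational (hatN V U₁ U₂ p q) (tildeN V U₁ U₂ q) hatToTilde := by
  refine ⟨isMorphism_hatToTilde, hatToTilde ⁻¹' tildeGeneric V U₁ U₂ q, tildeGeneric V U₁ U₂ q,
    isMorphism_hatToTilde.isOpen_preimage isOpen_tildeGeneric, isDense_hatGeneric hq hpq,
    isOpen_tildeGeneric, isDense_tildeGeneric (by omega) hq, fun z hz => hz, ?_⟩
  -- on the generic locus `V₁` is the range of `f₁`, and `V₂` is the kernel of `f₂`
  let ψ : tildeGeneric V U₁ U₂ q → HatN V U₁ U₂ p q := fun z =>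
    ⟨(z.1.1, ⟨LinearMap.range z.1.2.1, finrank_range_of_mem_tildeGeneric hpq z.2⟩,
      ⟨LinearMap.ker z.1.2.2, finrank_ker_of_mem_tildeGeneric z.2⟩),
      z.1.2.1.rangeRestrict, (LinearMap.ker z.1.2.2).liftQ z.1.2.2 le_rfl⟩
  have hψ : ∀ z, hatToTilde (ψ z) = z.1 := fun z => tildeN_ext rfl
    (Prod.ext (LinearMap.ext fun x => rfl) (LinearMap.ext fun x => rfl))
  refine IsIso.mk (ψ := fun z => ⟨ψ z, by rw [Set.mem_preimage, hψ]; exact z.2⟩) ?_ ?_ ?_ ?_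
  · intro z
    exact morAt_sub_iff.2 ((isMorphism_hatToTilde.morAt _).comp (morAt_val _ _ z))
  · intro z
    refine morAt_sub_iff.2 (morAt_induced_iff.2 ?_)
    have hval := morAt_val (tildeN V U₁ U₂ q) (tildeGeneric V U₁ U₂ q) z
    have hζ := ((isMorphism_zetaTilde V U₁ U₂ q).morAt z.1).comp hval
    have hν := (isMorphism_nuTilde.morAt z.1).comp hval
    have hν1 := hν.linear (LinearMap.fst ℂ _ _)
    have hν2 := hν.linear (LinearMap.snd ℂ _ _)
    obtain ⟨C, hC⟩ := Submodule.exists_isCompl z.1.1.1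
    have hCd : Module.finrank ℂ C = p := by
      have h1 := Submodule.finrank_add_eq_of_isCompl hC
      have h2 := z.1.1.2
      omega
    have hev := hζ.mem (eventually_isCompl hC)
    refine (hζ.prodMk (MorAt.prodMk ?_ ?_)).prodMk
      (hν.congr (Eventually.of_forall fun z => congrArg nuTilde (hψ z).symm))
    · refine morAt_grass_of_range hCd (hν1.compL (morAt_const C.subtype z)) ?_
      filter_upwards [hev] with w hw
      exact range_comp_mkQ_comp_subtype hw w.1.2.1
    · refine morAt_grass_of_ker ((morAt_const C.mkQ z).compL hν2)
        ((surjective_mkQ_comp_iff hC).2 z.2.2) ?_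
      filter_upwards [hev] with w hw
      exact ker_mkQ_comp_subtype_comp hw w.1.2.2
  · intro z
    refine Subtype.ext (hatN_ext (Prod.ext rfl (Prod.ext ?_ ?_)) ?_)
    · refine eq_of_le_of_gr ?_
      rintro _ ⟨x, rfl⟩
      exact (z.1.2.1 x).2
    · refine (eq_of_le_of_gr fun x hx => ?_).symm
      rw [LinearMap.mem_ker]
      change z.1.2.2 (Submodule.Quotient.mk x) = 0
      rw [(Submodule.Quotient.mk_eq_zero _).2 hx, map_zero]
    · exact congrArg nuTilde (hψ ⟨hatToTilde z.1, z.2⟩)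
  · intro z
    exact Subtype.ext (hψ z)

/-! ### Null cones and their slices -/

omit [FiniteDimensional ℂ V] [FiniteDimensional ℂ U₁] [FiniteDimensional ℂ U₂] in
theorem nuTilde_mem_nullCone (z : TildeN V U₁ U₂ q) : nuTilde z ∈ nullCone V U₁ U₂ :=
  LinearMap.ext fun x => by
    simp [nuTilde, (Submodule.Quotient.mk_eq_zero _).2 (z.2.2 x).2]

theorem nuTilde_mem_nullComponent (hp : p ≤ Module.finrank ℂ U₁) (hq : q ≤ Module.finrank ℂ U₂)
    (hpq : p + q = Module.finrank ℂ V) (z : TildeN V U₁ U₂ q) :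
    nuTilde z ∈ nullComponent V U₁ U₂ p q := by
  refine AlgStr.mem_closure_iff.2 fun U hU => ?_
  obtain ⟨w, hwU, hw⟩ := isDense_iff.1 (isDense_tildeGeneric (by omega) hq) z _
    ((isMorphism_nuTilde.morAt z).1 hU)
  refine ⟨nuTilde w, hwU, nuTilde_mem_nullCone w, ?_, ?_⟩
  · have : LinearMap.range (nuTilde w).1 = LinearMap.range w.2.1 :=
      LinearMap.range_comp_of_range_eq_top _ (LinearMap.range_eq_top.2 w.1.1.mkQ_surjective)
    rw [this, finrank_range_of_mem_tildeGeneric hpq hw]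
  · have : LinearMap.range (nuTilde w).2 = w.1.1 := by
      have := LinearMap.range_comp_of_range_eq_top w.1.1.subtype (LinearMap.range_eq_top.2 hw.2)
      rw [Submodule.range_subtype] at this
      exact this
    rw [this, w.1.2]

theorem isClosed_nullCone : (aff (RepW V U₁ U₂)).IsClosed (nullCone V U₁ U₂) := by
  refine isClosed_setOf_eq (f := fun f : RepW V U₁ U₂ => f.1 ∘ₗ f.2) (g := fun _ => 0)
    (isMorphism_iff.2 fun f => ?_) (isMorphism_iff.2 fun f => morAt_const 0 f)
  exact ((morAt_id _ f).linear (LinearMap.fst ℂ _ _)).compL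
    ((morAt_id _ f).linear (LinearMap.snd ℂ _ _))

theorem nullComponent_subset : nullComponent V U₁ U₂ p q ⊆ nullCone V U₁ U₂ :=
  AlgStr.closure_minimal (fun _ h => h.1) isClosed_nullCone

omit [FiniteDimensional ℂ V] [FiniteDimensional ℂ U₁] [FiniteDimensional ℂ U₂] in
theorem exists_nuTilde_eq {f : RepW V U₁ U₂} (S : Gr q V) (h1 : S.1 ≤ LinearMap.ker f.1)
    (h2 : LinearMap.range f.2 ≤ S.1) : ∃ z : TildeN V U₁ U₂ q, z.1 = S ∧ nuTilde z = f :=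
  ⟨⟨S, S.1.liftQ f.1 h1, f.2.codRestrict S.1 fun x => h2 ⟨x, rfl⟩⟩, rfl,
    Prod.ext (LinearMap.ext fun _ => rfl) (LinearMap.ext fun _ => rfl)⟩

omit [FiniteDimensional ℂ V] [FiniteDimensional ℂ U₁] [FiniteDimensional ℂ U₂] in
theorem le_ker_of_nuTilde {z : TildeN V U₁ U₂ q} : z.1.1 ≤ LinearMap.ker (nuTilde z).1 := by
  intro x hx
  simp [nuTilde, (Submodule.Quotient.mk_eq_zero _).2 hx]

omit [FiniteDimensional ℂ V] [FiniteDimensional ℂ U₁] [FiniteDimensional ℂ U₂] in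
theorem range_le_of_nuTilde {z : TildeN V U₁ U₂ q} : LinearMap.range (nuTilde z).2 ≤ z.1.1 := by
  rintro _ ⟨x, rfl⟩
  exact (z.2.2 x).2

omit [FiniteDimensional ℂ U₁] [FiniteDimensional ℂ U₂] in
theorem exists_nuTilde_eq_of_finrank {f : RepW V U₁ U₂} (hf : f ∈ nullCone V U₁ U₂)
    (h1 : q ≤ Module.finrank ℂ (LinearMap.ker f.1))
    (h2 : Module.finrank ℂ (LinearMap.range f.2) ≤ q) :
    ∃ z : TildeN V U₁ U₂ q, nuTilde z = f := by
  obtain ⟨S, hS1, hS2, hd⟩ := exists_submodule_between (LinearMap.range_le_ker_iff.2 hf) h2 h1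
  obtain ⟨z, -, hz⟩ := exists_nuTilde_eq ⟨S, hd⟩ hS2 hS1
  exact ⟨z, hz⟩

section Slice

variable {X₁ : Submodule ℂ U₁} {X₂ : Submodule ℂ U₂}

omit [FiniteDimensional ℂ V] [FiniteDimensional ℂ U₁] [FiniteDimensional ℂ U₂] in
theorem mem_range_reducedIncl {f : RepW V U₁ U₂} :
    f ∈ Set.range (reducedIncl V X₁ X₂) ↔ LinearMap.range f.1 ≤ X₁ ∧ X₂ ≤ LinearMap.ker f.2 := by
  constructor
  · rintro ⟨g, rfl⟩
    refine ⟨?_, fun x hx => ?_⟩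
    · rintro _ ⟨x, rfl⟩
      exact (g.1 x).2
    · simp [reducedIncl, (Submodule.Quotient.mk_eq_zero _).2 hx]
  · rintro ⟨h1, h2⟩
    exact ⟨(f.1.codRestrict X₁ fun x => h1 ⟨x, rfl⟩, X₂.liftQ f.2 h2),
      Prod.ext (LinearMap.ext fun x => rfl) (LinearMap.ext fun x => rfl)⟩

omit [FiniteDimensional ℂ V] [FiniteDimensional ℂ U₁] [FiniteDimensional ℂ U₂] in
theorem reducedIncl_mem_nullCone_iff {g : RepW V X₁ (U₂ ⧸ X₂)} :
    reducedIncl V X₁ X₂ g ∈ nullCone V U₁ U₂ ↔ g ∈ nullCone V X₁ (U₂ ⧸ X₂) := by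
  have : (reducedIncl V X₁ X₂ g).1 ∘ₗ (reducedIncl V X₁ X₂ g).2 =
      X₁.subtype ∘ₗ (g.1 ∘ₗ g.2) ∘ₗ X₂.mkQ := rfl
  constructor
  · intro h
    have h0 : X₁.subtype ∘ₗ (g.1 ∘ₗ g.2) ∘ₗ X₂.mkQ = X₁.subtype ∘ₗ 0 ∘ₗ X₂.mkQ := by
      rw [← this, LinearMap.zero_comp, LinearMap.comp_zero]
      exact h
    exact (LinearMap.cancel_right X₂.mkQ_surjective).1
      ((LinearMap.cancel_left X₁.injective_subtype).1 h0)
  · intro h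
    have h0 : g.1 ∘ₗ g.2 = 0 := h
    change (reducedIncl V X₁ X₂ g).1 ∘ₗ (reducedIncl V X₁ X₂ g).2 = 0
    rw [this, h0, LinearMap.zero_comp, LinearMap.comp_zero]

omit [FiniteDimensional ℂ V] [FiniteDimensional ℂ U₁] in
theorem exists_reducedIncl_retraction (X₁ : Submodule ℂ U₁) (X₂ : Submodule ℂ U₂) :
    ∃ L : RepW V U₁ U₂ →ₗ[ℂ] RepW V X₁ (U₂ ⧸ X₂), ∀ g, L (reducedIncl V X₁ X₂ g) = g := by
  obtain ⟨s, hs⟩ := exists_mkQ_section X₂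
  obtain ⟨P, hP⟩ := exists_subtype_retraction X₁
  refine ⟨LinearMap.prodMap (LinearMap.llcomp ℂ V U₁ X₁ P) (LinearMap.lcomp ℂ V s), fun g => ?_⟩
  refine Prod.ext (LinearMap.ext fun x => ?_) (LinearMap.ext fun x => ?_)
  · exact LinearMap.congr_fun hP (g.1 x)
  · exact congrArg g.2 (LinearMap.congr_fun hs x)

omit [FiniteDimensional ℂ V] [FiniteDimensional ℂ U₁] [FiniteDimensional ℂ U₂] in
theorem morAt_reducedIncl (g : RepW V X₁ (U₂ ⧸ X₂)) :
    MorAt (aff _) (aff (RepW V U₁ U₂)) (reducedIncl V X₁ X₂) g :=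
  morAt_linear (LinearMap.prodMap (LinearMap.llcomp ℂ V X₁ U₁ X₁.subtype)
    (LinearMap.lcomp ℂ V X₂.mkQ)) g

end Slice

variable (X₁ : Gr p U₁) (X₂ : Gr (Module.finrank ℂ U₂ - q) U₂)

theorem finrank_quotient_slice (hq : q ≤ Module.finrank ℂ U₂) :
    Module.finrank ℂ (U₂ ⧸ X₂.1) = q := by
  rw [finrank_quotient_gr]
  omega

theorem nullSlice_eq (hp : p ≤ Module.finrank ℂ U₁) (hq : q ≤ Module.finrank ℂ U₂)
    (hpq : p + q = Module.finrank ℂ V) : nullSlice V p q X₁.1 X₂.1 =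
      {f | f ∈ nullCone V U₁ U₂ ∧ LinearMap.range f.1 ≤ X₁.1 ∧ X₂.1 ≤ LinearMap.ker f.2} := by
  ext f
  rw [nullSlice, Set.mem_inter_iff, mem_range_reducedIncl]
  refine ⟨fun h => ⟨nullComponent_subset h.1, h.2⟩, fun h => ⟨?_, h.2⟩⟩
  have h1 := Submodule.finrank_mono h.2.1
  have h2 := Submodule.finrank_mono h.2.2
  rw [X₁.2] at h1
  rw [X₂.2] at h2
  have h3 := LinearMap.finrank_range_add_finrank_ker f.1
  have h4 := LinearMap.finrank_range_add_finrank_ker f.2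
  obtain ⟨z, rfl⟩ := exists_nuTilde_eq_of_finrank (q := q) h.1 (by omega) (by omega)
  exact nuTilde_mem_nullComponent hp hq hpq z

theorem reducedIncl_mem_nullSlice_iff (hp : p ≤ Module.finrank ℂ U₁)
    (hq : q ≤ Module.finrank ℂ U₂) (hpq : p + q = Module.finrank ℂ V)
    {g : RepW V X₁.1 (U₂ ⧸ X₂.1)} : reducedIncl V X₁.1 X₂.1 g ∈ nullSlice V p q X₁.1 X₂.1 ↔
      g ∈ nullCone V X₁.1 (U₂ ⧸ X₂.1) := by
  rw [nullSlice_eq X₁ X₂ hp hq hpq, Set.mem_ofPred_eq, reducedIncl_mem_nullCone_iff]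
  exact and_iff_left (mem_range_reducedIncl.1 ⟨g, rfl⟩)

omit [FiniteDimensional ℂ V] [FiniteDimensional ℂ U₁] in
theorem isIso_nullCone_nullSlice
    (h : ∀ g, reducedIncl V X₁.1 X₂.1 g ∈ nullSlice V p q X₁.1 X₂.1 ↔
      g ∈ nullCone V X₁.1 (U₂ ⧸ X₂.1)) :
    IsIso ((aff (RepW V X₁.1 (U₂ ⧸ X₂.1))).sub (nullCone V X₁.1 (U₂ ⧸ X₂.1)))
      ((aff (RepW V U₁ U₂)).sub (nullSlice V p q X₁.1 X₂.1))
      (fun g => ⟨reducedIncl V X₁.1 X₂.1 g.1, (h g.1).2 g.2⟩) := by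
  obtain ⟨L, hL⟩ := exists_reducedIncl_retraction (V := V) X₁.1 X₂.1
  have hL' : ∀ f ∈ nullSlice V p q X₁.1 X₂.1, reducedIncl V X₁.1 X₂.1 (L f) = f := by
    rintro _ ⟨-, g, rfl⟩
    rw [hL]
  refine IsIso.mk (ψ := fun f => ⟨L f.1, (h _).1 (by rw [hL' f.1 f.2]; exact f.2)⟩) ?_ ?_ ?_ ?_
  · exact fun g => morAt_sub_iff.2 ((morAt_reducedIncl g.1).comp (morAt_val _ _ g))
  · exact fun f => morAt_sub_iff.2 ((morAt_val _ _ f).linear L)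
  · exact fun g => Subtype.ext (hL g.1)
  · exact fun f => Subtype.ext (hL' f.1 f.2)

/-- The part of `HatN` over `Grass_q(V) × {(X₁, X₂)}` is the bundle `TildeN` for the spaces `V`,
`X₁` and `U₂ / X₂`. -/
def tildeToSlice (z : TildeN V X₁.1 (U₂ ⧸ X₂.1) q) :
    (hatSlice (X₁, X₂) : Set (HatN V U₁ U₂ p q)) :=
  ⟨⟨(z.1, X₁, X₂), z.2⟩, trivial, rfl⟩

omit [FiniteDimensional ℂ V] [FiniteDimensional ℂ U₁] [FiniteDimensional ℂ U₂] in
theorem nuHat_tildeToSlice (z : TildeN V X₁.1 (U₂ ⧸ X₂.1) q) :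
    nuHat (tildeToSlice X₁ X₂ z).1 = reducedIncl V X₁.1 X₂.1 (nuTilde z) := rfl

omit [FiniteDimensional ℂ V] [FiniteDimensional ℂ U₁] in
theorem bijective_tildeToSlice : Function.Bijective (tildeToSlice (V := V) (q := q) X₁ X₂) := by
  constructor
  · intro z w h
    have h' := congrArg Subtype.val h
    obtain ⟨L, hL⟩ := exists_reducedIncl_retraction (V := V) X₁.1 X₂.1
    refine tildeN_ext (congrArg (fun z : HatN V U₁ U₂ p q => z.1.1) h') ?_
    rw [← hL (nuTilde z), ← hL (nuTilde w), ← nuHat_tildeToSlice, ← nuHat_tildeToSlice, h]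
  · rintro ⟨⟨⟨V₀, Y⟩, F⟩, -, hY⟩
    obtain rfl : Y = (X₁, X₂) := hY
    exact ⟨⟨V₀, F⟩, rfl⟩

omit [FiniteDimensional ℂ V] [FiniteDimensional ℂ U₁] in
theorem isIso_tildeToSlice : IsIso (tildeN V X₁.1 (U₂ ⧸ X₂.1) q)
    ((hatN V U₁ U₂ p q).sub (hatSlice (X₁, X₂))) (tildeToSlice X₁ X₂) := by
  obtain ⟨L, hL⟩ := exists_reducedIncl_retraction (V := V) X₁.1 X₂.1
  let e := Equiv.ofBijective _ (bijective_tildeToSlice (V := V) (q := q) X₁ X₂)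
  refine IsIso.mk (ψ := e.symm) ?_ ?_ e.symm_apply_apply e.apply_symm_apply
  · intro z
    have h1 : MorAt (tildeN V X₁.1 (U₂ ⧸ X₂.1) q) (hatBase V U₁ U₂ p q)
        (fun z => (z.1, X₁, X₂)) z :=
      ((isMorphism_zetaTilde _ _ _ _).morAt z).prodMk (morAt_const (X₁, X₂) z)
    have h2 : MorAt (tildeN V X₁.1 (U₂ ⧸ X₂.1) q) (aff (RepW V U₁ U₂))
        (fun z => reducedIncl V X₁.1 X₂.1 (nuTilde z)) z :=
      (morAt_reducedIncl _).comp (isMorphism_nuTilde.morAt z)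
    exact morAt_sub_iff.2 (morAt_induced_iff.2 (h1.prodMk h2))
  · intro y
    have hval := morAt_val (hatN V U₁ U₂ p q) (hatSlice (X₁, X₂)) y
    refine morAt_induced_iff.2 (MorAt.prodMk ?_ ?_)
    · refine (((isMorphism_zetaHat V U₁ U₂ p q).morAt y.1).comp hval).fst.congr
        (Eventually.of_forall fun y => ?_)
      obtain ⟨z, rfl⟩ := e.surjective y
      rw [e.symm_apply_apply]
      rfl
    · refine (((isMorphism_nuHat.morAt y.1).comp hval).linear L).congr
        (Eventually.of_forall fun y => ?_)
      obtain ⟨z, rfl⟩ := e.surjective y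
      rw [e.symm_apply_apply]
      exact hL (nuTilde z)

theorem isClosedImmersion_slice : IsClosedImmersion
    ((hatN V U₁ U₂ p q).sub (hatSlice (X₁, X₂))) (tildeN V U₁ U₂ q)
    (fun z => hatToTilde z.1) := by
  let φ : (hatSlice (X₁, X₂) : Set (HatN V U₁ U₂ p q)) → TildeN V U₁ U₂ q :=
    fun z => hatToTilde z.1
  have hrange : Set.range φ = {z | X₁.1.mkQ ∘ₗ (nuTilde z).1 = 0} ∩
      {z | (nuTilde z).2 ∘ₗ X₂.1.subtype = 0} := by
    ext z
    constructor
    · rintro ⟨y, rfl⟩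
      obtain ⟨w, rfl⟩ := (bijective_tildeToSlice X₁ X₂).2 y
      obtain ⟨h1, h2⟩ := mem_range_reducedIncl.1 ⟨nuTilde w, nuHat_tildeToSlice X₁ X₂ w⟩
      refine ⟨LinearMap.range_le_ker_iff.1 (by rwa [Submodule.ker_mkQ]),
        LinearMap.range_le_ker_iff.1 (by rwa [Submodule.range_subtype])⟩
    · rintro ⟨h1, h2⟩
      have h1' := LinearMap.range_le_ker_iff.2 h1
      have h2' := LinearMap.range_le_ker_iff.2 h2
      rw [Submodule.ker_mkQ] at h1'
      rw [Submodule.range_subtype] at h2'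
      have h3 : ∀ x, z.2.1 x ∈ X₁.1 := by
        intro x
        obtain ⟨v, rfl⟩ := z.1.1.mkQ_surjective x
        exact h1' ⟨v, rfl⟩
      have h4 : X₂.1 ≤ LinearMap.ker z.2.2 := fun x hx => Subtype.ext (h2' hx)
      refine ⟨⟨⟨(z.1, X₁, X₂), z.2.1.codRestrict _ h3, X₂.1.liftQ z.2.2 h4⟩, trivial, rfl⟩,
        tildeN_ext rfl ?_⟩
      exact Prod.ext (LinearMap.ext fun x => rfl) (LinearMap.ext fun x => rfl)
  have hinj : Function.Injective φ := by
    intro y y' h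
    refine Subtype.ext (hatN_ext (Prod.ext (congrArg Sigma.fst h) ?_) (congrArg nuTilde h))
    rw [show y.1.1.2 = (X₁, X₂) from y.2.2, show y'.1.1.2 = (X₁, X₂) from y'.2.2]
  refine ⟨?_, ?_⟩
  · change (tildeN V U₁ U₂ q).IsClosed (Set.range φ)
    rw [hrange]
    have hν := fun z => (isMorphism_nuTilde (V := V) (U₁ := U₁) (U₂ := U₂) (q := q)).morAt z
    have c1 : (tildeN V U₁ U₂ q).IsClosed {z | X₁.1.mkQ ∘ₗ (nuTilde z).1 = 0} :=
      isClosed_setOf_eq (isMorphism_iff.2 fun z => (morAt_const X₁.1.mkQ z).compL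
        ((hν z).linear (LinearMap.fst ℂ _ _))) (isMorphism_iff.2 fun z => morAt_const 0 z)
    have c2 : (tildeN V U₁ U₂ q).IsClosed {z | (nuTilde z).2 ∘ₗ X₂.1.subtype = 0} :=
      isClosed_setOf_eq (isMorphism_iff.2 fun z => ((hν z).linear (LinearMap.snd ℂ _ _)).compL
        (morAt_const X₂.1.subtype z)) (isMorphism_iff.2 fun z => morAt_const 0 z)
    refine isClosed_iff.2 fun z hz => ?_
    rw [Set.mem_inter_iff, not_and_or] at hz
    rcases hz with hz | hz
    · exact mem_of_superset (isClosed_iff.1 c1 z hz) fun w hw h => hw h.1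
    · exact mem_of_superset (isClosed_iff.1 c2 z hz) fun w hw h => hw h.2
  · let e := Equiv.ofInjective φ hinj
    have he : ∀ z : Set.range φ, φ (e.symm z) = z := fun z =>
      congrArg Subtype.val (e.apply_symm_apply z)
    refine IsIso.mk (ψ := e.symm) ?_ ?_ e.symm_apply_apply e.apply_symm_apply
    · exact fun z => morAt_sub_iff.2 ((isMorphism_hatToTilde.morAt _).comp (morAt_val _ _ z))
    · intro z
      have hval := morAt_val (tildeN V U₁ U₂ q) (Set.range φ) z
      refine morAt_sub_iff.2 (morAt_induced_iff.2 (MorAt.prodMk ?_ ?_))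
      · refine ((((isMorphism_zetaTilde V U₁ U₂ q).morAt z.1).comp hval).prodMk
          (morAt_const (X₁, X₂) z)).congr (Eventually.of_forall fun z => ?_)
        refine Prod.ext (congrArg Sigma.fst (he z)).symm ?_
        exact (e.symm z).2.2.symm
      · refine ((isMorphism_nuTilde.morAt z.1).comp hval).congr (Eventually.of_forall fun z => ?_)
        exact congrArg nuTilde (he z).symm

end Maps

/-! ### Properness of `ν` -/

section Proper

open AlgStr

variable {V U₁ U₂ : Type u} [AddCommGroup V] [AddCommGroup U₁] [AddCommGroup U₂]
  [Module ℂ V] [Module ℂ U₁] [Module ℂ U₂]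
  [FiniteDimensional ℂ V] [FiniteDimensional ℂ U₁] [FiniteDimensional ℂ U₂] {q : ℕ}

omit [FiniteDimensional ℂ V] [FiniteDimensional ℂ U₁] [FiniteDimensional ℂ U₂] in
/-- The point of `TildeN` over `S` obtained from `f` by means of the projection onto `S` along a
complement. -/
theorem exists_tildeN_of_projAlong (C : Submodule ℂ V) (S : Gr q V) (f : RepW V U₁ U₂) :
    ∃ z : TildeN V U₁ U₂ q, z.1 = S ∧ (IsCompl S.1 C → nuTilde z =
      (f.1 ∘ₗ (LinearMap.id - projAlong C S.1), projAlong C S.1 ∘ₗ f.2)) := by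
  by_cases h : IsCompl S.1 C
  · obtain ⟨z, hz, hz'⟩ := exists_nuTilde_eq
      (f := (f.1 ∘ₗ (LinearMap.id - projAlong C S.1), projAlong C S.1 ∘ₗ f.2)) S
      (fun x hx => by simp [projAlong_of_mem h hx])
      (by rintro _ ⟨x, rfl⟩; exact projAlong_mem _ _ _)
    exact ⟨z, hz, fun _ => hz'⟩
  · exact ⟨⟨S, 0⟩, rfl, fun h' => (h h').elim⟩

omit [FiniteDimensional ℂ V] [FiniteDimensional ℂ U₁] [FiniteDimensional ℂ U₂] in
theorem projAlong_formula_eq {C : Submodule ℂ V} {S : Submodule ℂ V} {f : RepW V U₁ U₂}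
    (h : IsCompl S C) (h1 : S ≤ LinearMap.ker f.1) (h2 : LinearMap.range f.2 ≤ S) :
    (f.1 ∘ₗ (LinearMap.id - projAlong C S), projAlong C S ∘ₗ f.2) = f := by
  refine Prod.ext (LinearMap.ext fun x => ?_) (LinearMap.ext fun x => ?_)
  · have : f.1 (projAlong C S x) = 0 := h1 (projAlong_mem _ _ _)
    simp [this]
  · exact projAlong_of_mem h (h2 ⟨x, rfl⟩)

/-- The map `ν` from `TildeN` to the null cone is proper. A closed subset of the source times `Z`
gives a closed condition on frames `v` of `V₀`, maps `f` and points of `Z`; it depends only on the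
span of `v`, and `v` is eliminated by `eventually_frame_notMem`. -/
theorem isProperMorphism_nuTilde : IsProperMorphism (tildeN V U₁ U₂ q)
    ((aff (RepW V U₁ U₂)).sub (nullCone V U₁ U₂))
    (fun z => ⟨nuTilde z, nuTilde_mem_nullCone z⟩) := by
  refine ⟨isMorphism_iff.2 fun z => morAt_sub_iff.2 (isMorphism_nuTilde.morAt z),
    fun Z C _ S hS => AlgStr.isClosed_iff.2 ?_⟩
  rintro ⟨f₀, z₀⟩ h₀
  let D := ((aff (RepW V U₁ U₂)).sub (nullCone V U₁ U₂)).prod C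
  let T : Set ((Fin q → V) × (nullCone V U₁ U₂ × Z)) := {t | ∃ x : TildeN V U₁ U₂ q,
    x.1.1 = Submodule.span ℂ (Set.range t.1) ∧ nuTilde x = t.2.1.1 ∧ (x, t.2.2) ∈ S}
  have key : ∀ᶠ y in D.nhd (f₀, z₀), ∀ v, LinearIndependent ℂ v → (v, y) ∉ T := by
    refine eventually_frame_notMem q (fun v hv => ?_) fun y v v' hvv => ?_
    · have hfst : MorAt ((aff (Fin q → V)).prod D) (aff (Fin q → V)) Prod.fst (v, (f₀, z₀)) :=
        morAt_fst _
      have hsnd : MorAt ((aff (Fin q → V)).prod D) D Prod.snd (v, (f₀, z₀)) := morAt_snd _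
      have hf : MorAt ((aff (Fin q → V)).prod D) (aff (RepW V U₁ U₂)) (fun t => t.2.1.1)
          (v, (f₀, z₀)) := (morAt_val _ _ _).comp hsnd.fst
      have hf1 := hf.linear (LinearMap.fst ℂ _ _)
      have hf2 := hf.linear (LinearMap.snd ℂ _ _)
      by_cases h1 : Submodule.span ℂ (Set.range v) ≤ LinearMap.ker f₀.1.1
      swap
      · obtain ⟨i, hi⟩ : ∃ i, f₀.1.1 (v i) ≠ 0 := by
          by_contra! hc
          refine h1 (Submodule.span_le.2 ?_)
          rintro _ ⟨i, rfl⟩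
          exact hc i
        filter_upwards [(hf1.applyL (hfst.linear (LinearMap.proj i))).eventually_ne hi] with t ht
        rintro ⟨x, hx, hxf, -⟩
        refine ht ?_
        have hmem : t.1 i ∈ x.1.1 := by
          rw [hx]
          exact Submodule.subset_span ⟨i, rfl⟩
        have := le_ker_of_nuTilde hmem
        rw [hxf] at this
        exact this
      obtain ⟨R, hR⟩ := Submodule.exists_isCompl (Submodule.span ℂ (Set.range v))
      have hπ := morAt_projAlong_span hfst hv hR
      have hli := hfst.eventually_linearIndependent hv
      have hcompl : ∀ᶠ t in ((aff (Fin q → V)).prod D).nhd (v, (f₀, z₀)),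
          IsCompl (Submodule.span ℂ (Set.range t.1)) R := by
        filter_upwards [hli, ((morAt_const R.mkQ _).compL
          hfst.linearCombination).eventually_bijective ((isCompl_span_iff hv).1 hR)] with t h1 h2
        exact (isCompl_span_iff h1).2 h2
      by_cases h2 : LinearMap.range f₀.1.2 ≤ Submodule.span ℂ (Set.range v)
      swap
      · have hne : (f₀.1.2 - projAlong R (Submodule.span ℂ (Set.range v)) ∘ₗ f₀.1.2) ≠ 0 := by
          intro h0
          refine h2 ?_
          rintro _ ⟨x, rfl⟩
          have := LinearMap.congr_fun (sub_eq_zero.1 h0) x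
          rw [this]
          exact projAlong_mem _ _ _
        filter_upwards [(hf2.sub (hπ.compL hf2)).eventually_ne hne, hcompl] with t ht htc
        rintro ⟨x, hx, hxf, -⟩
        refine ht (sub_eq_zero.2 (LinearMap.ext fun y => ?_))
        have := range_le_of_nuTilde (z := x) ⟨y, rfl⟩
        rw [hx, hxf] at this
        exact (projAlong_of_mem htc this).symm
      classical
      let G : (Fin q → V) → Gr q V := fun w =>
        if hw : LinearIndependent ℂ w then frameSpan q V ⟨w, hw⟩ else frameSpan q V ⟨v, hv⟩
      have hG : ∀ w, LinearIndependent ℂ w → (G w).1 = Submodule.span ℂ (Set.range w) := by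
        intro w hw
        simp [G, hw, frameSpan]
      choose ρ hρ hρ' using exists_tildeN_of_projAlong (V := V) (U₁ := U₁) (U₂ := U₂) (q := q) R
      have hρmor : MorAt ((aff (Fin q → V)).prod D) (tildeN V U₁ U₂ q)
          (fun t => ρ (G t.1) t.2.1.1) (v, (f₀, z₀)) := by
        refine morAt_induced_iff.2 (MorAt.prodMk ?_ ?_)
        · refine morAt_grass_of_frame hfst ?_
          filter_upwards [hli] with t ht
          rw [hρ, hG _ ht]
        · refine (morAt_aff_prod (f := fun t : (Fin q → V) × (nullCone V U₁ U₂ × Z) =>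
            (t.2.1.1.1 ∘ₗ (LinearMap.id - projAlong R (Submodule.span ℂ (Set.range t.1))),
              projAlong R (Submodule.span ℂ (Set.range t.1)) ∘ₗ t.2.1.1.2))
            (hf1.compL ((morAt_const _ _).sub hπ)) (hπ.compL hf2)).congr ?_
          filter_upwards [hli, hcompl] with t ht htc
          rw [hρ' _ _ (by rwa [hG _ ht]), hG _ ht]
      have hx₀ : nuTilde (ρ (G v) f₀.1) = f₀.1 := by
        rw [hρ' _ _ (by rwa [hG _ hv]), hG _ hv, projAlong_formula_eq hR h1 h2]
      have hnot : (ρ (G v) f₀.1, z₀) ∉ S := fun h =>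
        h₀ ⟨_, h, Prod.ext (Subtype.ext hx₀) rfl⟩
      filter_upwards [(hρmor.prodMk hsnd.snd).mem (AlgStr.isClosed_iff.1 hS _ hnot), hli, hcompl]
        with t ht htl htc
      rintro ⟨x, hx, hxf, hxS⟩
      have : ρ (G t.1) t.2.1.1 = x := by
        refine tildeN_ext ?_ ?_
        · rw [hρ]
          exact Subtype.ext ((hG _ htl).trans hx.symm)
        · rw [hρ' _ _ (by rwa [hG _ htl]), hG _ htl, ← hxf, ← hx]
          exact projAlong_formula_eq (hx ▸ htc) le_ker_of_nuTilde range_le_of_nuTilde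
      exact ht (this ▸ hxS)
    · rintro ⟨x, hx, hxf, hxS⟩
      exact ⟨x, hx.trans hvv, hxf, hxS⟩
  filter_upwards [key] with y hy
  rintro ⟨⟨x, z⟩, hxz, rfl⟩
  let b := Module.finBasisOfFinrankEq ℂ x.1.1 x.1.2
  refine hy (fun i => (b i : V)) (b.linearIndependent.map' x.1.1.subtype x.1.1.ker_subtype)
    ⟨x, ?_, rfl, hxz⟩
  have : Set.range (fun i => (b i : V)) = x.1.1.subtype '' Set.range b :=
    (Set.range_comp x.1.1.subtype b)
  rw [this, Submodule.span_image, b.span_eq, Submodule.map_top, Submodule.range_subtype]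

end Proper

/-! ### Local rings and smooth points -/

section LocalRings

namespace AlgStr

variable {X : Type u} {Y : Type v} {A : AlgStr X} {B : AlgStr Y}

/-- The germ of a regular function, as an element of the local ring. -/
def germ {f : X → ℂ} {x : X} (hf : A.RegAt f x) : A.localRing x :=
  ⟨(f : Filter.Germ (@nhds X A.top x) ℂ), f, hf, rfl⟩

theorem germ_eq_iff {f g : X → ℂ} {x : X} {hf : A.RegAt f x} {hg : A.RegAt g x} :
    germ hf = germ hg ↔ ∀ᶠ y in A.nhd x, f y = g y :=
  Subtype.ext_iff.trans Filter.Germ.coe_eq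

theorem exists_germ_eq {x : X} (s : A.localRing x) : ∃ f, ∃ hf : A.RegAt f x, germ hf = s := by
  obtain ⟨s, f, hf, rfl⟩ := s
  exact ⟨f, hf, rfl⟩

/-- A germ is invertible if and only if its value is not zero. -/
theorem isUnit_germ_iff {f : X → ℂ} {x : X} {hf : A.RegAt f x} : IsUnit (germ hf) ↔ f x ≠ 0 := by
  constructor
  · rintro ⟨u, hu⟩ h0
    obtain ⟨g, hg, hgu⟩ := exists_germ_eq (u⁻¹ : (A.localRing x)ˣ).1
    have h1 : germ hf * germ hg = 1 := by rw [hgu, ← hu, u.mul_inv]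
    have h2 : ∀ᶠ y in A.nhd x, f y * g y = 1 :=
      germ_eq_iff (hf := hf.mul hg) (hg := A.regAt_const 1 x).1 h1
    have h3 := self_of_nhd h2
    rw [h0, zero_mul] at h3
    exact zero_ne_one h3
  · intro h
    refine IsUnit.of_mul_eq_one (germ (hf.inv h)) ?_
    refine germ_eq_iff (hf := hf.mul (hf.inv h)) (hg := A.regAt_const 1 x).2 ?_
    filter_upwards [hf.ne h] with y hy
    exact mul_inv_cancel₀ hy

/-- The homomorphism of local rings induced by a map that is a morphism at a point. -/
def pull {φ : X → Y} {x : X} {y : Y} (h1 : Tendsto φ (A.nhd x) (B.nhd y))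
    (h2 : ∀ f, B.RegAt f y → A.RegAt (f ∘ φ) x) : B.localRing y →+* A.localRing x where
  toFun s := ⟨s.1.compTendsto φ h1, by
    obtain ⟨_, f, hf, rfl⟩ := s
    exact ⟨f ∘ φ, h2 f hf, rfl⟩⟩
  map_one' := rfl
  map_zero' := rfl
  map_add' := by
    rintro ⟨_, f, hf, rfl⟩ ⟨_, g, hg, rfl⟩
    rfl
  map_mul' := by
    rintro ⟨_, f, hf, rfl⟩ ⟨_, g, hg, rfl⟩
    rfl

/-- Smoothness of a point is invariant under maps that are isomorphisms near the point. -/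
theorem SmoothAt.of_local_inverse {φ : X → Y} {ψ : Y → X} {x : X} (hφ : MorAt A B φ x)
    (hψ : MorAt B A ψ (φ x)) (h1 : ∀ᶠ z in A.nhd x, ψ (φ z) = z)
    (h2 : ∀ᶠ y in B.nhd (φ x), φ (ψ y) = y) (h : A.SmoothAt x) : B.SmoothAt (φ x) := by
  have hx : ψ (φ x) = x := self_of_nhd (p := fun z => ψ (φ z) = z) h1
  have hψ1 : Tendsto ψ (B.nhd (φ x)) (A.nhd x) := by
    have := hψ.1
    rwa [hx] at this
  have hψ2 : ∀ f, A.RegAt f x → B.RegAt (f ∘ ψ) (φ x) := fun f hf => hψ.2 f (by rwa [hx])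
  have e : A.localRing x ≃+* B.localRing (φ x) := by
    refine RingEquiv.ofRingHom (pull hψ1 hψ2) (pull hφ.1 hφ.2) ?_ ?_
    · refine RingHom.ext fun s => ?_
      obtain ⟨f, hf, rfl⟩ := exists_germ_eq s
      refine germ_eq_iff (hf := hψ2 _ (hφ.2 f hf)) (hg := hf).2 ?_
      filter_upwards [h2] with y hy
      exact congrArg f hy
    · refine RingHom.ext fun s => ?_
      obtain ⟨f, hf, rfl⟩ := exists_germ_eq s
      refine germ_eq_iff (hf := hφ.2 _ (hψ2 f hf)) (hg := hf).2 ?_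
      filter_upwards [h1] with y hy
      exact congrArg f hy
  have : IsRegularLocalRing (A.localRing x) := h
  exact IsRegularLocalRing.of_ringEquiv e

theorem IsIso.smoothAt_iff {φ : X → Y} (h : IsIso A B φ) (x : X) :
    B.SmoothAt (φ x) ↔ A.SmoothAt x := by
  obtain ⟨ψ, hψ, h1, h2⟩ := h.exists_symm
  refine ⟨fun hs => ?_, fun hs => hs.of_local_inverse (h.1.morAt x) (hψ.1.morAt _)
    (Eventually.of_forall h1) (Eventually.of_forall h2)⟩
  have := hs.of_local_inverse (hψ.1.morAt _) (h.1.morAt _)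
    (Eventually.of_forall h2) (Eventually.of_forall h1)
  rwa [h1] at this

theorem smoothAt_sub_iff {U : Set X} (hU : A.IsOpen U) (x : U) :
    (A.sub U).SmoothAt x ↔ A.SmoothAt x.1 := by
  classical
  let ψ : X → U := fun y => if hy : y ∈ U then ⟨y, hy⟩ else x
  have hψ : ∀ y : U, ψ y.1 = y := fun y => dif_pos y.2
  have hψx : MorAt A (A.sub U) ψ x.1 := by
    refine MorAt.of_restrict (isOpen_iff.1 hU x.1 x.2) ?_
    exact (morAt_id _ x).congr (Eventually.of_forall fun y => (hψ y).symm)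
  have hev : ∀ᶠ y in A.nhd x.1, (ψ y).1 = y := by
    filter_upwards [isOpen_iff.1 hU x.1 x.2] with y hy
    exact congrArg Subtype.val (hψ ⟨y, hy⟩)
  refine ⟨fun h => h.of_local_inverse (morAt_val _ _ x) hψx (Eventually.of_forall hψ) hev,
    fun h => ?_⟩
  have := h.of_local_inverse hψx (by rw [hψ]; exact morAt_val _ _ x) hev
    (Eventually.of_forall hψ)
  rwa [hψ] at this

variable {E : Type*} [AddCommGroup E] [Module ℂ E]

/-- The local ring at a point `x` of a subset `S` of an affine space is the localization of the
ring of polynomial functions on `S` at the ideal of functions vanishing at `x`. -/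
theorem isLocalization_localRing {S : Set E} (x : S) {R : Type*} [CommRing R]
    (ev : R →+* (S → ℂ)) (hinj : Function.Injective ev)
    (hrange : ∀ f : S → ℂ, (∃ r, ev r = f) ↔ ∃ g ∈ polyFun E, ∀ y : S, f y = g y)
    (M : Ideal R) [M.IsPrime] (hM : ∀ r, r ∈ M ↔ ev r x = 0) :
    ∃ _ : Algebra R (((aff E).sub S).localRing x),
      IsLocalization.AtPrime (((aff E).sub S).localRing x) M := by
  have hreg : ∀ r, ((aff E).sub S).RegAt (ev r) x := by
    intro r
    obtain ⟨g, hg, hgr⟩ := (hrange _).1 ⟨r, rfl⟩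
    exact ((morAt_val _ S x).regAt (regAt_polyFun hg x.1)).congr
      (Eventually.of_forall fun y => (hgr y).symm)
  let F : R →+* ((aff E).sub S).localRing x :=
    { toFun := fun r => germ (hreg r)
      map_one' := germ_eq_iff (hg := ((aff E).sub S).regAt_const 1 x).2
        (Eventually.of_forall fun y => by simp)
      map_zero' := germ_eq_iff (hg := ((aff E).sub S).regAt_const 0 x).2
        (Eventually.of_forall fun y => by simp)
      map_add' := fun a b => germ_eq_iff (hg := (hreg a).add (hreg b)).2
        (Eventually.of_forall fun y => by simp)
      map_mul' := fun a b => germ_eq_iff (hg := (hreg a).mul (hreg b)).2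
        (Eventually.of_forall fun y => by simp) }
  let : Algebra R (((aff E).sub S).localRing x) := F.toAlgebra
  refine ⟨this, (isLocalization_iff _ _).2 ⟨?_, ?_, ?_⟩⟩
  · rintro ⟨r, hr⟩
    exact (isUnit_germ_iff (hf := hreg r)).2 fun h => hr ((hM r).2 h)
  · intro s
    obtain ⟨f, hf, rfl⟩ := exists_germ_eq s
    obtain ⟨f', hf', hff'⟩ := id hf
    obtain ⟨g, hg, h, hh, h0, hgh⟩ := regAt_aff_iff.1 hf'
    obtain ⟨r, hr⟩ := (hrange fun y => g y).2 ⟨g, hg, fun _ => rfl⟩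
    obtain ⟨r', hr'⟩ := (hrange fun y => h y).2 ⟨h, hh, fun _ => rfl⟩
    refine ⟨⟨r, r', fun hm => h0 ?_⟩, ?_⟩
    · have := (hM r').1 hm
      rwa [hr'] at this
    · refine germ_eq_iff (hf := hf.mul (hreg r')) (hg := hreg r).2 ?_
      filter_upwards [hff', (morAt_val _ S x).1.eventually hgh,
        (morAt_val _ S x).1.eventually ((regAt_polyFun hh x.1).ne h0)] with y h1 h2 h3
      simp only [hr, hr']
      rw [h1, Function.comp_apply, h2, div_mul_cancel₀ _ h3]
  · intro r r' hrr
    have h1 : ∀ᶠ y in ((aff E).sub S).nhd x, ev r y = ev r' y :=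
      germ_eq_iff (hf := hreg r) (hg := hreg r').1 hrr
    rw [nhd_sub] at h1
    obtain ⟨t, ht, hts⟩ := mem_comap.1 h1
    obtain ⟨h, hh, h0, hs⟩ := mem_nhd_aff.1 ht
    obtain ⟨c, hc⟩ := (hrange fun y => h y).2 ⟨h, hh, fun _ => rfl⟩
    refine ⟨⟨c, fun hm => h0 ?_⟩, hinj ?_⟩
    · have := (hM c).1 hm
      rwa [hc] at this
    · rw [map_mul, map_mul]
      funext y
      simp only [Pi.mul_apply, hc]
      by_cases hy : h y = 0
      · rw [hy, zero_mul, zero_mul]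
      · have : ev r y = ev r' y := hts (hs hy)
        rw [this]

theorem eval_mem_polyFun {n : ℕ} (P : MvPolynomial (Fin n) ℂ) :
    (fun x => MvPolynomial.eval x P) ∈ polyFun (Fin n → ℂ) := by
  induction P using MvPolynomial.induction_on with
  | C a =>
    simp only [MvPolynomial.eval_C]
    exact (polyFun (Fin n → ℂ)).algebraMap_mem a
  | add P Q hP hQ =>
    simp only [map_add]
    exact add_mem hP hQ
  | mul_X P i hP =>
    simp only [map_mul, MvPolynomial.eval_X]
    exact mul_mem hP (dual_mem_polyFun (LinearMap.proj i : (Fin n → ℂ) →ₗ[ℂ] ℂ))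

theorem smoothAt_aff {n : ℕ} (x : Fin n → ℂ) : (aff (Fin n → ℂ)).SmoothAt x := by
  let ev : MvPolynomial (Fin n) ℂ →+* (↥(Set.univ : Set (Fin n → ℂ)) → ℂ) :=
    RingHom.pi fun (y : (Set.univ : Set (Fin n → ℂ))) => MvPolynomial.eval y.1
  let M : Ideal (MvPolynomial (Fin n) ℂ) := RingHom.ker (MvPolynomial.eval x)
  have hp : M.IsPrime := RingHom.ker_isPrime _
  obtain ⟨_, _⟩ := isLocalization_localRing (⟨x, trivial⟩ : (Set.univ : Set (Fin n → ℂ))) ev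
    (fun P Q h => MvPolynomial.funext fun y => congrFun h ⟨y, trivial⟩)
    (fun f => by
      constructor
      · rintro ⟨P, rfl⟩
        exact ⟨_, eval_mem_polyFun P, fun _ => rfl⟩
      · rintro ⟨g, hg, hf⟩
        obtain ⟨P, hP⟩ := exists_mvPolynomial_of_mem_polyFun hg
        exact ⟨P, funext fun y => by rw [hf y, hP]; rfl⟩) M (fun P => Iff.rfl)
  have e := IsLocalization.algEquiv M.primeCompl (Localization.AtPrime M)
    (((aff (Fin n → ℂ)).sub Set.univ).localRing ⟨x, trivial⟩)
  exact (smoothAt_sub_iff (isOpen_univ _) ⟨x, trivial⟩).1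
    (IsRegularLocalRing.of_ringEquiv e.toRingEquiv)

theorem HasAtlas.smoothAt {n : ℕ} {P : Set X → Prop} (hA : HasAtlas A n P) (x : X) :
    A.SmoothAt x := by
  obtain ⟨𝒰, -, hcov, h⟩ := hA
  obtain ⟨U, hU, hx⟩ := Set.eq_univ_iff_forall.1 hcov x
  obtain ⟨φ, hφ⟩ := (h U hU).2.1
  exact (smoothAt_sub_iff (h U hU).1 ⟨x, hx⟩).1 ((hφ.smoothAt_iff _).1 (smoothAt_aff _))

/-! ### Tangent vectors and dimension -/

theorem differentiable_of_mem_polyFun {g : ℂ → ℂ} (hg : g ∈ polyFun ℂ) : Differentiable ℂ g := by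
  induction hg using Algebra.adjoin_induction with
  | mem g hg =>
    obtain ⟨φ, rfl⟩ := hg
    have : ∀ z, φ z = z * φ 1 := fun z => by simpa using φ.map_smul z 1
    rw [show (fun x => φ x) = fun x => x * φ 1 from funext this]
    fun_prop
  | algebraMap r => exact differentiable_const r
  | add f g _ _ hf hg => exact hf.add hg
  | mul f g _ _ hf hg => exact hf.mul hg

theorem eventually_nhds_of_nhd_aff {p : ℂ → Prop} {x : ℂ} (h : ∀ᶠ y in (aff ℂ).nhd x, p y) :
    ∀ᶠ y in 𝓝 x, p y := by
  have hfin := finite_compl_of_mem_nhd_aff h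
  have : {y | p y} ∈ 𝓝 x := by
    rw [← compl_compl {y | p y}]
    exact hfin.isClosed.isOpen_compl.mem_nhds fun hx => hx (mem_of_mem_nhd h)
  exact this

theorem RegAt.differentiableAt {f : ℂ → ℂ} {x : ℂ} (hf : (aff ℂ).RegAt f x) :
    DifferentiableAt ℂ f x := by
  obtain ⟨g, hg, h, hh, h0, hf⟩ := regAt_aff_iff.1 hf
  exact ((differentiable_of_mem_polyFun hg x).fun_div (differentiable_of_mem_polyFun hh x)
    h0).congr_of_eventuallyEq (eventually_nhds_of_nhd_aff hf)

/-- The velocities `v` at `0` of regular curves through `x`, with respect to a map `ι` to a vector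
space. -/
def velocities (A : AlgStr X) (ι : X → E) (x : X) : Set E :=
  {v | ∃ γ : ℂ → X, γ 0 = x ∧ MorAt (aff ℂ) A γ 0 ∧
    ∀ φ : Module.Dual ℂ E, HasDerivAt (fun t => φ (ι (γ t))) (φ v) 0}

/-- The number of generators of the maximal ideal is at least the dimension of the space spanned
by the velocities of curves, since derivations along curves are determined by their values on
generators. -/
theorem finrank_span_velocities_le [FiniteDimensional ℂ E] {ι : X → E} {x : X}
    (hι : MorAt A (aff E) ι x) [IsLocalRing (A.localRing x)] [IsNoetherianRing (A.localRing x)] :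
    Module.finrank ℂ (Submodule.span ℂ (velocities A ι x)) ≤
      (IsLocalRing.maximalIdeal (A.localRing x)).spanFinrank := by
  set m := IsLocalRing.maximalIdeal (A.localRing x)
  have hfg : m.FG := IsNoetherian.noetherian m
  have hgfin : (Submodule.generators m).Finite := Submodule.FG.finite_generators hfg
  have hcard : (Submodule.generators m).ncard = m.spanFinrank := Submodule.FG.generators_ncard hfg
  have : Finite (Submodule.generators m) := hgfin
  have := Fintype.ofFinite (Submodule.generators m)
  have hmem : ∀ {f} (hf : A.RegAt f x), germ hf ∈ m ↔ f x = 0 := by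
    intro f hf
    rw [IsLocalRing.mem_maximalIdeal, mem_nonunits_iff, isUnit_germ_iff, not_not]
  choose α hα hα' using fun a : Submodule.generators m => exists_germ_eq a.1
  have hα0 : ∀ a, α a x = 0 := fun a => by
    rw [← hmem (hα a), hα' a]
    exact Submodule.FG.generators_mem m a.2
  obtain ⟨b, hbsub, hbspan, hbli⟩ := exists_linearIndependent ℂ (velocities A ι x)
  have hbfin : Finite b := hbli.finite
  have := Fintype.ofFinite b
  choose γ hγ0 hγ hγd using fun v : b => hbsub v.2
  have hdiff : ∀ (v : b) {f : X → ℂ}, A.RegAt f x → DifferentiableAt ℂ (fun t => f (γ v t)) 0 :=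
    fun v f hf => ((hγ v).regAt (by rwa [hγ0])).differentiableAt
  by_contra! hlt
  rw [← hbspan, finrank_span_set_eq_card hbli, ← hcard, Set.toFinset_card,
    ← Nat.card_coe_set_eq, Nat.card_eq_fintype_card] at hlt
  -- a linear relation between the derivatives of the generators along the curves
  have hdep : ¬ LinearIndependent ℂ
      (fun v : b => fun a : Submodule.generators m => deriv (fun t => α a (γ v t)) 0) := by
    intro h
    have := h.fintype_card_le_finrank
    rw [Module.finrank_fintype_fun_eq_card] at this
    omega
  obtain ⟨c, hc, v₀, hv₀⟩ := Fintype.not_linearIndependent_iff.1 hdep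
  let D : (X → ℂ) → ℂ := fun f => ∑ v, c v * deriv (fun t => f (γ v t)) 0
  have hDcongr : ∀ {f g : X → ℂ}, (∀ᶠ y in A.nhd x, f y = g y) → D f = D g := by
    intro f g h
    refine Finset.sum_congr rfl fun v _ => ?_
    have h1 : ∀ᶠ t in (aff ℂ).nhd 0, f (γ v t) = g (γ v t) :=
      (hγ v).1.eventually (by rwa [hγ0])
    have h2 : (fun t => f (γ v t)) =ᶠ[𝓝 0] fun t => g (γ v t) := eventually_nhds_of_nhd_aff h1
    rw [h2.deriv_eq]
  have key : ∀ s ∈ m, ∀ f (hf : A.RegAt f x), germ hf = s → D f = 0 := by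
    intro s hs
    rw [← Submodule.span_generators m] at hs
    induction hs using Submodule.span_induction with
    | mem s hs =>
      intro f hf hfs
      rw [hDcongr (germ_eq_iff.1 (hfs.trans (hα' ⟨s, hs⟩).symm))]
      have := congrFun hc ⟨s, hs⟩
      simpa [Finset.sum_apply] using this
    | zero =>
      intro f hf hfs
      rw [hDcongr (germ_eq_iff (hg := A.regAt_const 0 x).1 hfs)]
      simp [D]
    | add s s' _ _ hs hs' =>
      intro f hf hfs
      obtain ⟨g, hg, rfl⟩ := exists_germ_eq s
      obtain ⟨g', hg', rfl⟩ := exists_germ_eq s'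
      rw [hDcongr (germ_eq_iff (hg := hg.add hg').1 hfs)]
      have : D (fun y => g y + g' y) = D g + D g' := by
        simp only [D, ← Finset.sum_add_distrib, ← mul_add]
        exact Finset.sum_congr rfl fun v _ => by rw [deriv_fun_add (hdiff v hg) (hdiff v hg')]
      rw [this, hs g hg rfl, hs' g' hg' rfl, add_zero]
    | smul r s hsm hs =>
      intro f hf hfs
      obtain ⟨g, hg, rfl⟩ := exists_germ_eq s
      obtain ⟨k, hk, rfl⟩ := exists_germ_eq r
      rw [Submodule.span_generators, hmem] at hsm
      rw [hDcongr (germ_eq_iff (hg := hk.mul hg).1 hfs)]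
      have : D (fun y => k y * g y) = k x * D g := by
        simp only [D, Finset.mul_sum]
        refine Finset.sum_congr rfl fun v _ => ?_
        rw [deriv_fun_mul (hdiff v hk) (hdiff v hg), hγ0, hsm]
        ring
      rw [this, hs g hg rfl, mul_zero]
  -- hence the same relation holds between the velocities
  have hrel : ∑ v, c v • (v : E) = 0 := by
    rw [← Module.forall_dual_apply_eq_zero_iff ℂ]
    intro φ
    have hreg : A.RegAt (fun y => φ (ι y) - φ (ι x)) x :=
      (morAt_aff_iff.1 hι φ).sub (A.regAt_const _ x)
    have h1 := key _ ((hmem hreg).2 (sub_self _)) _ hreg rfl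
    rw [map_sum, ← h1]
    refine Finset.sum_congr rfl fun v _ => ?_
    rw [((hγd v φ).sub_const _).deriv, map_smul, smul_eq_mul]
  exact hv₀ (Fintype.linearIndependent_iff.1 hbli c hrel v₀)

end AlgStr

end LocalRings

/-! ### The dimension of a parametrized variety -/

section Dimension

open AlgStr

/-- A finitely generated algebra contained in a polynomial ring in `d` variables has dimension at
most `d`, by Noether normalization and comparison of transcendence degrees. -/
theorem ringKrullDim_le_of_injective {d : ℕ} {R : Type*} [CommRing R] [Algebra ℂ R]
    [Algebra.FiniteType ℂ R] (f : R →ₐ[ℂ] MvPolynomial (Fin d) ℂ) (hf : Function.Injective f) :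
    ringKrullDim R ≤ d := by
  have : Nontrivial R := f.toRingHom.domain_nontrivial
  obtain ⟨s, g, hg, hint⟩ := exists_integral_inj_algHom_of_fg ℂ R
  have hs : s ≤ d := by
    have hind : AlgebraicIndependent ℂ (fun i : Fin s => f (g (MvPolynomial.X i))) := by
      have : MvPolynomial.aeval (fun i : Fin s => f (g (MvPolynomial.X i))) = f.comp g := by
        ext i
        simp
      rw [AlgebraicIndependent, this]
      exact hf.comp hg
    have := hind.lift_cardinalMk_le_trdeg
    rw [MvPolynomial.trdeg_of_isDomain] at this
    simpa using this
  let := g.toRingHom.toAlgebra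
  have : Algebra.IsIntegral (MvPolynomial (Fin s) ℂ) R := ⟨hint⟩
  calc ringKrullDim R ≤ ringKrullDim (MvPolynomial (Fin s) ℂ) :=
        Order.krullDim_le_of_strictMono
          (PrimeSpectrum.comap (algebraMap (MvPolynomial (Fin s) ℂ) R))
          fun I J hIJ => Ideal.IsIntegral.comap_lt_comap hIJ
    _ = s := by
        rw [MvPolynomial.ringKrullDim_of_isNoetherianRing, ringKrullDim_eq_zero_of_field]
        simp
    _ ≤ d := by exact_mod_cast hs

variable {E F G : Type*} [AddCommGroup E] [Module ℂ E] [AddCommGroup F] [Module ℂ F]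
  [AddCommGroup G] [Module ℂ G] [FiniteDimensional ℂ E] [FiniteDimensional ℂ F]

theorem fg_polyFun : (polyFun E).FG := by
  let b := Module.finBasis ℂ E
  have : polyFun E = Algebra.adjoin ℂ (Set.range fun i => fun x => b.coord i x) := by
    refine le_antisymm (Algebra.adjoin_le ?_) (Algebra.adjoin_mono ?_)
    · rintro _ ⟨φ, rfl⟩
      have : (fun x => φ x) = ∑ i, φ (b i) • fun x => b.coord i x := by
        funext x
        conv_lhs => rw [← b.sum_repr x]
        simp [-Module.Basis.sum_repr, mul_comm]
      rw [this]
      refine sum_mem fun i _ => Subalgebra.smul_mem _ (Algebra.subset_adjoin ?_) _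
      exact ⟨i, rfl⟩
    · rintro _ ⟨i, rfl⟩
      exact ⟨b.coord i, rfl⟩
  rw [this]
  exact Subalgebra.fg_def.2 ⟨_, Set.finite_range _, rfl⟩

omit [FiniteDimensional ℂ E] [FiniteDimensional ℂ F] in
theorem comp_mem_polyFun {θ : F → E} (hθ : ∀ φ : Module.Dual ℂ E, (fun y => φ (θ y)) ∈ polyFun F)
    {g : E → ℂ} (hg : g ∈ polyFun E) : (fun y => g (θ y)) ∈ polyFun F := by
  induction hg using Algebra.adjoin_induction with
  | mem g hg =>
    obtain ⟨φ, rfl⟩ := hg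
    exact hθ φ
  | algebraMap r => exact (polyFun F).algebraMap_mem r
  | add f g _ _ hf hg => exact add_mem hf hg
  | mul f g _ _ hf hg => exact mul_mem hf hg

omit [FiniteDimensional ℂ F] in
theorem bilin_mem_polyFun (β : E →ₗ[ℂ] F →ₗ[ℂ] ℂ) (L : G →ₗ[ℂ] E) (L' : G →ₗ[ℂ] F) :
    (fun x => β (L x) (L' x)) ∈ polyFun G := by
  let b := Module.finBasis ℂ E
  have : (fun x => β (L x) (L' x)) =
      ∑ i, (fun x => (b.coord i ∘ₗ L) x) * fun x => (β (b i) ∘ₗ L') x := by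
    funext x
    conv_lhs => rw [← b.sum_repr (L x)]
    simp [-Module.Basis.sum_repr]
  rw [this]
  exact sum_mem fun i _ => mul_mem (dual_mem_polyFun _) (dual_mem_polyFun _)

/-- If a polynomial map from a vector space of dimension `d` to `S` has dense image, the local
rings of `S` have dimension at most `d`. -/
theorem ringKrullDim_localRing_le {S : Set E} (x : S) (θ : F → E)
    (hθ : ∀ φ : Module.Dual ℂ E, (fun y => φ (θ y)) ∈ polyFun F) (hθS : ∀ y, θ y ∈ S)
    (hdense : ∀ g ∈ polyFun E, (∀ y, g (θ y) = 0) → ∀ z ∈ S, g z = 0) :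
    ringKrullDim (((aff E).sub S).localRing x) ≤ Module.finrank ℂ F := by
  let e := (Module.finBasis ℂ F).equivFun
  let res : (E → ℂ) →ₐ[ℂ] (S → ℂ) :=
    AlgHom.pi fun y => Pi.evalAlgHom ℂ (fun _ => ℂ) y.1
  let R := (polyFun E).map res
  have hRfg : Algebra.FiniteType ℂ R := (Subalgebra.fg_iff_finiteType _).1 (fg_polyFun.map res)
  let M : Ideal R := RingHom.ker ((Pi.evalRingHom (fun _ : S => ℂ) x).comp R.val.toRingHom)
  have hp : M.IsPrime := RingHom.ker_isPrime _
  obtain ⟨_, _⟩ := isLocalization_localRing x R.val.toRingHom Subtype.val_injective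
    (fun f => by
      constructor
      · rintro ⟨⟨_, g, hg, rfl⟩, rfl⟩
        exact ⟨g, hg, fun _ => rfl⟩
      · rintro ⟨g, hg, hf⟩
        exact ⟨⟨f, g, hg, funext fun y => (hf y).symm⟩, rfl⟩) M (fun P => Iff.rfl)
  rw [IsLocalization.AtPrime.ringKrullDim_eq_height M]
  refine (Ideal.height_le_ringKrullDim_of_ne_top hp.ne_top).trans ?_
  let ev : MvPolynomial (Fin (Module.finrank ℂ F)) ℂ →ₐ[ℂ]
      ((Fin (Module.finrank ℂ F) → ℂ) → ℂ) :=
    AlgHom.pi fun y => MvPolynomial.aeval y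
  have hev : Function.Injective ev := fun P Q h => MvPolynomial.funext fun y => by
    have := congrFun h y
    simpa [ev, MvPolynomial.aeval_eq_eval] using this
  let pb : (S → ℂ) →ₐ[ℂ] ((Fin (Module.finrank ℂ F) → ℂ) → ℂ) :=
    AlgHom.pi fun y => Pi.evalAlgHom ℂ (fun _ : S => ℂ) ⟨θ (e.symm y), hθS _⟩
  have hpb : ∀ r : R, pb r ∈ ev.range := by
    rintro ⟨_, g, hg, rfl⟩
    have h1 : (fun y => g (θ (e.symm y))) ∈ polyFun (Fin (Module.finrank ℂ F) → ℂ) :=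
      comp_mem_polyFun (θ := e.symm) (fun φ => dual_mem_polyFun (φ ∘ₗ e.symm.toLinearMap))
        (comp_mem_polyFun hθ hg)
    obtain ⟨P, hP⟩ := exists_mvPolynomial_of_mem_polyFun h1
    exact ⟨P, funext fun y => by
      simpa [ev, pb, res, MvPolynomial.aeval_eq_eval] using (hP y).symm⟩
  refine ringKrullDim_le_of_injective
    ((AlgEquiv.ofInjective ev hev).symm.toAlgHom.comp ((pb.comp R.val).codRestrict ev.range hpb)) ?_
  have hinj : Function.Injective ((pb.comp R.val).codRestrict ev.range hpb) := by
    rw [injective_iff_map_eq_zero]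
    rintro ⟨_, g, hg, rfl⟩ h
    refine Subtype.ext (funext fun y => hdense g hg (fun z => ?_) y.1 y.2)
    have h1 : g (θ (e.symm (e z))) = 0 := congrFun (congrArg Subtype.val h) (e z)
    rwa [e.symm_apply_apply] at h1
  exact (AlgEquiv.ofInjective ev hev).symm.injective.comp hinj

section NullCone

variable {V U₁ U₂ : Type u} [AddCommGroup V] [AddCommGroup U₁] [AddCommGroup U₂]
  [Module ℂ V] [Module ℂ U₁] [Module ℂ U₂]
  [FiniteDimensional ℂ V] [FiniteDimensional ℂ U₁] [FiniteDimensional ℂ U₂] {p q : ℕ}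

omit [FiniteDimensional ℂ U₂] in
/-- Every point of the null cone with `range f₂ ≤ S ≤ ker f₁` lies on a curve in the null cone
whose general point satisfies the same condition for a complement of a given subspace `C`: move
`f` by the automorphisms `1 + t w` of `V`. -/
theorem exists_curve_isCompl {f : RepW V U₁ U₂} {S C : Submodule ℂ V}
    (hS : Module.finrank ℂ S + Module.finrank ℂ C = Module.finrank ℂ V)
    (h1 : S ≤ LinearMap.ker f.1) (h2 : LinearMap.range f.2 ≤ S) :
    ∃ γ : ℂ → RepW V U₁ U₂, γ 0 = f ∧ MorAt (aff ℂ) (aff (RepW V U₁ U₂)) γ 0 ∧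
      {t | ¬ ∃ S' : Submodule ℂ V, IsCompl S' C ∧ S' ≤ LinearMap.ker (γ t).1 ∧
        LinearMap.range (γ t).2 ≤ S'}.Finite := by
  obtain ⟨s, hs⟩ := exists_mkQ_section C
  have hd : Module.finrank ℂ S = Module.finrank ℂ (V ⧸ C) := by
    have := C.finrank_quotient_add_finrank
    omega
  let e : S ≃ₗ[ℂ] V ⧸ C := LinearEquiv.ofFinrankEq _ _ hd
  obtain ⟨e', he'⟩ := LinearMap.exists_extend e.toLinearMap
  let w : V →ₗ[ℂ] V := s ∘ₗ e'
  have hw : C.mkQ ∘ₗ w ∘ₗ S.subtype = e.toLinearMap := by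
    rw [← he', ← LinearMap.comp_assoc, ← LinearMap.comp_assoc, hs, LinearMap.id_comp]
  let M : ℂ → V →ₗ[ℂ] V := fun t => LinearMap.id + t • w
  have hM : MorAt (aff ℂ) (aff (V →ₗ[ℂ] V)) M 0 := morAt_line _ _ 0
  have hM0 : M 0 = LinearMap.id := by simp [M]
  obtain ⟨N, hN, hNM⟩ := hM.exists_inverse (by rw [hM0]; exact Function.bijective_id)
  have hN0 : N 0 = LinearMap.id := by
    have := self_of_nhd (p := fun t => N t ∘ₗ M t = LinearMap.id ∧ M t ∘ₗ N t = LinearMap.id) hNM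
    rw [hM0] at this
    exact this.1
  refine ⟨fun t => (f.1 ∘ₗ N t, M t ∘ₗ f.2), ?_, ?_, ?_⟩
  · simp only [hM0, hN0, LinearMap.comp_id, LinearMap.id_comp]
  · exact morAt_aff_prod ((morAt_const f.1 0).compL hN) (hM.compL (morAt_const f.2 0))
  · refine ((finite_compl_of_mem_nhd_aff hNM).union (finite_not_bijective_add_smul
      ((C.mkQ ∘ₗ S.subtype) ∘ₗ e.symm.toLinearMap))).subset fun t ht => ?_
    by_contra hc
    simp only [Set.mem_union, not_or, Set.mem_compl_iff, Set.mem_ofPred_eq, not_not] at hc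
    obtain ⟨⟨hc1, hc2⟩, hc3⟩ := hc
    have hMinj : Function.Injective (M t) :=
      Function.LeftInverse.injective (g := N t) fun v => LinearMap.congr_fun hc1 v
    refine ht ⟨LinearMap.range (M t ∘ₗ S.subtype), ?_, ?_, ?_⟩
    · rw [isCompl_range_iff fun a b h => Subtype.ext (hMinj h)]
      have : C.mkQ ∘ₗ M t ∘ₗ S.subtype =
          ((C.mkQ ∘ₗ S.subtype) ∘ₗ e.symm.toLinearMap + t • LinearMap.id) ∘ₗ e.toLinearMap := by
        refine LinearMap.ext fun x => ?_
        have hx : C.mkQ (w x) = e x := LinearMap.congr_fun hw x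
        simp only [M, LinearMap.comp_apply, LinearMap.add_apply, LinearMap.smul_apply,
          LinearMap.id_apply, map_add, map_smul, Submodule.subtype_apply, hx,
          LinearEquiv.coe_coe, e.symm_apply_apply]
      rw [this, LinearMap.coe_comp]
      exact hc3.comp e.bijective
    · rintro _ ⟨x, rfl⟩
      have hx : N t (M t x) = x := LinearMap.congr_fun hc1 x
      have hx' : f.1 x = 0 := h1 x.2
      simp [hx, hx']
    · rintro _ ⟨x, rfl⟩
      exact ⟨⟨f.2 x, h2 ⟨x, rfl⟩⟩, rfl⟩

/-- The dimension of the null cone of the contraction map is at most `p² + p q + q²` if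
`dim U₁ = p`, `dim U₂ = q` and `dim V = p + q`. The null cone is parametrized by the triples of a
linear map `h : K → C` between complementary subspaces, whose graph is `V₀`, and of linear maps
`C → U₁` and `U₂ → K`. -/
theorem ringKrullDim_localRing_nullCone_le (hp : Module.finrank ℂ U₁ = p)
    (hq : Module.finrank ℂ U₂ = q) (hpq : p + q = Module.finrank ℂ V) (f : nullCone V U₁ U₂) :
    ringKrullDim (((aff (RepW V U₁ U₂)).sub (nullCone V U₁ U₂)).localRing f) ≤
      (p * p + p * q + q * q : ℕ) := by
  obtain ⟨K, -, -, hK⟩ := exists_submodule_between (bot_le : (⊥ : Submodule ℂ V) ≤ ⊤) (d := q)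
    (by simp) (by rw [finrank_top]; omega)
  obtain ⟨C, hKC⟩ := Submodule.exists_isCompl K
  have hC : Module.finrank ℂ C = p := by
    have := Submodule.finrank_add_eq_of_isCompl hKC
    omega
  let πK : V →ₗ[ℂ] K := K.projectionOnto C hKC
  let πC : V →ₗ[ℂ] C := C.projectionOnto K hKC.symm
  have hπK : ∀ k : K, πK k = k := fun k => Submodule.projectionOnto_apply_left _ k
  have hπC : ∀ c : C, πC c = c := fun c => Submodule.projectionOnto_apply_left _ c
  have hπKC : ∀ c : C, πK c = 0 := fun c => Submodule.projectionOnto_apply_right _ c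
  have hπCK : ∀ k : K, πC k = 0 := fun k => Submodule.projectionOnto_apply_right _ k
  have hsum : ∀ v : V, (πK v : V) + πC v = v := by
    intro v
    obtain ⟨k, hk, c, hc, rfl⟩ := Submodule.mem_sup.1
      (hKC.sup_eq_top ▸ Submodule.mem_top : v ∈ K ⊔ C)
    rw [map_add, map_add, hπK ⟨k, hk⟩, hπC ⟨c, hc⟩, hπKC ⟨c, hc⟩, hπCK ⟨k, hk⟩, add_zero, zero_add]
  let θ : (K →ₗ[ℂ] C) × (C →ₗ[ℂ] U₁) × (U₂ →ₗ[ℂ] K) → RepW V U₁ U₂ := fun z =>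
    (z.2.1 ∘ₗ πC - (z.2.1 ∘ₗ z.1) ∘ₗ πK, K.subtype ∘ₗ z.2.2 + C.subtype ∘ₗ z.1 ∘ₗ z.2.2)
  have hd : Module.finrank ℂ ((K →ₗ[ℂ] C) × (C →ₗ[ℂ] U₁) × (U₂ →ₗ[ℂ] K)) =
      p * p + p * q + q * q := by
    rw [Module.finrank_prod, Module.finrank_prod, Module.finrank_linearMap,
      Module.finrank_linearMap, Module.finrank_linearMap, hK, hC, hp, hq]
    ring
  rw [← hd]
  refine ringKrullDim_localRing_le f θ ?_ ?_ ?_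
  · intro φ
    let L₁ : (K →ₗ[ℂ] C) × (C →ₗ[ℂ] U₁) × (U₂ →ₗ[ℂ] K) →ₗ[ℂ] K →ₗ[ℂ] C := LinearMap.fst ℂ _ _
    let L₂ : (K →ₗ[ℂ] C) × (C →ₗ[ℂ] U₁) × (U₂ →ₗ[ℂ] K) →ₗ[ℂ] C →ₗ[ℂ] U₁ :=
      LinearMap.fst ℂ _ _ ∘ₗ LinearMap.snd ℂ _ _
    let L₃ : (K →ₗ[ℂ] C) × (C →ₗ[ℂ] U₁) × (U₂ →ₗ[ℂ] K) →ₗ[ℂ] U₂ →ₗ[ℂ] K :=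
      LinearMap.snd ℂ _ _ ∘ₗ LinearMap.snd ℂ _ _
    let φ₁ : (V →ₗ[ℂ] U₁) →ₗ[ℂ] ℂ := φ ∘ₗ LinearMap.inl ℂ _ _
    let φ₂ : (U₂ →ₗ[ℂ] V) →ₗ[ℂ] ℂ := φ ∘ₗ LinearMap.inr ℂ _ _
    let β₁ : (C →ₗ[ℂ] U₁) →ₗ[ℂ] (K →ₗ[ℂ] C) →ₗ[ℂ] ℂ := (LinearMap.llcomp ℂ K C U₁).compr₂
      (φ₁ ∘ₗ LinearMap.lcomp ℂ U₁ πK)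
    let β₂ : (K →ₗ[ℂ] C) →ₗ[ℂ] (U₂ →ₗ[ℂ] K) →ₗ[ℂ] ℂ := (LinearMap.llcomp ℂ U₂ K C).compr₂
      (φ₂ ∘ₗ LinearMap.llcomp ℂ U₂ C V C.subtype)
    have hφ : (fun z => φ (θ z)) = (fun z => (φ₁ ∘ₗ LinearMap.lcomp ℂ U₁ πC ∘ₗ L₂) z) -
        (fun z => β₁ (L₂ z) (L₁ z)) +
        ((fun z => (φ₂ ∘ₗ LinearMap.llcomp ℂ U₂ K V K.subtype ∘ₗ L₃) z) +
          fun z => β₂ (L₁ z) (L₃ z)) := by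
      funext z
      have : θ z = LinearMap.inl ℂ _ _ (θ z).1 + LinearMap.inr ℂ _ _ (θ z).2 := by simp
      rw [this, map_add]
      change φ₁ (θ z).1 + φ₂ (θ z).2 = _
      simp only [θ, map_sub, map_add]
      rfl
    rw [hφ]
    exact add_mem (sub_mem (dual_mem_polyFun _) (bilin_mem_polyFun _ _ _))
      (add_mem (dual_mem_polyFun _) (bilin_mem_polyFun _ _ _))
  · intro z
    refine LinearMap.ext fun u => ?_
    simp [θ, hπK, hπC, hπKC, hπCK]
  · intro g hg hgθ z hz
    by_contra hne
    have hz1 := LinearMap.finrank_range_add_finrank_ker z.1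
    have hz2 := LinearMap.finrank_range_le z.2
    have hz3 := Submodule.finrank_le (LinearMap.range z.1)
    obtain ⟨y, hy⟩ := exists_nuTilde_eq_of_finrank (q := q) hz (by omega) (by omega)
    obtain ⟨γ, hγ0, hγ, hfin⟩ := exists_curve_isCompl (f := z) (S := y.1.1) (C := C)
      (by rw [y.1.2, hC]; omega) (hy ▸ le_ker_of_nuTilde) (hy ▸ range_le_of_nuTilde)
    obtain ⟨t, ht, htg⟩ := exists_notMem_of_line hγ (U := {f | g f ≠ 0})
      ((regAt_polyFun hg _).ne (by rwa [hγ0])) hfin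
    rw [Set.mem_ofPred_eq, not_not] at ht
    obtain ⟨S, hSC, hS1, hS2⟩ := ht
    refine htg ?_
    -- a complement `S` of `C` is the graph of a linear map from `K` to `C`
    let h : K →ₗ[ℂ] C := πC ∘ₗ projAlong C S ∘ₗ K.subtype
    have hproj : ∀ v, ((πK v : K) : V) + h (πK v) = projAlong C S (πK v) := by
      intro v
      have h1 : πK (πK v - projAlong C S (πK v)) = 0 :=
        hπKC ⟨_, sub_projAlong_mem hSC (πK v : V)⟩
      rw [map_sub, hπK, sub_eq_zero] at h1
      have h2 := hsum (projAlong C S (πK v))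
      rwa [← h1] at h2
    have hgraph : ∀ s ∈ S, projAlong C S (πK s) = s := by
      intro s hs
      refine projAlong_unique hSC hs ?_
      have h3 : (πK s : V) - s = -(πC s : V) := by
        rw [sub_eq_iff_eq_add, ← hsum s]
        simp only [map_add, hπK, hπC, hπKC, hπCK]
        simp
      rw [h3]
      exact C.neg_mem (πC s).2
    have hrange : θ (h, (γ t).1 ∘ₗ C.subtype, πK ∘ₗ (γ t).2) = γ t := by
      refine Prod.ext (LinearMap.ext fun v => ?_) (LinearMap.ext fun u => ?_)
      · have h0 : (γ t).1 (projAlong C S (πK v)) = 0 := hS1 (projAlong_mem _ _ _)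
        rw [← hproj, map_add] at h0
        have h4 : (γ t).1 v = (γ t).1 (πK v) + (γ t).1 (πC v) := by
          rw [← map_add, hsum]
        rw [h4, eq_neg_of_add_eq_zero_left h0]
        change (γ t).1 (πC v) - (γ t).1 (h (πK v)) = _
        abel
      · change ((πK ((γ t).2 u) : K) : V) + h (πK ((γ t).2 u)) = (γ t).2 u
        rw [hproj, hgraph _ (hS2 ⟨u, rfl⟩)]
    rw [← hrange]
    exact hgθ _

end NullCone

end Dimension

/-! ### Singular points of the null cone -/

section Singular

open AlgStr

theorem exists_generalized_inverse {E F : Type*} [AddCommGroup E] [Module ℂ E] [AddCommGroup F]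
    [Module ℂ F] (f : E →ₗ[ℂ] F) : ∃ g : F →ₗ[ℂ] E, f ∘ₗ g ∘ₗ f = f := by
  obtain ⟨s, hs⟩ := f.rangeRestrict.exists_rightInverse_of_surjective f.range_rangeRestrict
  obtain ⟨g, hg⟩ := LinearMap.exists_extend s
  refine ⟨g, LinearMap.ext fun x => ?_⟩
  have h1 : g (f x) = s (f.rangeRestrict x) := LinearMap.congr_fun hg (f.rangeRestrict x)
  have h2 : f.rangeRestrict (s (f.rangeRestrict x)) = f.rangeRestrict x :=
    LinearMap.congr_fun hs _
  change f (g (f x)) = f x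
  rw [h1]
  exact congrArg Subtype.val h2

variable {V U₁ U₂ : Type u} [AddCommGroup V] [AddCommGroup U₁] [AddCommGroup U₂]
  [Module ℂ V] [Module ℂ U₁] [Module ℂ U₂]

/-- The differential of the contraction map at `f`. -/
def contractionDeriv (f : RepW V U₁ U₂) : RepW V U₁ U₂ →ₗ[ℂ] U₂ →ₗ[ℂ] U₁ :=
  LinearMap.lcomp ℂ U₁ f.2 ∘ₗ LinearMap.fst ℂ _ _ +
    LinearMap.llcomp ℂ U₂ V U₁ f.1 ∘ₗ LinearMap.snd ℂ _ _

theorem contractionDeriv_apply (f h : RepW V U₁ U₂) :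
    contractionDeriv f h = h.1 ∘ₗ f.2 + f.1 ∘ₗ h.2 := rfl

/-- The lines through `f` that lie in the null cone span the kernel of the differential of the
contraction map. -/
theorem ker_contractionDeriv_le {f : RepW V U₁ U₂} (hf : f ∈ nullCone V U₁ U₂) :
    LinearMap.ker (contractionDeriv f) ≤
      Submodule.span ℂ {h | contractionDeriv f h = 0 ∧ h.1 ∘ₗ h.2 = 0} := by
  intro h hh
  have hh' : h.1 ∘ₗ f.2 + f.1 ∘ₗ h.2 = 0 := hh
  have hf' : ∀ x, f.1 (f.2 x) = 0 := fun x => LinearMap.congr_fun hf x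
  obtain ⟨r, hr⟩ := exists_generalized_inverse f.1
  obtain ⟨g, hg⟩ := exists_generalized_inverse f.2
  have hr' : ∀ x, f.1 (r (f.1 x)) = f.1 x := fun x => LinearMap.congr_fun hr x
  have hg' : ∀ x, f.2 (g (f.2 x)) = f.2 x := fun x => LinearMap.congr_fun hg x
  have h12 : ∀ x, f.1 (h.2 x) = -h.1 (f.2 x) := fun x =>
    eq_neg_of_add_eq_zero_right (LinearMap.congr_fun hh' x)
  -- an endomorphism `a` with `a² = 0` and `f₁ a f₂ = f₁ h₂`
  let a : V →ₗ[ℂ] V := r ∘ₗ f.1 ∘ₗ h.2 ∘ₗ g ∘ₗ (LinearMap.id - r ∘ₗ f.1)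
  have haa : ∀ x, a (a x) = 0 := fun x => by simp [a, hr']
  have hfa : ∀ x, f.1 (a (f.2 x)) = f.1 (h.2 x) := fun x => by
    have : f.1 (a (f.2 x)) = f.1 (h.2 (g (f.2 x))) := by simp [a, hr', hf']
    rw [this, h12, hg', h12]
  have hdecomp : h = (-(f.1 ∘ₗ a), a ∘ₗ f.2) + ((h.1 + f.1 ∘ₗ a, 0) + (0, h.2 - a ∘ₗ f.2)) := by
    refine Prod.ext (LinearMap.ext fun x => ?_) (LinearMap.ext fun x => ?_)
    · simp
    · simp
  rw [hdecomp]
  refine add_mem (Submodule.subset_span ⟨?_, ?_⟩)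
    (add_mem (Submodule.subset_span ⟨?_, ?_⟩) (Submodule.subset_span ⟨?_, ?_⟩)) <;>
  refine LinearMap.ext fun x => ?_
  · simp [contractionDeriv_apply]
  · simp [haa]
  · simp [contractionDeriv_apply, hfa, h12]
  · simp
  · simp [contractionDeriv_apply, hfa]
  · simp

variable [FiniteDimensional ℂ V] [FiniteDimensional ℂ U₁] [FiniteDimensional ℂ U₂] {p q : ℕ}

omit [FiniteDimensional ℂ V] [FiniteDimensional ℂ U₁] [FiniteDimensional ℂ U₂] in
theorem ker_contractionDeriv_le_velocities (f : nullCone V U₁ U₂) :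
    LinearMap.ker (contractionDeriv f.1) ≤ Submodule.span ℂ
      (velocities ((aff (RepW V U₁ U₂)).sub (nullCone V U₁ U₂)) Subtype.val f) := by
  refine (ker_contractionDeriv_le f.2).trans (Submodule.span_mono ?_)
  rintro h ⟨h1, h2⟩
  have hline : ∀ t : ℂ, f.1 + t • h ∈ nullCone V U₁ U₂ := by
    intro t
    have hf : f.1.1 ∘ₗ f.1.2 = 0 := f.2
    rw [contractionDeriv_apply] at h1
    change (f.1.1 + t • h.1) ∘ₗ (f.1.2 + t • h.2) = 0
    rw [LinearMap.add_comp, LinearMap.comp_add, LinearMap.comp_add, LinearMap.comp_smul,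
      LinearMap.comp_smul, LinearMap.smul_comp, LinearMap.smul_comp, hf, h2, smul_zero, smul_zero,
      add_zero, zero_add, ← smul_add, add_comm, h1, smul_zero]
  refine ⟨fun t => ⟨f.1 + t • h, hline t⟩, Subtype.ext (by simp),
    morAt_sub_iff.2 (morAt_line _ _ 0), fun φ => ?_⟩
  have : HasDerivAt (fun t : ℂ => φ f.1 + t * φ h) (φ h) 0 := by
    simpa using ((hasDerivAt_id (0 : ℂ)).mul_const (φ h)).const_add (φ f.1)
  simpa using this

/-- If `f₁` is not surjective and `f₂` is not injective, the tangent space of the null cone at `f`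
is larger than its dimension. -/
theorem not_smoothAt_nullCone (hp : Module.finrank ℂ U₁ = p) (hq : Module.finrank ℂ U₂ = q)
    (hpq : p + q = Module.finrank ℂ V) (f : nullCone V U₁ U₂)
    (h1 : ¬ Function.Surjective f.1.1) (h2 : ¬ Function.Injective f.1.2) :
    ¬ ((aff (RepW V U₁ U₂)).sub (nullCone V U₁ U₂)).SmoothAt f := by
  intro hs
  have hreg : IsRegularLocalRing
    (((aff (RepW V U₁ U₂)).sub (nullCone V U₁ U₂)).localRing f) := hs
  have hdim := ringKrullDim_localRing_nullCone_le hp hq hpq f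
  rw [← hreg.spanFinrank_maximalIdeal] at hdim
  have hdim' : (IsLocalRing.maximalIdeal (((aff (RepW V U₁ U₂)).sub
    (nullCone V U₁ U₂)).localRing f)).spanFinrank ≤ p * p + p * q + q * q := by exact_mod_cast hdim
  have htan := (Submodule.finrank_mono (ker_contractionDeriv_le_velocities f)).trans
    (finrank_span_velocities_le (morAt_val _ _ f))
  -- the range of the differential is a proper subspace of `Hom(U₂, U₁)`
  have hrange : LinearMap.range (contractionDeriv f.1) ≠ ⊤ := by
    intro htop
    obtain ⟨u, hu, hu0⟩ : ∃ u, f.1.2 u = 0 ∧ u ≠ 0 := by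
      by_contra! hc
      exact h2 ((injective_iff_map_eq_zero _).2 hc)
    obtain ⟨y, hy⟩ : ∃ y, y ∉ LinearMap.range f.1.1 := by
      by_contra! hc
      exact h1 hc
    obtain ⟨φ, hφ⟩ : ∃ φ : Module.Dual ℂ U₂, φ u ≠ 0 := by
      by_contra! hc
      exact hu0 ((Module.forall_dual_apply_eq_zero_iff ℂ _).1 hc)
    obtain ⟨k, hk⟩ := LinearMap.range_eq_top.1 htop (φ.smulRight y)
    have := LinearMap.congr_fun hk u
    simp only [contractionDeriv_apply, LinearMap.add_apply, LinearMap.comp_apply, hu, map_zero,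
      zero_add, LinearMap.smulRight_apply] at this
    refine hy ⟨(φ u)⁻¹ • k.2 u, ?_⟩
    rw [map_smul, this, smul_smul, inv_mul_cancel₀ hφ, one_smul]
  have hlt := Submodule.finrank_lt hrange
  have hrn := LinearMap.finrank_range_add_finrank_ker (contractionDeriv f.1)
  rw [Module.finrank_prod, Module.finrank_linearMap, Module.finrank_linearMap, hp, hq, ← hpq] at hrn
  rw [Module.finrank_linearMap, hp, hq] at hlt
  nlinarith

end Singular

/-! ### The resolution of the null cone -/

section NullConeResolution

open AlgStr

variable {V U₁ U₂ : Type u} [AddCommGroup V] [AddCommGroup U₁] [AddCommGroup U₂]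
  [Module ℂ V] [Module ℂ U₁] [Module ℂ U₂]
  [FiniteDimensional ℂ V] [FiniteDimensional ℂ U₁] [FiniteDimensional ℂ U₂] {p q : ℕ}

/-- The points of the null cone where `f₁` is surjective or `f₂` is injective. If `dim U₁ = p` and
`dim U₂ = q`, these are the points with exactly one preimage under `ν`. -/
def nullConeRegular (V U₁ U₂ : Type u) [AddCommGroup V] [AddCommGroup U₁] [AddCommGroup U₂]
    [Module ℂ V] [Module ℂ U₁] [Module ℂ U₂] : Set (nullCone V U₁ U₂) :=
  {f | Function.Surjective f.1.1 ∨ Function.Injective f.1.2}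

theorem isOpen_nullConeRegular : ((aff (RepW V U₁ U₂)).sub (nullCone V U₁ U₂)).IsOpen
    (nullConeRegular V U₁ U₂) := by
  rw [AlgStr.isOpen_iff]
  intro f hf
  have hval := morAt_val (aff (RepW V U₁ U₂)) (nullCone V U₁ U₂) f
  rcases hf with hf | hf
  · filter_upwards [(hval.linear (LinearMap.fst ℂ _ _)).eventually_surjective hf] with g hg
    exact Or.inl hg
  · filter_upwards [(hval.linear (LinearMap.snd ℂ _ _)).eventually_injective hf] with g hg
    exact Or.inr hg

/-- The map `ν` with values in the null cone. -/
def nuNull (z : TildeN V U₁ U₂ q) : nullCone V U₁ U₂ := ⟨nuTilde z, nuTilde_mem_nullCone z⟩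

omit [FiniteDimensional ℂ U₁] [FiniteDimensional ℂ U₂] in
theorem eq_ker_of_surjective (hp : Module.finrank ℂ U₁ = p) (hpq : p + q = Module.finrank ℂ V)
    {z : TildeN V U₁ U₂ q} (h : Function.Surjective (nuTilde z).1) :
    z.1.1 = LinearMap.ker (nuTilde z).1 := by
  refine Submodule.eq_of_le_of_finrank_eq le_ker_of_nuTilde ?_
  have h1 := LinearMap.finrank_range_add_finrank_ker (nuTilde z).1
  rw [LinearMap.range_eq_top.2 h, finrank_top] at h1
  have h2 := z.1.2
  omega

omit [FiniteDimensional ℂ U₁] [FiniteDimensional ℂ U₂] in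
theorem eq_range_of_injective (hq : Module.finrank ℂ U₂ = q)
    {z : TildeN V U₁ U₂ q} (h : Function.Injective (nuTilde z).2) :
    LinearMap.range (nuTilde z).2 = z.1.1 := by
  refine Submodule.eq_of_le_of_finrank_eq range_le_of_nuTilde ?_
  rw [LinearMap.finrank_range_of_inj h, hq, z.1.2]

theorem surjective_nuNull (hp : Module.finrank ℂ U₁ = p) (hq : Module.finrank ℂ U₂ = q)
    (hpq : p + q = Module.finrank ℂ V) :
    Function.Surjective (nuNull : TildeN V U₁ U₂ q → nullCone V U₁ U₂) := by
  intro f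
  have h1 := LinearMap.finrank_range_add_finrank_ker f.1.1
  have h2 := LinearMap.finrank_range_le f.1.2
  have h3 := Submodule.finrank_le (LinearMap.range f.1.1)
  obtain ⟨z, hz⟩ := exists_nuTilde_eq_of_finrank (q := q) f.2 (by omega) (by omega)
  exact ⟨z, Subtype.ext hz⟩

omit [FiniteDimensional ℂ U₁] [FiniteDimensional ℂ U₂] in
theorem injOn_nuNull (hp : Module.finrank ℂ U₁ = p) (hq : Module.finrank ℂ U₂ = q)
    (hpq : p + q = Module.finrank ℂ V) {z w : TildeN V U₁ U₂ q}
    (hz : nuNull z ∈ nullConeRegular V U₁ U₂)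
    (h : nuNull z = nuNull w) : z = w := by
  have h' : nuTilde z = nuTilde w := congrArg Subtype.val h
  refine tildeN_ext (Subtype.ext ?_) h'
  rcases hz with hz | hz
  · rw [eq_ker_of_surjective hp hpq hz, eq_ker_of_surjective hp hpq (h' ▸ hz), h']
  · rw [← eq_range_of_injective hq hz, ← eq_range_of_injective hq (h' ▸ hz), h']

omit [FiniteDimensional ℂ U₂] in
theorem tildeGeneric_subset (hp : Module.finrank ℂ U₁ = p)
    (hpq : p + q = Module.finrank ℂ V) :
    tildeGeneric V U₁ U₂ q ⊆ nuNull ⁻¹' nullConeRegular V U₁ U₂ := by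
  rintro z ⟨hz, -⟩
  refine Or.inl ?_
  have h1 := finrank_quotient_gr z.1
  exact ((LinearMap.injective_iff_surjective_of_finrank_eq_finrank (by omega)).1 hz).comp
    z.1.1.mkQ_surjective

/-- Over the regular locus the inverse of `ν` is given by `V₀ = ker f₁` or `V₀ = range f₂`. -/
theorem isIso_nuNull (hp : Module.finrank ℂ U₁ = p) (hq : Module.finrank ℂ U₂ = q)
    (hpq : p + q = Module.finrank ℂ V) : IsIso
    ((tildeN V U₁ U₂ q).sub (nuNull ⁻¹' nullConeRegular V U₁ U₂))
    (((aff (RepW V U₁ U₂)).sub (nullCone V U₁ U₂)).sub (nullConeRegular V U₁ U₂))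
    ((Set.mapsTo_preimage nuNull (nullConeRegular V U₁ U₂)).restrict _ _ _) := by
  choose ψ hψ using surjective_nuNull (V := V) hp hq hpq
  refine IsIso.mk (ψ := fun f => ⟨ψ f.1, by rw [Set.mem_preimage, hψ]; exact f.2⟩) ?_ ?_ ?_ ?_
  · exact fun z => morAt_sub_iff.2 (morAt_sub_iff.2
      ((isMorphism_nuTilde.morAt z.1).comp (morAt_val _ _ z)))
  · intro f
    have hψ' : ∀ g, nuTilde (ψ g) = g.1 := fun g => congrArg Subtype.val (hψ g)
    have hval : MorAt (((aff (RepW V U₁ U₂)).sub (nullCone V U₁ U₂)).sub (nullConeRegular V U₁ U₂))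
        (aff (RepW V U₁ U₂)) (fun g => g.1.1) f := (morAt_val _ _ f.1).comp (morAt_val _ _ f)
    refine morAt_sub_iff.2 (morAt_induced_iff.2 (MorAt.prodMk ?_ ?_))
    · rcases f.2 with hf | hf
      · have h1 := hval.linear (LinearMap.fst ℂ _ _)
        refine morAt_grass_of_ker h1 hf ?_
        filter_upwards [h1.eventually_surjective hf] with g hg
        have := eq_ker_of_surjective hp hpq (z := ψ g.1) (by rw [hψ']; exact hg)
        rw [this, hψ']
        rfl
      · have h1 := hval.linear (LinearMap.snd ℂ _ _)
        refine morAt_grass_of_range hq h1 ?_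
        filter_upwards [h1.eventually_injective hf] with g hg
        have := eq_range_of_injective hq (z := ψ g.1) (by rw [hψ']; exact hg)
        rw [← this, hψ']
        rfl
    · exact hval.congr (Eventually.of_forall fun g => (hψ' g.1).symm)
  · exact fun z => Subtype.ext (injOn_nuNull hp hq hpq (by rw [hψ]; exact z.2) (hψ _))
  · exact fun f => Subtype.ext (hψ _)

theorem isBirational_nuNull (hp : Module.finrank ℂ U₁ = p) (hq : Module.finrank ℂ U₂ = q)
    (hpq : p + q = Module.finrank ℂ V) : IsBirational (tildeN V U₁ U₂ q)
    ((aff (RepW V U₁ U₂)).sub (nullCone V U₁ U₂)) nuNull := by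
  have hmor : IsMorphism (tildeN V U₁ U₂ q) ((aff (RepW V U₁ U₂)).sub (nullCone V U₁ U₂)) nuNull :=
    isMorphism_iff.2 fun z => morAt_sub_iff.2 (isMorphism_nuTilde.morAt z)
  have hd := isDense_iff.1
    (isDense_tildeGeneric (V := V) (U₁ := U₁) (U₂ := U₂) (q := q) (by omega) (by omega))
  refine ⟨hmor, _, _, hmor.isOpen_preimage isOpen_nullConeRegular, ?_, isOpen_nullConeRegular, ?_,
    Set.mapsTo_preimage _ _, isIso_nuNull hp hq hpq⟩
  · refine isDense_iff.2 fun z U hU => ?_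
    obtain ⟨w, hwU, hw⟩ := hd z U hU
    exact ⟨w, hwU, tildeGeneric_subset hp hpq hw⟩
  · refine isDense_iff.2 fun f U hU => ?_
    obtain ⟨z, rfl⟩ := surjective_nuNull hp hq hpq f
    obtain ⟨w, hwU, hw⟩ := hd z _ ((hmor.morAt z).1 hU)
    exact ⟨nuNull w, hwU, tildeGeneric_subset hp hpq hw⟩

theorem existsUnique_nuNull_iff (hp : Module.finrank ℂ U₁ = p) (hq : Module.finrank ℂ U₂ = q)
    (hpq : p + q = Module.finrank ℂ V) (f : nullCone V U₁ U₂) :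
    (∃! z : TildeN V U₁ U₂ q, nuNull z = f) ↔ f ∈ nullConeRegular V U₁ U₂ := by
  constructor
  · rintro ⟨z, rfl, hz⟩
    by_contra hc
    rw [nullConeRegular, Set.mem_ofPred_eq, not_or] at hc
    have h1 := LinearMap.finrank_range_add_finrank_ker (nuTilde z).1
    have h2 := LinearMap.finrank_range_add_finrank_ker (nuTilde z).2
    have h3 : Module.finrank ℂ (LinearMap.range (nuTilde z).1) < p :=
      hp ▸ Submodule.finrank_lt fun h => hc.1 (LinearMap.range_eq_top.1 h)
    have h4 : Module.finrank ℂ (LinearMap.ker (nuTilde z).2) ≠ 0 := fun h =>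
      hc.2 (LinearMap.ker_eq_bot.1 (Submodule.finrank_eq_zero.1 h))
    have h5 := z.1.2
    -- a second `q`-dimensional subspace between the range and the kernel
    obtain ⟨y, hyk, hyz⟩ : ∃ y ∈ LinearMap.ker (nuTilde z).1, y ∉ z.1.1 := by
      by_contra! hle
      have := Submodule.finrank_mono (show LinearMap.ker (nuTilde z).1 ≤ z.1.1 from hle)
      omega
    have h6 : Module.finrank ℂ ↥(LinearMap.range (nuTilde z).2 ⊔ Submodule.span ℂ {y}) =
        Module.finrank ℂ (LinearMap.range (nuTilde z).2) + 1 :=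
      Submodule.finrank_sup_span_singleton fun h => hyz (range_le_of_nuTilde h)
    obtain ⟨S, hS1, hS2, hS⟩ := exists_submodule_between
      (sup_le (LinearMap.range_le_ker_iff.2 (nuTilde_mem_nullCone z))
        ((Submodule.span_singleton_le_iff_mem _ _).2 hyk)) (d := q)
      (by omega) (by omega)
    obtain ⟨w, hwS, hw⟩ := exists_nuTilde_eq ⟨S, hS⟩ hS2 (le_sup_left.trans hS1)
    have : w = z := hz w (Subtype.ext hw)
    refine hyz ?_
    rw [← this, hwS]
    exact hS1 (Submodule.mem_sup_right (Submodule.mem_span_singleton_self y))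
  · intro hf
    obtain ⟨z, rfl⟩ := surjective_nuNull hp hq hpq f
    exact ⟨z, rfl, fun w hw => (injOn_nuNull hp hq hpq hf hw.symm).symm⟩

theorem isResolution_nuNull (hp : Module.finrank ℂ U₁ = p) (hq : Module.finrank ℂ U₂ = q)
    (hpq : p + q = Module.finrank ℂ V) : IsResolution (tildeN V U₁ U₂ q)
    ((aff (RepW V U₁ U₂)).sub (nullCone V U₁ U₂)) nuNull where
  isVariety := (hasAtlas_tildeN V U₁ U₂ q).isVariety (isSeparated_tildeN V U₁ U₂ q)
  smooth := (hasAtlas_tildeN V U₁ U₂ q).smoothAt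
  proper := isProperMorphism_nuTilde
  birational := isBirational_nuNull hp hq hpq
  one_to_one_iff f := by
    rw [existsUnique_nuNull_iff hp hq hpq]
    constructor
    · intro h
      by_contra hc
      rw [nullConeRegular, Set.mem_ofPred_eq, not_or] at hc
      exact not_smoothAt_nullCone hp hq hpq f hc.1 hc.2 h
    · intro hf
      obtain ⟨z, rfl⟩ := surjective_nuNull hp hq hpq f
      refine (smoothAt_sub_iff isOpen_nullConeRegular ⟨_, hf⟩).1 ?_
      refine ((isIso_nuNull hp hq hpq).smoothAt_iff ⟨z, hf⟩).2 ?_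
      have hmor : IsMorphism (tildeN V U₁ U₂ q) ((aff (RepW V U₁ U₂)).sub (nullCone V U₁ U₂))
        nuNull := (isBirational_nuNull hp hq hpq).1
      exact (smoothAt_sub_iff (hmor.isOpen_preimage isOpen_nullConeRegular) ⟨z, hf⟩).2
        ((hasAtlas_tildeN V U₁ U₂ q).smoothAt z)

end NullConeResolution

/-! ### Resolutions and isomorphisms -/

namespace AlgStr

section Transport

variable {X Y X₀ Y₀ : Type u} {A : AlgStr X} {B : AlgStr Y} {A₀ : AlgStr X₀} {B₀ : AlgStr Y₀}

theorem IsIso.restrict_preimage {φ : X → Y} (h : IsIso A B φ) (U : Set Y) :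
    IsIso (A.sub (φ ⁻¹' U)) (B.sub U) ((Set.mapsTo_preimage φ U).restrict _ _ _) := by
  obtain ⟨ψ, hψ, h1, h2⟩ := h.exists_symm
  refine IsIso.mk (ψ := fun y => ⟨ψ y.1, by rw [Set.mem_preimage, h2]; exact y.2⟩) ?_ ?_ ?_ ?_
  · exact fun x => morAt_sub_iff.2 ((h.1.morAt _).comp (morAt_val _ _ x))
  · exact fun y => morAt_sub_iff.2 ((hψ.1.morAt _).comp (morAt_val _ _ y))
  · exact fun x => Subtype.ext (h1 x.1)
  · exact fun y => Subtype.ext (h2 y.1)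

theorem IsIso.isVariety {φ : X → Y} (h : IsIso A B φ) (hB : IsVariety B) : IsVariety A := by
  obtain ⟨⟨𝒰, hfin, hcov, h𝒰⟩, hsep⟩ := hB
  refine ⟨⟨(fun U => φ ⁻¹' U) '' 𝒰, hfin.image _, ?_, ?_⟩,
    IsSeparated.of_injective hsep h.1 h.bijective.1⟩
  · rw [Set.eq_univ_iff_forall] at *
    intro x
    obtain ⟨U, hU, hx⟩ := hcov (φ x)
    exact ⟨_, ⟨U, hU, rfl⟩, hx⟩
  · rintro _ ⟨U, hU, rfl⟩
    obtain ⟨hUo, n, S, hS, χ, hχ⟩ := h𝒰 U hU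
    exact ⟨h.1.isOpen_preimage hUo, n, S, hS, _, hχ.comp (h.restrict_preimage U)⟩

theorem IsIso.isDense_preimage {φ : X → Y} (h : IsIso A B φ) {U : Set Y} (hU : B.IsDense U) :
    A.IsDense (φ ⁻¹' U) := by
  obtain ⟨ψ, hψ, h1, h2⟩ := h.exists_symm
  refine isDense_iff.2 fun x N hN => ?_
  have hN' : ψ ⁻¹' N ∈ B.nhd (φ x) := (hψ.1.morAt (φ x)).1 (by rwa [h1])
  obtain ⟨y, hyN, hy⟩ := isDense_iff.1 hU _ _ hN'
  exact ⟨ψ y, hyN, by rw [Set.mem_preimage, h2]; exact hy⟩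

/-- Resolutions are invariant under isomorphisms of the source and of the target. -/
theorem IsResolution.of_isIso {g₀ : X₀ → Y₀} {g : X → Y} {φ : X₀ → X} {ψ : Y₀ → Y}
    (h : IsResolution A₀ B₀ g₀) (hφ : IsIso A₀ A φ) (hψ : IsIso B₀ B ψ)
    (hg : ∀ x, g (φ x) = ψ (g₀ x)) : IsResolution A B g := by
  obtain ⟨φ', hφ', h1, h2⟩ := hφ.exists_symm
  obtain ⟨ψ', hψ', h3, h4⟩ := hψ.exists_symm
  have hg' : ∀ x, g x = ψ (g₀ (φ' x)) := fun x => by rw [← hg, h2]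
  have hg'' : ∀ x, ψ' (g x) = g₀ (φ' x) := fun x => by rw [hg', h3]
  have hmor : IsMorphism A B g := by
    rw [funext hg']
    exact isMorphism_comp hψ.1 (isMorphism_comp h.proper.1 hφ'.1)
  refine ⟨hφ'.isVariety h.isVariety, fun x => (hφ'.smoothAt_iff x).1 (h.smooth _), ⟨hmor, ?_⟩,
    ⟨hmor, ?_⟩, fun y => ?_⟩
  · intro Z C hC S hS
    have hS₀ : (A₀.prod C).IsClosed ((fun z => (φ z.1, z.2)) ⁻¹' S) :=
      IsMorphism.isClosed_preimage (isMorphism_iff.2 fun z =>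
        ((hφ.1.morAt _).comp (morAt_fst z)).prodMk (morAt_snd z)) hS
    have hψC : IsMorphism (B.prod C) (B₀.prod C) (fun z => (ψ' z.1, z.2)) :=
      isMorphism_iff.2 fun z => ((hψ'.1.morAt _).comp (morAt_fst z)).prodMk (morAt_snd z)
    convert hψC.isClosed_preimage (h.proper.2 Z C hC _ hS₀) using 1
    ext ⟨y, z⟩
    constructor
    · rintro ⟨⟨x, z⟩, hx, hxy⟩
      obtain ⟨rfl, rfl⟩ := Prod.mk.inj hxy
      refine ⟨(φ' x, z), ?_, Prod.ext (hg'' x).symm rfl⟩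
      rw [Set.mem_preimage, h2]
      exact hx
    · rintro ⟨⟨x, z'⟩, hx, hxy⟩
      obtain ⟨hxy, rfl⟩ := Prod.mk.inj hxy
      have hxy' : g₀ x = ψ' y := hxy
      exact ⟨(φ x, z'), hx, Prod.ext (by change g (φ x) = y; rw [hg, hxy', h4]) rfl⟩
  · obtain ⟨-, U, U', hU, hUd, hU', hUd', hm, hiso⟩ := h.birational
    have hm' : Set.MapsTo g (φ' ⁻¹' U) (ψ' ⁻¹' U') := fun x hx => by
      rw [Set.mem_preimage, hg'']
      exact hm hx
    refine ⟨_, _, hφ'.1.isOpen_preimage hU, hφ'.isDense_preimage hUd, hψ'.1.isOpen_preimage hU',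
      hψ'.isDense_preimage hUd', hm', ?_⟩
    obtain ⟨χ, hχ, hχ1, -⟩ := (hψ'.restrict_preimage U').exists_symm
    convert hχ.comp (hiso.comp (hφ'.restrict_preimage U)) using 1
    funext x
    rw [← hχ1 (hm'.restrict g _ _ x)]
    exact congrArg χ (Subtype.ext (hg'' x.1))
  · rw [← hψ'.smoothAt_iff y, h.one_to_one_iff]
    constructor
    · rintro ⟨x, hx, hu⟩
      refine ⟨φ x, by change g (φ x) = y; rw [hg, hx, h4], fun x' hx' => ?_⟩
      rw [← hu (φ' x') (by change g₀ (φ' x') = ψ' y; rw [← hg'', hx']), h2]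
    · rintro ⟨x, hx, hu⟩
      refine ⟨φ' x, by change g₀ (φ' x) = ψ' y; rw [← hg'', hx], fun x' hx' => ?_⟩
      rw [← hu (φ x') (by change g (φ x') = y; rw [hg, hx', h4]), h1]

end Transport

end AlgStr

theorem mainTheorem6 (V U₁ U₂ : Type u) [AddCommGroup V] [AddCommGroup U₁] [AddCommGroup U₂]
    [Module ℂ V] [Module ℂ U₁] [Module ℂ U₂]
    [FiniteDimensional ℂ V] [FiniteDimensional ℂ U₁] [FiniteDimensional ℂ U₂]
    (p q : ℕ) (hp : p ≤ Module.finrank ℂ U₁) (hq : q ≤ Module.finrank ℂ U₂)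
    (hpq : p + q = Module.finrank ℂ V)
    (hlt : Module.finrank ℂ V < Module.finrank ℂ U₁ + Module.finrank ℂ U₂) :
    -- the varieties and the vector bundle
    (AlgStr.IsVariety (hatBase V U₁ U₂ p q) ∧ AlgStr.IsVariety (hatN V U₁ U₂ p q) ∧
      AlgStr.IsVariety (tildeN V U₁ U₂ q) ∧
      AlgStr.IsVectorBundle (hatN V U₁ U₂ p q) (hatBase V U₁ U₂ p q)) ∧
    -- the map `f_{p,q}` and the two commutative diagrams
    (AlgStr.IsMorphism (hatN V U₁ U₂ p q) (tildeN V U₁ U₂ q) hatToTilde ∧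
      Function.Surjective (hatToTilde : HatN V U₁ U₂ p q → TildeN V U₁ U₂ q) ∧
      AlgStr.IsBirational (hatN V U₁ U₂ p q) (tildeN V U₁ U₂ q) hatToTilde ∧
      (∃ (hν : ∀ z : TildeN V U₁ U₂ q, nuTilde z ∈ nullComponent V U₁ U₂ p q)
          (hν' : ∀ z : HatN V U₁ U₂ p q, nuHat z ∈ nullComponent V U₁ U₂ p q),
        AlgStr.IsMorphism (tildeN V U₁ U₂ q)
          ((AlgStr.aff (RepW V U₁ U₂)).sub (nullComponent V U₁ U₂ p q))
          (fun z => ⟨nuTilde z, hν z⟩) ∧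
        AlgStr.IsMorphism (hatN V U₁ U₂ p q)
          ((AlgStr.aff (RepW V U₁ U₂)).sub (nullComponent V U₁ U₂ p q))
          (fun z => ⟨nuHat z, hν' z⟩) ∧
        ∀ z : HatN V U₁ U₂ p q,
          (⟨nuHat z, hν' z⟩ : nullComponent V U₁ U₂ p q) =
            ⟨nuTilde (hatToTilde z), hν (hatToTilde z)⟩) ∧
      AlgStr.IsMorphism (tildeN V U₁ U₂ q) (grass q V) zetaTilde ∧
      AlgStr.IsMorphism (hatN V U₁ U₂ p q) (hatBase V U₁ U₂ p q) zetaHat ∧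
      AlgStr.IsMorphism (hatBase V U₁ U₂ p q) (grass q V) Prod.fst ∧
      ∀ z : HatN V U₁ U₂ p q, zetaTilde (hatToTilde z) = (zetaHat z).1) ∧
    -- the slices over the points of `Grass_p(U₁) × Grass_{m₂ - q}(U₂)`
    ∀ (X₁ : Gr p U₁) (X₂ : Gr (Module.finrank ℂ U₂ - q) U₂),
      nullSlice V p q X₁.1 X₂.1 =
        {f | f ∈ nullCone V U₁ U₂ ∧ LinearMap.range f.1 ≤ X₁.1 ∧ X₂.1 ≤ LinearMap.ker f.2} ∧
      Module.finrank ℂ X₁.1 + Module.finrank ℂ (U₂ ⧸ X₂.1) ≤ Module.finrank ℂ V ∧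
      (∃ h : ∀ g ∈ nullCone V X₁.1 (U₂ ⧸ X₂.1), reducedIncl V X₁.1 X₂.1 g ∈ nullSlice V p q X₁.1 X₂.1,
        AlgStr.IsIso
          ((AlgStr.aff (RepW V X₁.1 (U₂ ⧸ X₂.1))).sub (nullCone V X₁.1 (U₂ ⧸ X₂.1)))
          ((AlgStr.aff (RepW V U₁ U₂)).sub (nullSlice V p q X₁.1 X₂.1))
          (fun g => ⟨reducedIncl V X₁.1 X₂.1 g.1, h g.1 g.2⟩)) ∧
      (∃ h : ∀ z ∈ (hatSlice (X₁, X₂) : Set (HatN V U₁ U₂ p q)), nuHat z ∈ nullSlice V p q X₁.1 X₂.1,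
        AlgStr.IsResolution
          ((hatN V U₁ U₂ p q).sub (hatSlice (X₁, X₂)))
          ((AlgStr.aff (RepW V U₁ U₂)).sub (nullSlice V p q X₁.1 X₂.1))
          (fun z => ⟨nuHat z.1, h z.1 z.2⟩)) ∧
      AlgStr.IsClosedImmersion ((hatN V U₁ U₂ p q).sub (hatSlice (X₁, X₂)))
        (tildeN V U₁ U₂ q) (fun z => hatToTilde z.1) := by
  have hS : ∀ (X₁ : Gr p U₁) (X₂ : Gr (Module.finrank ℂ U₂ - q) U₂) g,
      reducedIncl V X₁.1 X₂.1 g ∈ nullSlice V p q X₁.1 X₂.1 ↔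
        g ∈ nullCone V X₁.1 (U₂ ⧸ X₂.1) :=
    fun X₁ X₂ _ => reducedIncl_mem_nullSlice_iff X₁ X₂ hp hq hpq
  refine ⟨⟨?_, ?_, ?_, ?_⟩, ⟨isMorphism_hatToTilde, surjective_hatToTilde hp hq hpq,
    isBirational_hatToTilde hp hq hpq, ⟨nuTilde_mem_nullComponent hp hq hpq,
      fun z => nuTilde_mem_nullComponent hp hq hpq (hatToTilde z), ?_, ?_, fun _ => rfl⟩,
    isMorphism_zetaTilde V U₁ U₂ q, isMorphism_zetaHat V U₁ U₂ p q, AlgStr.isMorphism_fst,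
    fun _ => rfl⟩, fun X₁ X₂ => ⟨nullSlice_eq X₁ X₂ hp hq hpq, ?_,
    ⟨fun g hg => (hS X₁ X₂ g).2 hg, isIso_nullCone_nullSlice X₁ X₂ (hS X₁ X₂)⟩, ?_,
    isClosedImmersion_slice X₁ X₂⟩⟩
  · exact (hasAtlas_hatBase V U₁ U₂ p q).isVariety (isSeparated_hatBase V U₁ U₂ p q)
  · exact ((hasAtlas_hatBase V U₁ U₂ p q).total (isMorphism_zetaHat V U₁ U₂ p q)).isVariety
      (isSeparated_hatN V U₁ U₂ p q)
  · exact (hasAtlas_tildeN V U₁ U₂ q).isVariety (isSeparated_tildeN V U₁ U₂ q)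
  · exact (hasAtlas_hatBase V U₁ U₂ p q).isVectorBundle (isMorphism_zetaHat V U₁ U₂ p q)
  · exact AlgStr.isMorphism_iff.2 fun z => AlgStr.morAt_sub_iff.2 (isMorphism_nuTilde.morAt z)
  · exact AlgStr.isMorphism_iff.2 fun z => AlgStr.morAt_sub_iff.2 (isMorphism_nuHat.morAt z)
  · rw [X₁.2, finrank_quotient_slice X₂ hq, hpq]
  · have hmem : ∀ z ∈ (hatSlice (X₁, X₂) : Set (HatN V U₁ U₂ p q)),
        nuHat z ∈ nullSlice V p q X₁.1 X₂.1 := by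
      intro z hz
      obtain ⟨w, hw⟩ := (bijective_tildeToSlice X₁ X₂).2 ⟨z, hz⟩
      have hw' : nuHat z = reducedIncl V X₁.1 X₂.1 (nuTilde w) := by
        rw [← nuHat_tildeToSlice, hw]
      rw [hw']
      exact (hS X₁ X₂ _).2 (nuTilde_mem_nullCone w)
    exact ⟨hmem, (isResolution_nuNull X₁.2 (finrank_quotient_slice X₂ hq) hpq).of_isIso
      (isIso_tildeToSlice X₁ X₂) (isIso_nullCone_nullSlice X₁ X₂ (hS X₁ X₂)) fun _ => rfl⟩
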